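/- Let $m\ge 2$, let $n=2m-1$, and let $(\mathbb{CP}^m,g_{FS})$ be complex projective space of complex dimension $m$ with the Fubini--Study metric, normalized so that its sectional curvatures lie between $1$ and $4$, and with its complex structure $J$. Let $M^n$ be a closed (compact, without boundary, not necessarily connected) smooth embedded hypersurface of $\mathbb{CP}^m$ that is minimal, i.e. the trace of its second fundamental form vanishes identically; give $M$ the induced Riemannian metric. Let $\omega$ be a harmonic one-form on $M$, i.e. a smooth one-form with $(dd^*+d^*d)\,\omega=0$, where $d^*$ is the formal adjoint of the exterior differential $d$ with respect to the induced metric. Suppose that at each point $x\in M$ the covector $\omega_x$ is a real multiple of $(JN)^\flat$, where $N$ is a unit normal vector of $M$ at $x$ and $(JN)^\flat=g_{FS}(JN,\cdot)|_{T_xM}$. Then $\omega$ vanishes identically on $M$. -/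

import Mathlib

open scoped Manifold ContDiff Topology LinearAlgebra.Projectivization

noncomputable section

/-! ### Complex projective space as a smooth manifold -/

/-- Complex projective space `ℂP^m`: the complex lines in `ℂ^(m+1)`. -/
def ComplexProjectiveSpace (m : ℕ) : Type :=
  ℙ ℂ (EuclideanSpace ℂ (Fin (m + 1)))

namespace ComplexProjectiveSpace

variable {m : ℕ}

/-- The point `[Z₀ : … : Z_m]` with homogeneous coordinates `Z ≠ 0`. -/
def proj (Z : {Z : EuclideanSpace ℂ (Fin (m + 1)) // Z ≠ 0}) : ComplexProjectiveSpace m :=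
  Projectivization.mk' ℂ Z

/-- The quotient topology. -/
instance : TopologicalSpace (ComplexProjectiveSpace m) :=
  TopologicalSpace.coinduced proj inferInstance

theorem isQuotientMap_proj : Topology.IsQuotientMap (proj (m := m)) :=
  ⟨⟨rfl⟩, Quotient.mk''_surjective⟩

/-- The vector with entry `1` in position `j` and with the entries of `z` in the others. -/
def affineLift (j : Fin (m + 1)) (z : EuclideanSpace ℂ (Fin m)) :
    EuclideanSpace ℂ (Fin (m + 1)) :=
  WithLp.toLp 2 (j.insertNth (α := fun _ => ℂ) 1 z.ofLp)

theorem affineLift_self (j : Fin (m + 1)) (z : EuclideanSpace ℂ (Fin m)) :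
    affineLift j z j = 1 := by
  simp [affineLift]

theorem affineLift_succAbove (j : Fin (m + 1)) (z : EuclideanSpace ℂ (Fin m)) (i : Fin m) :
    affineLift j z (j.succAbove i) = z i := by
  simp [affineLift]

theorem affineLift_ne_zero (j : Fin (m + 1)) (z : EuclideanSpace ℂ (Fin m)) :
    affineLift j z ≠ 0 := by
  intro h
  have := affineLift_self j z
  rw [h] at this
  simp at this

theorem contDiff_affineLift (j : Fin (m + 1)) : ContDiff ℂ ∞ (affineLift j) := by
  rw [contDiff_euclidean]
  intro k
  rcases Fin.eq_self_or_eq_succAbove j k with rfl | ⟨i, rfl⟩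
  · simp only [affineLift_self]
    exact contDiff_const
  · simp only [affineLift_succAbove]
    fun_prop

/-- Affine coordinates `(Z_i / Z_j)_{i ≠ j}` of the vector `Z`. -/
def affineCoord (j : Fin (m + 1)) (Z : EuclideanSpace ℂ (Fin (m + 1))) :
    EuclideanSpace ℂ (Fin m) :=
  WithLp.toLp 2 fun i => Z (j.succAbove i) / Z j

theorem affineCoord_smul (j : Fin (m + 1)) (t : ℂ) (ht : t ≠ 0)
    (Z : EuclideanSpace ℂ (Fin (m + 1))) : affineCoord j (t • Z) = affineCoord j Z := by
  ext i
  simp [affineCoord, mul_div_mul_left _ _ ht]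

theorem contDiffOn_affineCoord (j : Fin (m + 1)) :
    ContDiffOn ℂ ∞ (affineCoord j) {Z | Z j ≠ 0} := by
  rw [contDiffOn_euclidean]
  intro i
  simp only [affineCoord]
  refine ContDiffOn.div ?_ ?_ (fun Z hZ => hZ)
  · exact ContDiff.contDiffOn (by fun_prop)
  · exact ContDiff.contDiffOn (by fun_prop)

theorem rep_proj (Z : {Z : EuclideanSpace ℂ (Fin (m + 1)) // Z ≠ 0}) :
    ∃ t : ℂ, t ≠ 0 ∧ Projectivization.rep (proj Z) = t • Z.1 := by
  obtain ⟨a, ha⟩ := Projectivization.exists_smul_eq_mk_rep ℂ Z.1 Z.2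
  exact ⟨a, a.ne_zero, ha.symm⟩

theorem preimage_rep_ne_zero (j : Fin (m + 1)) :
    proj ⁻¹' {p : ComplexProjectiveSpace m | Projectivization.rep p j ≠ 0}
      = {Z : {Z : EuclideanSpace ℂ (Fin (m + 1)) // Z ≠ 0} | Z.1 j ≠ 0} := by
  ext Z
  obtain ⟨t, ht, h⟩ := rep_proj Z
  simp [h, ht]

theorem isOpen_rep_ne_zero (j : Fin (m + 1)) :
    IsOpen {p : ComplexProjectiveSpace m | Projectivization.rep p j ≠ 0} := by
  rw [← isQuotientMap_proj.isOpen_preimage, preimage_rep_ne_zero]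
  exact isOpen_ne_fun (by fun_prop) continuous_const

/-- The affine chart `[Z₀ : … : Z_m] ↦ (Z_i / Z_j)_{i ≠ j}` on the open set `{Z_j ≠ 0}`. -/
def affineChart (j : Fin (m + 1)) :
    OpenPartialHomeomorph (ComplexProjectiveSpace m) (EuclideanSpace ℂ (Fin m)) where
  toFun p := affineCoord j (Projectivization.rep p)
  invFun z := proj ⟨affineLift j z, affineLift_ne_zero j z⟩
  source := {p | Projectivization.rep p j ≠ 0}
  target := Set.univ
  map_source' _ _ := Set.mem_univ _
  map_target' z _ := by
    obtain ⟨t, ht, h⟩ := rep_proj ⟨affineLift j z, affineLift_ne_zero j z⟩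
    simp [h, ht, affineLift_self]
  left_inv' p hp := by
    have hp' : Projectivization.rep p j ≠ 0 := hp
    conv_rhs => rw [← Projectivization.mk_rep p]
    refine (Projectivization.mk_eq_mk_iff' ℂ _ _ _ _).2 ⟨(Projectivization.rep p j)⁻¹, ?_⟩
    ext k
    rcases Fin.eq_self_or_eq_succAbove j k with rfl | ⟨i, rfl⟩
    · rw [affineLift_self]
      simp [hp']
    · rw [affineLift_succAbove]
      simp [affineCoord, div_eq_inv_mul]
  right_inv' z _ := by
    obtain ⟨t, ht, h⟩ := rep_proj ⟨affineLift j z, affineLift_ne_zero j z⟩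
    rw [h, affineCoord_smul j t ht]
    ext i
    simp [affineCoord, affineLift_self, affineLift_succAbove]
  open_source := isOpen_rep_ne_zero j
  open_target := isOpen_univ
  continuousOn_toFun := by
    rw [isQuotientMap_proj.continuousOn_isOpen_iff (isOpen_rep_ne_zero j), preimage_rep_ne_zero]
    have hfun : (fun p : ComplexProjectiveSpace m => affineCoord j (Projectivization.rep p)) ∘ proj
        = affineCoord j ∘ Subtype.val := by
      funext Z
      obtain ⟨t, ht, h⟩ := rep_proj Z
      simp [h, affineCoord_smul j t ht]
    rw [hfun]
    exact (contDiffOn_affineCoord j).continuousOn.comp continuous_subtype_val.continuousOn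
      (fun Z hZ => hZ)
  continuousOn_invFun :=
    (isQuotientMap_proj.continuous.comp
      ((contDiff_affineLift j).continuous.subtype_mk _)).continuousOn

theorem exists_rep_ne_zero (p : ComplexProjectiveSpace m) :
    ∃ j, Projectivization.rep p j ≠ 0 := by
  by_contra! h
  exact Projectivization.rep_nonzero p (by ext j; simpa using h j)

/-- The smooth structure given by the `m + 1` affine charts. -/
instance : ChartedSpace (EuclideanSpace ℂ (Fin m)) (ComplexProjectiveSpace m) where
  atlas := Set.range affineChart
  chartAt p := affineChart (exists_rep_ne_zero p).choose
  mem_chart_source p := (exists_rep_ne_zero p).choose_spec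
  chart_mem_atlas _ := Set.mem_range_self _

/-- `ℂP^m` as a real smooth manifold of dimension `2m`. -/
instance : IsManifold 𝓘(ℝ, EuclideanSpace ℂ (Fin m)) ∞ (ComplexProjectiveSpace m) := by
  apply isManifold_of_contDiffOn
  rintro _ _ ⟨j, rfl⟩ ⟨k, rfl⟩
  have key : ∀ z : EuclideanSpace ℂ (Fin m),
      affineChart k ((affineChart j).symm z) = affineCoord k (affineLift j z) := by
    intro z
    obtain ⟨t, ht, h⟩ := rep_proj ⟨affineLift j z, affineLift_ne_zero j z⟩
    change affineCoord k (Projectivization.rep (proj _)) = _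
    rw [h, affineCoord_smul k t ht]
  have hs : ContDiffOn ℂ ∞ (fun z => affineCoord k (affineLift j z))
      {z | affineLift j z k ≠ 0} :=
    (contDiffOn_affineCoord k).comp (contDiff_affineLift j).contDiffOn (fun z hz => hz)
  refine ((hs.restrict_scalars ℝ).congr (fun z _ => key z)).mono ?_
  rintro z ⟨hz, -⟩
  have hz' : Projectivization.rep ((affineChart j).symm z) k ≠ 0 := by
    simpa [affineChart] using hz
  obtain ⟨t, ht, h⟩ := rep_proj ⟨affineLift j z, affineLift_ne_zero j z⟩
  change Projectivization.rep (proj _) k ≠ 0 at hz'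
  rw [h] at hz'
  intro h0
  exact hz' (by simp [h0])

/-! ### Fubini–Study metric and complex structure

The tangent space at `p` is identified with `ℂ^m` by the affine chart `chartAt _ p`. All affine
charts give the same metric and the same complex structure. -/

/-- The Fubini–Study metric in an affine chart, at the point with affine coordinates `z`:
`Re ((1 + |z|²) ⟨v, w⟩ - ⟨v, z⟩ ⟨z, w⟩) / (1 + |z|²)²`. It is normalized so that the
sectional curvatures lie between `1` and `4` when `2 ≤ m`. -/
def affineFubiniStudy (z v w : EuclideanSpace ℂ (Fin m)) : ℝ :=
  (((1 + ‖z‖ ^ 2 : ℝ) : ℂ) * inner ℂ v w - inner ℂ v z * inner ℂ z w).re / (1 + ‖z‖ ^ 2) ^ 2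

/-- The Fubini–Study metric `g_FS` on the tangent space at `p`. -/
def fubiniStudy (p : ComplexProjectiveSpace m)
    (v w : TangentSpace 𝓘(ℝ, EuclideanSpace ℂ (Fin m)) p) : ℝ :=
  affineFubiniStudy (chartAt (EuclideanSpace ℂ (Fin m)) p p) v w

/-- The complex structure `J` on the tangent space at `p`: multiplication by `i`. -/
def complexStructure (p : ComplexProjectiveSpace m)
    (v : TangentSpace 𝓘(ℝ, EuclideanSpace ℂ (Fin m)) p) :
    TangentSpace 𝓘(ℝ, EuclideanSpace ℂ (Fin m)) p :=
  (fun z : EuclideanSpace ℂ (Fin m) => Complex.I • z) v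

end ComplexProjectiveSpace

/-! ### Tensors in a chart -/

namespace ChartGeometry

section Tensors

variable {E : Type*} [NormedAddCommGroup E] [NormedSpace ℝ E]
  {M : Type*} [TopologicalSpace M] [ChartedSpace E M]

/-- The tangent vector of `M` at the point with coordinates `y` in the chart `e` whose coordinate
vector is `v`. -/
def coordVec (e : OpenPartialHomeomorph M E) (y v : E) : TangentSpace 𝓘(ℝ, E) (e.symm y) :=
  mfderiv 𝓘(ℝ, E) 𝓘(ℝ, E) e.symm y v

/-- The metric `g` of `M` in the chart `e`. -/
def chartMetric (g : ∀ x : M, TangentSpace 𝓘(ℝ, E) x → TangentSpace 𝓘(ℝ, E) x → ℝ)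
    (e : OpenPartialHomeomorph M E) (y v w : E) : ℝ :=
  g (e.symm y) (coordVec e y v) (coordVec e y w)

/-- Christoffel symbols of the first kind, `Γ(u, v; w) = g(∇_u v, w)` for constant vector fields
`u, v, w`, of the metric `h` on an open subset of `E`. -/
def christoffelFirst (h : E → E → E → ℝ) (y u v w : E) : ℝ :=
  (fderiv ℝ (fun z => h z v w) y u + fderiv ℝ (fun z => h z u w) y v
    - fderiv ℝ (fun z => h z u v) y w) / 2

end Tensors

/-! ### Hodge Laplacian on one-forms in coordinates -/

section Coordinates

variable {n : ℕ}

/-- The `i`-th coordinate vector. -/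
def basisVec (i : Fin n) : EuclideanSpace ℝ (Fin n) := EuclideanSpace.single i 1

/-- The `i`-th partial derivative. -/
def partialDeriv (i : Fin n) (f : EuclideanSpace ℝ (Fin n) → ℝ) (y : EuclideanSpace ℝ (Fin n)) :
    ℝ :=
  fderiv ℝ f y (basisVec i)

/-- Christoffel symbols of the second kind `Γ^k_{ij}` of the metric with matrix `G`. -/
def christoffel (G : EuclideanSpace ℝ (Fin n) → Matrix (Fin n) (Fin n) ℝ)
    (y : EuclideanSpace ℝ (Fin n)) (k i j : Fin n) : ℝ :=
  ∑ l, (G y)⁻¹ k l * ((partialDeriv i (fun z => G z j l) y + partialDeriv j (fun z => G z i l) y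
    - partialDeriv l (fun z => G z i j) y) / 2)

/-- `∇_i w_j` for the one-form `w`. -/
def covDerivOne (G : EuclideanSpace ℝ (Fin n) → Matrix (Fin n) (Fin n) ℝ)
    (w : EuclideanSpace ℝ (Fin n) → Fin n → ℝ) (y : EuclideanSpace ℝ (Fin n)) (i j : Fin n) : ℝ :=
  partialDeriv i (fun z => w z j) y - ∑ k, christoffel G y k i j * w y k

/-- `∇_k β_{ij}` for the two-form `β`. -/
def covDerivTwo (G : EuclideanSpace ℝ (Fin n) → Matrix (Fin n) (Fin n) ℝ)
    (β : EuclideanSpace ℝ (Fin n) → Fin n → Fin n → ℝ) (y : EuclideanSpace ℝ (Fin n))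
    (k i j : Fin n) : ℝ :=
  partialDeriv k (fun z => β z i j) y - ∑ l, christoffel G y l k i * β y l j
    - ∑ l, christoffel G y l k j * β y i l

/-- The exterior differential `(dw)_{ij} = ∂_i w_j - ∂_j w_i` of a one-form. -/
def extDerivOne (w : EuclideanSpace ℝ (Fin n) → Fin n → ℝ) (y : EuclideanSpace ℝ (Fin n))
    (i j : Fin n) : ℝ :=
  partialDeriv i (fun z => w z j) y - partialDeriv j (fun z => w z i) y

/-- The codifferential `d* w = - g^{ij} ∇_i w_j` of a one-form, the formal adjoint of `d` on
functions. -/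
def codiffOne (G : EuclideanSpace ℝ (Fin n) → Matrix (Fin n) (Fin n) ℝ)
    (w : EuclideanSpace ℝ (Fin n) → Fin n → ℝ) (y : EuclideanSpace ℝ (Fin n)) : ℝ :=
  -∑ i, ∑ j, (G y)⁻¹ i j * covDerivOne G w y i j

/-- The codifferential `(d* β)_j = - g^{ki} ∇_k β_{ij}` of a two-form, the formal adjoint of `d` on
one-forms. -/
def codiffTwo (G : EuclideanSpace ℝ (Fin n) → Matrix (Fin n) (Fin n) ℝ)
    (β : EuclideanSpace ℝ (Fin n) → Fin n → Fin n → ℝ) (y : EuclideanSpace ℝ (Fin n))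
    (j : Fin n) : ℝ :=
  -∑ k, ∑ i, (G y)⁻¹ k i * covDerivTwo G β y k i j

/-- The Hodge Laplacian `(d d* + d* d) w` of a one-form. -/
def hodgeLaplacianOne (G : EuclideanSpace ℝ (Fin n) → Matrix (Fin n) (Fin n) ℝ)
    (w : EuclideanSpace ℝ (Fin n) → Fin n → ℝ) (y : EuclideanSpace ℝ (Fin n)) (j : Fin n) : ℝ :=
  partialDeriv j (codiffOne G w) y + codiffTwo G (extDerivOne w) y j

end Coordinates

/-! ### Harmonic one-forms and minimal immersions -/

section Manifold

variable {n : ℕ} {M : Type*} [TopologicalSpace M] [ChartedSpace (EuclideanSpace ℝ (Fin n)) M]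

/-- The matrix `g_{ij}` of the metric `g` in the chart `e`. -/
def metricMatrix (g : ∀ x : M, TangentSpace (𝓡 n) x → TangentSpace (𝓡 n) x → ℝ)
    (e : OpenPartialHomeomorph M (EuclideanSpace ℝ (Fin n))) (y : EuclideanSpace ℝ (Fin n)) :
    Matrix (Fin n) (Fin n) ℝ :=
  Matrix.of fun i j => chartMetric g e y (basisVec i) (basisVec j)

/-- The components `α_i` of the one-form `α` in the chart `e`. -/
def formComponents (α : ∀ x : M, TangentSpace (𝓡 n) x →L[ℝ] ℝ)
    (e : OpenPartialHomeomorph M (EuclideanSpace ℝ (Fin n))) (y : EuclideanSpace ℝ (Fin n))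
    (i : Fin n) : ℝ :=
  α (e.symm y) (coordVec e y (basisVec i))

/-- A smooth one-form: its components in every smooth chart are smooth. -/
def IsSmoothOneForm (α : ∀ x : M, TangentSpace (𝓡 n) x →L[ℝ] ℝ) : Prop :=
  ∀ e ∈ IsManifold.maximalAtlas (𝓡 n) ∞ M, ∀ i,
    ContDiffOn ℝ ∞ (fun y => formComponents α e y i) e.target

/-- A harmonic one-form for the metric `g`: a smooth one-form with `(d d* + d* d) α = 0`. -/
def IsHarmonicOneForm (g : ∀ x : M, TangentSpace (𝓡 n) x → TangentSpace (𝓡 n) x → ℝ)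
    (α : ∀ x : M, TangentSpace (𝓡 n) x →L[ℝ] ℝ) : Prop :=
  IsSmoothOneForm α ∧
    ∀ e ∈ IsManifold.maximalAtlas (𝓡 n) ∞ M, ∀ y ∈ e.target, ∀ j,
      hodgeLaplacianOne (metricMatrix g e) (formComponents α e) y j = 0

variable {E : Type*} [NormedAddCommGroup E] [NormedSpace ℝ E]
  {N : Type*} [TopologicalSpace N] [ChartedSpace E N]

/-- The metric on `M` induced by the metric `h` on `N` through `F : M → N`. -/
def inducedMetric (h : ∀ p : N, TangentSpace 𝓘(ℝ, E) p → TangentSpace 𝓘(ℝ, E) p → ℝ)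
    (F : M → N) (x : M) (v w : TangentSpace (𝓡 n) x) : ℝ :=
  h (F x) (mfderiv (𝓡 n) 𝓘(ℝ, E) F x v) (mfderiv (𝓡 n) 𝓘(ℝ, E) F x w)

/-- `h(∇_u dF(v), ν)`, where `∇` is the Levi-Civita connection of the metric `h` of `N`, for the map
`F : M → N` written in a chart `e` of `M` and a chart `e'` of `N`, at the point with coordinates
`y`: in coordinates `∇_u dF(v) = D²F(u, v) + Γ(DF u, DF v)`. For `ν` normal to `F` this is
the second fundamental form of `F` in the direction `ν`. -/
def secondFundamentalForm
    (h : ∀ p : N, TangentSpace 𝓘(ℝ, E) p → TangentSpace 𝓘(ℝ, E) p → ℝ)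
    (F : M → N) (e : OpenPartialHomeomorph M (EuclideanSpace ℝ (Fin n)))
    (e' : OpenPartialHomeomorph N E) (y u v : EuclideanSpace ℝ (Fin n)) (ν : E) : ℝ :=
  let f : EuclideanSpace ℝ (Fin n) → E := fun z => e' (F (e.symm z))
  chartMetric h e' (f y) (fderiv ℝ (fun z => fderiv ℝ f z v) y u) ν
    + christoffelFirst (chartMetric h e') (f y) (fderiv ℝ f y u) (fderiv ℝ f y v) ν

/-- `F : M → N` is minimal for the metric `h` of `N`: the trace, for the induced metric, of its
second fundamental form vanishes in every normal direction at every point. -/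
def IsMinimal (h : ∀ p : N, TangentSpace 𝓘(ℝ, E) p → TangentSpace 𝓘(ℝ, E) p → ℝ)
    (F : M → N) : Prop :=
  ∀ e ∈ IsManifold.maximalAtlas (𝓡 n) ∞ M, ∀ e' ∈ IsManifold.maximalAtlas 𝓘(ℝ, E) ∞ N,
    ∀ y ∈ e.target, F (e.symm y) ∈ e'.source →
      ∀ ν : E,
        (∀ v, chartMetric h e' (e' (F (e.symm y)))
          (fderiv ℝ (fun z => e' (F (e.symm z))) y v) ν = 0) →
        ∑ i, ∑ j, (metricMatrix (inducedMetric h F) e y)⁻¹ i j *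
          secondFundamentalForm h F e e' y (basisVec i) (basisVec j) ν = 0

/-- `ν` is a unit normal vector of `F : M → N` at `x`. -/
def IsUnitNormal (h : ∀ p : N, TangentSpace 𝓘(ℝ, E) p → TangentSpace 𝓘(ℝ, E) p → ℝ)
    (F : M → N) (x : M) (ν : TangentSpace 𝓘(ℝ, E) (F x)) : Prop :=
  h (F x) ν ν = 1 ∧
    ∀ v : TangentSpace (𝓡 n) x, h (F x) ν (mfderiv (𝓡 n) 𝓘(ℝ, E) F x v) = 0

end Manifold

end ChartGeometry

end

/-! A harmonic one-form on a closed manifold is closed, because integrating the pairing of its Hodge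
Laplacian with the form gives the squared norms of `d` and `d*` of it. So let ω = R g(JN, ·) with dω
= 0, and let T be the complex linear functional on the ambient tangent space with real part R g(JN,
·). On tangent vectors of M its imaginary part vanishes, since J(JN) = -N is normal; hence T
restricts to ω on M.

Where R ≠ 0 the kernel of ω is the maximal complex subspace of TM, and dω = 0 makes it integrable: M
is foliated there by complex hypersurfaces. Closedness says moreover that T is holomorphic along the
leaves (`complexify_fderiv_of_I_smul`), so x ↦ (x, T) is a CR map into the holomorphic cotangent
bundle of projective space. In affine coordinates z this bundle is mapped to square matrices of size
m + 1 by Ψ = (1, z) ⊗ (-T z, T), and the Euclidean norm of Ψ is the Fubini–Study norm of T, which is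
|R| (`fubiniStudy_dual_norm`).

Thus R² = ‖Ψ‖² is plurisubharmonic along the leaves. At a maximum with R ≠ 0 the derivative of Ψ
along the leaf must vanish. But a nonzero Ψ determines the point z, so the differential of the
immersion would vanish on the leaf directions, which exist because the leaves have complex dimension
m - 1 ≥ 1. This contradiction is `eq_zero_of_closed_of_isLocalMax`. Since R² = |ω|² is continuous on
the compact M, it has a maximum, and so R = 0 everywhere.

The leaves are never constructed: `fderiv_eq_zero_of_isLocalMax_norm_sq` is the maximum principle
for a pair of vector fields X, JX, and integrability enters only through the bracket. The closedness
of harmonic forms, `extDerivOne_eq_zero_of_harmonic`, is proved from the coordinate definitions: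
both codifferentials are put in divergence form, which gives a pointwise energy identity, and this
is integrated with a partition of unity. -/

noncomputable section

/-! ### A maximum principle for CR maps -/

section CauchyRiemann

variable {E : Type*} [NormedAddCommGroup E] [NormedSpace ℝ E]
  {H : Type*} [NormedAddCommGroup H] [InnerProductSpace ℂ H]

/-- If the second derivative were positive, `a` would be a local minimum too. Then `g` would be
constant near `a` and its second derivative zero. -/
theorem deriv_deriv_nonpos_of_isLocalMax {g : ℝ → ℝ} {a : ℝ} (hg : ContDiffAt ℝ 2 g a)
    (hmax : IsLocalMax g a) : deriv (deriv g) a ≤ 0 := by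
  by_contra! h
  have h0 : deriv g a = 0 := hmax.deriv_eq_zero
  have hmin := isLocalMin_of_deriv_deriv_pos h h0 hg.continuousAt
  have heq : g =ᶠ[𝓝 a] fun _ => g a := by
    filter_upwards [hmax, hmin] with x h1 h2 using le_antisymm h1 h2
  have h1 : deriv g =ᶠ[𝓝 a] fun _ => 0 := by
    filter_upwards [heq.eventuallyEq_nhds] with x hx
    rw [hx.deriv_eq]; simp
  rw [h1.deriv_eq] at h
  simp at h

/-- At a local maximum of `‖Ψ‖²` the first derivative of `Ψ` is orthogonal to `Ψ`. -/
theorem re_inner_fderiv_eq_zero_of_isLocalMax {Ψ : E → H} {p : E} (hΨ : ContDiffAt ℝ 2 Ψ p)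
    (hmax : IsLocalMax (fun y => ‖Ψ y‖ ^ 2) p) (v : E) :
    (inner ℂ (Ψ p) (fderiv ℝ Ψ p v)).re = 0 := by
  let _ : InnerProductSpace ℝ H := InnerProductSpace.complexToReal
  have h1 : HasFDerivAt Ψ (fderiv ℝ Ψ p) p :=
    (hΨ.differentiableAt (by norm_num)).hasFDerivAt
  have h2 := h1.norm_sq
  have h3 := hmax.hasFDerivAt_eq_zero h2
  have h4 := congrArg (fun L => L v) h3
  simp [real_inner_eq_re_inner ℂ] at h4
  exact h4

/-- At a local maximum of `‖Ψ‖²` the second derivative of `‖Ψ‖²` is nonpositive. -/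
theorem re_inner_fderiv_fderiv_le_of_isLocalMax {Ψ : E → H} {p : E} (hΨ : ContDiffAt ℝ 2 Ψ p)
    (hmax : IsLocalMax (fun y => ‖Ψ y‖ ^ 2) p) (v : E) :
    ‖fderiv ℝ Ψ p v‖ ^ 2 + (inner ℂ (Ψ p) (fderiv ℝ (fderiv ℝ Ψ) p v v)).re ≤ 0 := by
  let _ : InnerProductSpace ℝ H := InnerProductSpace.complexToReal
  -- Along this line the second derivative of `‖Ψ‖²` at `0` is twice the left-hand side of the
  -- claim.
  set ℓ : ℝ → E := fun t => p + t • v with hℓ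
  have hℓ0 : ℓ 0 = p := by simp [hℓ]
  have hℓd : ∀ t, HasDerivAt ℓ v t := fun t => by
    simpa [hℓ] using ((hasDerivAt_id t).smul_const v).const_add p
  have hℓc : ContDiff ℝ 2 ℓ := by fun_prop
  have hcont : Filter.Tendsto ℓ (𝓝 0) (𝓝 p) := by
    have := hℓc.continuous.tendsto 0
    rwa [hℓ0] at this
  set g : ℝ → ℝ := fun t => ‖Ψ (ℓ t)‖ ^ 2 with hg
  have hgmax : IsLocalMax g 0 := by
    have := hcont.eventually hmax
    filter_upwards [this] with t ht
    simpa [hg, hℓ0] using ht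
  have hcomp : ContDiffAt ℝ 2 (fun t => Ψ (ℓ t)) 0 :=
    ContDiffAt.comp (0 : ℝ) (by rwa [hℓ0]) hℓc.contDiffAt
  have hgc : ContDiffAt ℝ 2 g 0 := hcomp.norm_sq ℝ
  have h0 := deriv_deriv_nonpos_of_isLocalMax hgc hgmax
  have hev : ∀ᶠ y in 𝓝 p, DifferentiableAt ℝ Ψ y := by
    have := hΨ.eventually (by norm_num)
    filter_upwards [this] with y hy using hy.differentiableAt (by norm_num)
  have hd1 : ∀ᶠ t in 𝓝 (0 : ℝ), HasDerivAt (fun t => Ψ (ℓ t)) (fderiv ℝ Ψ (ℓ t) v) t := by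
    filter_upwards [hcont.eventually hev] with t ht
    exact ht.hasFDerivAt.comp_hasDerivAt t (hℓd t)
  have hd2 : deriv g =ᶠ[𝓝 0] fun t => 2 * inner ℝ (Ψ (ℓ t)) (fderiv ℝ Ψ (ℓ t) v) := by
    filter_upwards [hd1] with t ht
    exact ht.norm_sq.deriv
  have hd3 : HasDerivAt (fun t => fderiv ℝ Ψ (ℓ t) v) (fderiv ℝ (fderiv ℝ Ψ) p v v) 0 := by
    have h1 : HasFDerivAt (fderiv ℝ Ψ) (fderiv ℝ (fderiv ℝ Ψ) p) (ℓ 0) := by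
      rw [hℓ0]
      exact ((hΨ.fderiv_right (m := 1) (by norm_num)).differentiableAt (by norm_num)).hasFDerivAt
    have h2 := h1.comp_hasDerivAt (0 : ℝ) (hℓd 0)
    have h3 := h2.clm_apply (hasDerivAt_const (0 : ℝ) v)
    simpa using h3
  have hd4 := ((hd1.self_of_nhds.inner ℝ hd3).const_mul 2).deriv
  rw [hd2.deriv_eq, hd4, hℓ0] at h0
  have h5 : inner ℝ (fderiv ℝ Ψ p v) (fderiv ℝ Ψ p v) = ‖fderiv ℝ Ψ p v‖ ^ 2 :=
    real_inner_self_eq_norm_sq _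
  rw [h5, real_inner_eq_re_inner ℂ] at h0
  simp only [RCLike.re_to_complex] at h0
  linarith

/-- Maximum principle for CR maps. If `DΨ (Y) = i DΨ (X)` near `p` for vector fields `X`, `Y`, and
`DΨ` maps the direction of the bracket `[Y, X]` and another direction `W` in the same way, then
`‖Ψ‖²` can only have a local maximum at `p` if `DΨ (X) = 0` at `p`. -/
theorem fderiv_eq_zero_of_isLocalMax_norm_sq {Ψ : E → H} {p : E} (hΨ : ContDiffAt ℝ 2 Ψ p)
    (hmax : IsLocalMax (fun y => ‖Ψ y‖ ^ 2) p) {X Y : E → E}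
    (hX : DifferentiableAt ℝ X p) (hY : DifferentiableAt ℝ Y p)
    (hCR : ∀ᶠ y in 𝓝 p, fderiv ℝ Ψ y (Y y) = Complex.I • fderiv ℝ Ψ y (X y))
    {W : E} (hW : fderiv ℝ Ψ p W =
      Complex.I • fderiv ℝ Ψ p (fderiv ℝ X p (Y p) - fderiv ℝ Y p (X p))) :
    fderiv ℝ Ψ p (X p) = 0 := by
  have hD : HasFDerivAt (fderiv ℝ Ψ) (fderiv ℝ (fderiv ℝ Ψ) p) p :=
    ((hΨ.fderiv_right (m := 1) (by norm_num)).differentiableAt (by norm_num)).hasFDerivAt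
  have ha := hD.clm_apply hX.hasFDerivAt
  have hb := hD.clm_apply hY.hasFDerivAt
  have ha' := ha.const_smul Complex.I
  have hb' := ha'.congr_of_eventuallyEq (f₁ := fun y => fderiv ℝ Ψ y (Y y)) hCR
  have heq := hb.unique hb'
  have e1 := congrArg (fun L => L (Y p)) heq
  have e2 := congrArg (fun L => Complex.I • L (X p)) heq
  have hsymm : fderiv ℝ (fderiv ℝ Ψ) p (X p) (Y p) = fderiv ℝ (fderiv ℝ Ψ) p (Y p) (X p) :=
    (hΨ.isSymmSndFDerivAt (by simp)).eq _ _
  simp only [add_apply, ContinuousLinearMap.comp_apply,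
    ContinuousLinearMap.flip_apply, smul_apply] at e1 e2
  rw [smul_smul, Complex.I_mul_I, hsymm] at e2
  -- Differentiate the CR equation along `Y` and along `X`, and multiply the latter by `i`. In the
  -- sum the mixed second derivatives cancel by symmetry, so the Laplacian of `Ψ` in the plane of
  -- `X`, `Y` is of first order.
  have hsum : fderiv ℝ (fderiv ℝ Ψ) p (X p) (X p) + fderiv ℝ (fderiv ℝ Ψ) p (Y p) (Y p)
      = fderiv ℝ Ψ p W - fderiv ℝ Ψ p (fderiv ℝ X p (X p)) - fderiv ℝ Ψ p (fderiv ℝ Y p (Y p)) := by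
    rw [hW, map_sub]
    linear_combination (norm := module) e1 + e2
  have hx := re_inner_fderiv_fderiv_le_of_isLocalMax hΨ hmax (X p)
  have hy := re_inner_fderiv_fderiv_le_of_isLocalMax hΨ hmax (Y p)
  have hn : ‖fderiv ℝ Ψ p (Y p)‖ = ‖fderiv ℝ Ψ p (X p)‖ := by
    rw [hCR.self_of_nhds, norm_smul]; simp
  -- All terms of `hsum` are derivatives of `Ψ` in real directions, hence orthogonal to `Ψ p` at the
  -- maximum. This is what `W` is for: it turns `i` times a derivative into a derivative.
  have hz : (inner ℂ (Ψ p) (fderiv ℝ (fderiv ℝ Ψ) p (X p) (X p))).re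
      + (inner ℂ (Ψ p) (fderiv ℝ (fderiv ℝ Ψ) p (Y p) (Y p))).re = 0 := by
    rw [← Complex.add_re, ← inner_add_right, hsum, inner_sub_right, inner_sub_right,
      Complex.sub_re, Complex.sub_re, re_inner_fderiv_eq_zero_of_isLocalMax hΨ hmax,
      re_inner_fderiv_eq_zero_of_isLocalMax hΨ hmax, re_inner_fderiv_eq_zero_of_isLocalMax hΨ hmax]
    simp
  rw [hn] at hy
  have : ‖fderiv ℝ Ψ p (X p)‖ ^ 2 ≤ 0 := by linarith
  simpa using this

end CauchyRiemann

/-! ### Algebra of the Fubini–Study metric -/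

namespace ComplexProjectiveSpace

variable {m : ℕ}

/-- The Fubini–Study metric as a real bilinear form. -/
def affineFubiniStudyForm (z : EuclideanSpace ℂ (Fin m)) :
    EuclideanSpace ℂ (Fin m) →ₗ[ℝ] EuclideanSpace ℂ (Fin m) →ₗ[ℝ] ℝ :=
  LinearMap.mk₂ ℝ (affineFubiniStudy z)
    (fun v v' w => by
      simp only [affineFubiniStudy, inner_add_left, ← add_div, ← Complex.add_re]
      congr 2; ring)
    (fun c v w => by
      have h : ∀ x y : EuclideanSpace ℂ (Fin m), inner ℂ (c • x) y = (c : ℂ) * inner ℂ x y := by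
        intro x y
        rw [← Complex.coe_smul, inner_smul_left]; simp
      simp only [affineFubiniStudy, h, smul_eq_mul, ← mul_div_assoc, ← Complex.re_ofReal_mul]
      congr 2; ring)
    (fun v w w' => by
      simp only [affineFubiniStudy, inner_add_right, ← add_div, ← Complex.add_re]
      congr 2; ring)
    (fun c v w => by
      have h : ∀ x y : EuclideanSpace ℂ (Fin m), inner ℂ x (c • y) = (c : ℂ) * inner ℂ x y := by
        intro x y
        rw [← Complex.coe_smul, inner_smul_right]
      simp only [affineFubiniStudy, h, smul_eq_mul, ← mul_div_assoc, ← Complex.re_ofReal_mul]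
      congr 2; ring)

@[simp]
theorem affineFubiniStudyForm_apply (z v w : EuclideanSpace ℂ (Fin m)) :
    affineFubiniStudyForm z v w = affineFubiniStudy z v w := rfl

theorem affineFubiniStudy_I_smul_right (z v w : EuclideanSpace ℂ (Fin m)) :
    affineFubiniStudy z v (Complex.I • w) = - affineFubiniStudy z (Complex.I • v) w := by
  simp only [affineFubiniStudy, inner_smul_left, inner_smul_right, Complex.conj_I, ← neg_div,
    ← Complex.neg_re]
  congr 2; ring

theorem affineFubiniStudy_I_smul_I_smul (z v w : EuclideanSpace ℂ (Fin m)) :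
    affineFubiniStudy z (Complex.I • v) (Complex.I • w) = affineFubiniStudy z v w := by
  rw [affineFubiniStudy_I_smul_right, smul_smul, Complex.I_mul_I]
  have h := (affineFubiniStudyForm z).map_neg₂ v w
  simp only [affineFubiniStudyForm_apply] at h
  rw [neg_one_smul, h, neg_neg]

theorem affineFubiniStudy_comm (z v w : EuclideanSpace ℂ (Fin m)) :
    affineFubiniStudy z v w = affineFubiniStudy z w v := by
  rw [affineFubiniStudy, affineFubiniStudy, ← Complex.conj_re]
  congr 2
  simp only [map_sub, map_mul, Complex.conj_ofReal, inner_conj_symm]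
  ring

theorem inner_mul_inner_eq_norm_sq (v z : EuclideanSpace ℂ (Fin m)) :
    inner ℂ v z * inner ℂ z v = ((‖inner ℂ v z‖ ^ 2 : ℝ) : ℂ) := by
  rw [← inner_conj_symm z v, Complex.mul_conj, Complex.normSq_eq_norm_sq]

theorem affineFubiniStudy_self (z v : EuclideanSpace ℂ (Fin m)) :
    affineFubiniStudy z v v
      = ((1 + ‖z‖ ^ 2) * ‖v‖ ^ 2 - ‖inner ℂ v z‖ ^ 2) / (1 + ‖z‖ ^ 2) ^ 2 := by
  rw [affineFubiniStudy, inner_mul_inner_eq_norm_sq, inner_self_eq_norm_sq_to_K]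
  congr 1
  rw [Complex.sub_re, Complex.ofReal_re, Complex.re_ofReal_mul]
  norm_cast

theorem affineFubiniStudy_self_pos (z : EuclideanSpace ℂ (Fin m)) {v : EuclideanSpace ℂ (Fin m)}
    (hv : v ≠ 0) : 0 < affineFubiniStudy z v v := by
  rw [affineFubiniStudy_self]
  have h1 : ‖inner ℂ v z‖ ≤ ‖v‖ * ‖z‖ := norm_inner_le_norm v z
  have h2 : ‖inner ℂ v z‖ ^ 2 ≤ (‖v‖ * ‖z‖) ^ 2 := by gcongr
  have h3 : 0 < ‖v‖ ^ 2 := by positivity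
  apply div_pos _ (by positivity)
  nlinarith

theorem affineFubiniStudy_self_I_smul (z v : EuclideanSpace ℂ (Fin m)) :
    affineFubiniStudy z v (Complex.I • v) = 0 := by
  have h1 := affineFubiniStudy_I_smul_right z v v
  have h2 := affineFubiniStudy_comm z v (Complex.I • v)
  linarith

/-- The complex covector `r (g (a, ·) - i g (a, i ·))` has the Fubini–Study norm `|r|` when `a` is
a unit vector. -/
theorem fubiniStudy_dual_norm (z a : EuclideanSpace ℂ (Fin m))
    (h1 : affineFubiniStudy z a a = 1) (T : EuclideanSpace ℂ (Fin m) → ℂ) (r : ℝ)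
    (hT : ∀ w, T w = r * affineFubiniStudy z a w
      - Complex.I * (r * affineFubiniStudy z a (Complex.I • w))) :
    (1 + ∑ i, ‖z i‖ ^ 2) * (‖T z‖ ^ 2 + ∑ i, ‖T (EuclideanSpace.single i 1)‖ ^ 2) = r ^ 2 := by
  have hS : 0 < 1 + ‖z‖ ^ 2 := by positivity
  set S := 1 + ‖z‖ ^ 2 with hSdef
  -- The vector `b / S²` represents the Fubini–Study pairing with `a` in the Euclidean Hermitian
  -- product, so `T` is `r / S²` times the pairing with `b`. What remains is `‖b‖² + |⟨b, z⟩|²`,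
  -- evaluated with `S ‖a‖² - |⟨a, z⟩|² = S²`, which says that `a` is a unit vector.
  set b : EuclideanSpace ℂ (Fin m) := (S : ℂ) • a - inner ℂ z a • z with hb
  have hinner : ∀ w, inner ℂ b w = (S : ℂ) * inner ℂ a w - inner ℂ a z * inner ℂ z w := by
    intro w
    rw [hb, inner_sub_left, inner_smul_left, inner_smul_left, Complex.conj_ofReal,
      inner_conj_symm]
  have hTb : ∀ w, T w = (r / S ^ 2 : ℝ) * inner ℂ b w := by
    intro w
    rw [hT, affineFubiniStudy, affineFubiniStudy, ← hSdef, inner_smul_right, inner_smul_right,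
      hinner]
    have : (S : ℂ) ≠ 0 := by exact_mod_cast hS.ne'
    generalize inner ℂ a w = A
    generalize inner ℂ a z = B
    generalize inner ℂ z w = C
    have e : (S : ℂ) * (Complex.I * A) - B * (Complex.I * C) = Complex.I * (S * A - B * C) := by
      ring
    rw [e]
    generalize (S * A - B * C) = D
    have h2 : (Complex.I * D).re = - D.im := by simp
    rw [h2]
    push_cast
    have hD : D = D.re + D.im * Complex.I := (Complex.re_add_im D).symm
    generalize D.re = x at *
    generalize D.im = y at *
    rw [hD]
    field_simp
    ring
  have hbz : inner ℂ b z = inner ℂ a z := by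
    rw [hinner, inner_self_eq_norm_sq_to_K]
    have : (S : ℂ) = 1 + (‖z‖ : ℂ) ^ 2 := by rw [hSdef]; push_cast; ring
    rw [this]; simp; ring
  have hbn : ‖b‖ ^ 2 = S ^ 2 * ‖a‖ ^ 2 - (S + 1) * ‖inner ℂ a z‖ ^ 2 := by
    have h1 : (inner ℂ b b).re = ‖b‖ ^ 2 := by
      rw [inner_self_eq_norm_sq_to_K]; norm_cast
    rw [← h1, hinner b]
    have h2 : inner ℂ a b = (S : ℂ) * (‖a‖ ^ 2 : ℝ) - (‖inner ℂ a z‖ ^ 2 : ℝ) := by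
      rw [hb, inner_sub_right, inner_smul_right, inner_smul_right, inner_self_eq_norm_sq_to_K,
        mul_comm (inner ℂ z a), inner_mul_inner_eq_norm_sq]
      simp
    have h3 : inner ℂ z b = inner ℂ z a := by
      rw [← inner_conj_symm, hbz, inner_conj_symm]
    rw [h2, h3, inner_mul_inner_eq_norm_sq]
    norm_cast
    ring
  have hbsum : ∑ i, ‖T (EuclideanSpace.single i 1)‖ ^ 2 = (r / S ^ 2) ^ 2 * ‖b‖ ^ 2 := by
    rw [EuclideanSpace.norm_sq_eq, Finset.mul_sum]
    refine Finset.sum_congr rfl fun i _ => ?_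
    rw [hTb, norm_mul, mul_pow, EuclideanSpace.inner_single_right,
      Complex.norm_real, Real.norm_eq_abs, sq_abs]
    simp
  have haN : S * ‖a‖ ^ 2 - ‖inner ℂ a z‖ ^ 2 = S ^ 2 := by
    rw [affineFubiniStudy_self, ← hSdef, div_eq_one_iff_eq (by positivity)] at h1
    exact h1
  rw [← EuclideanSpace.norm_sq_eq, ← hSdef, hbsum, hbn, hTb z, hbz, norm_mul, mul_pow,
    Complex.norm_real, Real.norm_eq_abs, sq_abs]
  have : S * ((r / S ^ 2) ^ 2 * ‖inner ℂ a z‖ ^ 2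
      + (r / S ^ 2) ^ 2 * (S ^ 2 * ‖a‖ ^ 2 - (S + 1) * ‖inner ℂ a z‖ ^ 2))
      = S ^ 2 * (r / S ^ 2) ^ 2 * (S * ‖a‖ ^ 2 - ‖inner ℂ a z‖ ^ 2) := by ring
  rw [this, haN]
  field_simp

end ComplexProjectiveSpace

/-! ### Real hypersurfaces of an affine chart -/

namespace ComplexProjectiveSpace

variable {m : ℕ} {E : Type*} [NormedAddCommGroup E] [NormedSpace ℝ E]

/-- Linear data of a real hypersurface at a point with affine coordinates `z`: the image of the
linear map `A` has the unit normal `N`, and the covector `ℓ` is `r` times the covector of `i N`. -/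
structure IsHypersurfaceCovector (z : EuclideanSpace ℂ (Fin m))
    (A : E →L[ℝ] EuclideanSpace ℂ (Fin m))
    (ℓ : E →L[ℝ] ℝ) (r : ℝ) (N : EuclideanSpace ℂ (Fin m)) : Prop where
  injective : Function.Injective A
  unit : affineFubiniStudy z N N = 1
  normal : ∀ v, affineFubiniStudy z N (A v) = 0
  covector : ∀ v, ℓ v = r * affineFubiniStudy z (Complex.I • N) (A v)

/-- The map `(v, s) ↦ A v + s i A v₀`. -/
def complexExtension (A : E →L[ℝ] EuclideanSpace ℂ (Fin m)) (v₀ : E) :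
    (E × ℝ) →L[ℝ] EuclideanSpace ℂ (Fin m) :=
  A ∘L ContinuousLinearMap.fst ℝ E ℝ
    + (ContinuousLinearMap.snd ℝ E ℝ).smulRight (Complex.I • A v₀)

theorem complexExtension_apply (A : E →L[ℝ] EuclideanSpace ℂ (Fin m)) (v₀ v : E) (s : ℝ) :
    complexExtension A v₀ (v, s) = A v + s • Complex.I • A v₀ := by
  simp [complexExtension]

/-- The real covector on the ambient space that restricts to `ℓ`, given a left inverse `K` of
`complexExtension`. -/
def realExtension (ℓ : E →L[ℝ] ℝ) (K : EuclideanSpace ℂ (Fin m) →L[ℝ] E × ℝ) :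
    EuclideanSpace ℂ (Fin m) →L[ℝ] ℝ :=
  ℓ ∘L ContinuousLinearMap.fst ℝ E ℝ ∘L K

/-- The complex linear functional with real part `ρ`. -/
def complexify (ρ : EuclideanSpace ℂ (Fin m) →L[ℝ] ℝ) (w : EuclideanSpace ℂ (Fin m)) : ℂ :=
  ρ w - Complex.I * ρ (Complex.I • w)

theorem complexify_I_smul (ρ : EuclideanSpace ℂ (Fin m) →L[ℝ] ℝ) (w : EuclideanSpace ℂ (Fin m)) :
    complexify ρ (Complex.I • w) = Complex.I * complexify ρ w := by
  have h : Complex.I • Complex.I • w = -w := by rw [smul_smul, Complex.I_mul_I, neg_one_smul]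
  rw [complexify, complexify, h, map_neg, Complex.ofReal_neg]
  linear_combination (ρ (Complex.I • w) : ℂ) * Complex.I_mul_I

theorem complexify_add (ρ : EuclideanSpace ℂ (Fin m) →L[ℝ] ℝ) (w w' : EuclideanSpace ℂ (Fin m)) :
    complexify ρ (w + w') = complexify ρ w + complexify ρ w' := by
  simp only [complexify, smul_add, map_add, Complex.ofReal_add]; ring

theorem complexify_smul (ρ : EuclideanSpace ℂ (Fin m) →L[ℝ] ℝ) (c : ℝ)
    (w : EuclideanSpace ℂ (Fin m)) : complexify ρ (c • w) = c * complexify ρ w := by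
  simp only [complexify, smul_comm Complex.I c, map_smul, smul_eq_mul, Complex.ofReal_mul]; ring

namespace IsHypersurfaceCovector

variable {z N : EuclideanSpace ℂ (Fin m)} {A : E →L[ℝ] EuclideanSpace ℂ (Fin m)}
  {ℓ : E →L[ℝ] ℝ} {r : ℝ}

/-- The image of `A` lies in the orthogonal complement of `N`, and both have real dimension `2m -
1`. -/
theorem exists_eq_of_orthogonal [FiniteDimensional ℝ E] (h : IsHypersurfaceCovector z A ℓ r N)
    (hdim : Module.finrank ℝ E + 1 = 2 * m) {W : EuclideanSpace ℂ (Fin m)}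
    (hW : affineFubiniStudy z N W = 0) : ∃ v, A v = W := by
  have hsub : LinearMap.range (A : E →ₗ[ℝ] EuclideanSpace ℂ (Fin m))
      ≤ LinearMap.ker (affineFubiniStudyForm z N) := by
    rintro _ ⟨v, rfl⟩
    simpa using h.normal v
  have hN : affineFubiniStudyForm z N ≠ 0 := by
    intro h0
    have := congrArg (fun L => L N) h0
    simp [h.unit] at this
  have hV : Module.finrank ℝ (EuclideanSpace ℂ (Fin m)) = 2 * m := by
    rw [← Module.finrank_mul_finrank ℝ ℂ, Complex.finrank_real_complex, finrank_euclideanSpace_fin]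
  have h1 := Module.Dual.finrank_ker_add_one_of_ne_zero hN
  have h2 : Module.finrank ℝ (LinearMap.range (A : E →ₗ[ℝ] EuclideanSpace ℂ (Fin m)))
      = Module.finrank ℝ E := LinearMap.finrank_range_of_inj h.injective
  have heq := Submodule.eq_of_le_of_finrank_eq hsub (by omega)
  have hmem : W ∈ LinearMap.range (A : E →ₗ[ℝ] EuclideanSpace ℂ (Fin m)) := by
    rw [heq]; simpa using hW
  exact hmem

/-- For `r ≠ 0` the equation `ℓ u = 0` says that `A u` is orthogonal to `i N`, equivalently that `i
A u` is orthogonal to `N`. So the kernel of `ℓ` corresponds to the maximal complex subspace of the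
tangent hyperplane. -/
theorem exists_eq_I_smul [FiniteDimensional ℝ E] (h : IsHypersurfaceCovector z A ℓ r N)
    (hdim : Module.finrank ℝ E + 1 = 2 * m) (hr : r ≠ 0) {u : E} (hu : ℓ u = 0) :
    ∃ v, A v = Complex.I • A u := by
  refine h.exists_eq_of_orthogonal hdim ?_
  rw [affineFubiniStudy_I_smul_right]
  have := h.covector u
  rw [hu] at this
  simpa [hr] using this.symm

theorem exists_unit_tangent [FiniteDimensional ℝ E] (h : IsHypersurfaceCovector z A ℓ r N)
    (hdim : Module.finrank ℝ E + 1 = 2 * m) : ∃ v, A v = Complex.I • N :=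
  h.exists_eq_of_orthogonal hdim (affineFubiniStudy_self_I_smul z N)

theorem exists_apply_ne_zero [FiniteDimensional ℝ E] (h : IsHypersurfaceCovector z A ℓ r N)
    (hdim : Module.finrank ℝ E + 1 = 2 * m) (hr : r ≠ 0) : ∃ v, ℓ v ≠ 0 := by
  obtain ⟨v, hv⟩ := h.exists_unit_tangent hdim
  refine ⟨v, ?_⟩
  rw [h.covector, hv, affineFubiniStudy_I_smul_I_smul, h.unit]
  simpa using hr

theorem ne_zero_of_apply_ne_zero (h : IsHypersurfaceCovector z A ℓ r N) {v : E} (hv : ℓ v ≠ 0) :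
    r ≠ 0 := by
  rintro rfl
  exact hv (by rw [h.covector]; simp)

/-- Since `g(N, i A v₀) = -g(i N, A v₀)` is a nonzero multiple of `ℓ v₀`, the vector `i A v₀` is
transverse to the image of `A`. The dimensions agree. -/
theorem complexExtension_bijective [FiniteDimensional ℝ E] (h : IsHypersurfaceCovector z A ℓ r N)
    (hdim : Module.finrank ℝ E + 1 = 2 * m) {v₀ : E} (hv₀ : ℓ v₀ ≠ 0) :
    Function.Bijective (complexExtension A v₀) := by
  have hV : Module.finrank ℝ (EuclideanSpace ℂ (Fin m)) = 2 * m := by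
    rw [← Module.finrank_mul_finrank ℝ ℂ, Complex.finrank_real_complex, finrank_euclideanSpace_fin]
  have hinj : Function.Injective
      (complexExtension A v₀ : (E × ℝ) →ₗ[ℝ] EuclideanSpace ℂ (Fin m)) := by
    rw [← LinearMap.ker_eq_bot, LinearMap.ker_eq_bot']
    rintro ⟨v, s⟩ h0
    rw [ContinuousLinearMap.coe_coe, complexExtension_apply] at h0
    have h1 := congrArg (affineFubiniStudyForm z N) h0
    simp only [map_add, map_smul, map_zero, affineFubiniStudyForm_apply, h.normal,
      affineFubiniStudy_I_smul_right, zero_add, smul_eq_mul] at h1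
    have h2 := h.covector v₀
    have h3 : affineFubiniStudy z (Complex.I • N) (A v₀) ≠ 0 := by
      intro h3; rw [h3] at h2; simp at h2; exact hv₀ h2
    have hs : s = 0 := by simpa [h3] using h1
    subst hs
    have h4 : A v = A 0 := by simpa using h0
    simpa using h.injective h4
  refine ⟨hinj, ?_⟩
  exact (LinearMap.injective_iff_surjective_of_finrank_eq_finrank
    (f := (complexExtension A v₀ : (E × ℝ) →ₗ[ℝ] EuclideanSpace ℂ (Fin m)))
    (by simp [hV, hdim])).1 hinj

variable {K : EuclideanSpace ℂ (Fin m) →L[ℝ] E × ℝ} {v₀ : E}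

/-- Both sides restrict to `ℓ` on the image of `A` and vanish on `i A v₀`. The left side involves
only `ℓ` and `K`, so it is smooth in the point where these are, although `r` and `N` are chosen
pointwise without any regularity. -/
theorem realExtension_apply [FiniteDimensional ℝ E] (h : IsHypersurfaceCovector z A ℓ r N)
    (hdim : Module.finrank ℝ E + 1 = 2 * m) (hv₀ : ℓ v₀ ≠ 0)
    (hK : ∀ x, K (complexExtension A v₀ x) = x) (W : EuclideanSpace ℂ (Fin m)) :
    realExtension ℓ K W = r * affineFubiniStudy z (Complex.I • N) W := by
  obtain ⟨⟨v, s⟩, rfl⟩ := (h.complexExtension_bijective hdim hv₀).2 W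
  simp only [realExtension, ContinuousLinearMap.comp_apply, hK, ContinuousLinearMap.coe_fst']
  have h1 := (affineFubiniStudyForm z (Complex.I • N)).map_add (A v) (s • Complex.I • A v₀)
  rw [LinearMap.map_smul] at h1
  simp only [affineFubiniStudyForm_apply, affineFubiniStudy_I_smul_I_smul, h.normal] at h1
  rw [complexExtension_apply, h.covector, h1]
  simp

/-- The imaginary part on `A v` is a multiple of `g(i N, i A v) = g(N, A v) = 0`. -/
theorem complexify_apply [FiniteDimensional ℝ E] (h : IsHypersurfaceCovector z A ℓ r N)
    (hdim : Module.finrank ℝ E + 1 = 2 * m) (hv₀ : ℓ v₀ ≠ 0)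
    (hK : ∀ x, K (complexExtension A v₀ x) = x) (v : E) :
    complexify (realExtension ℓ K) (A v) = ℓ v := by
  rw [complexify, h.realExtension_apply hdim hv₀ hK, h.realExtension_apply hdim hv₀ hK,
    affineFubiniStudy_I_smul_I_smul, h.normal, h.covector]
  simp

theorem dual_norm [FiniteDimensional ℝ E] (h : IsHypersurfaceCovector z A ℓ r N)
    (hdim : Module.finrank ℝ E + 1 = 2 * m) (hv₀ : ℓ v₀ ≠ 0)
    (hK : ∀ x, K (complexExtension A v₀ x) = x) :
    (1 + ∑ i, ‖z i‖ ^ 2) * (‖complexify (realExtension ℓ K) z‖ ^ 2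
      + ∑ i, ‖complexify (realExtension ℓ K) (EuclideanSpace.single i 1)‖ ^ 2) = r ^ 2 := by
  refine fubiniStudy_dual_norm z (Complex.I • N) ?_ _ r ?_
  · rw [affineFubiniStudy_I_smul_I_smul, h.unit]
  · intro w
    rw [complexify, h.realExtension_apply hdim hv₀ hK, h.realExtension_apply hdim hv₀ hK]
    push_cast
    ring

end IsHypersurfaceCovector

end ComplexProjectiveSpace

/-! ### The matrix-valued map on points and covectors, and its derivative. -/

namespace ComplexProjectiveSpace

variable {m : ℕ} {E : Type*} [NormedAddCommGroup E] [NormedSpace ℝ E]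

/-- The tensor `(1, z) ⊗ (-T z, T)` of a point and a covector. -/
def pointCovectorTensor (z : EuclideanSpace ℂ (Fin m)) (ρ : EuclideanSpace ℂ (Fin m) →L[ℝ] ℝ) :
    EuclideanSpace ℂ (Option (Fin m) × Option (Fin m)) :=
  WithLp.toLp 2 fun ab => (ab.1.elim 1 fun i => z i) *
    (ab.2.elim (-complexify ρ z) fun i => complexify ρ (EuclideanSpace.single i 1))

/-- The norm of a tensor product is the product of the norms. The result is the left-hand side of
`fubiniStudy_dual_norm`. -/
theorem norm_sq_pointCovectorTensor (z : EuclideanSpace ℂ (Fin m))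
    (ρ : EuclideanSpace ℂ (Fin m) →L[ℝ] ℝ) :
    ‖pointCovectorTensor z ρ‖ ^ 2 = (1 + ∑ i, ‖z i‖ ^ 2) * (‖complexify ρ z‖ ^ 2
      + ∑ i, ‖complexify ρ (EuclideanSpace.single i 1)‖ ^ 2) := by
  rw [EuclideanSpace.norm_sq_eq, Fintype.sum_prod_type]
  simp only [pointCovectorTensor, norm_mul, mul_pow, ← Finset.mul_sum, ← Finset.sum_mul]
  rw [Fintype.sum_option, Fintype.sum_option]
  simp

theorem contDiffAt_complexify {k : WithTop ℕ∞} {ρ : E → EuclideanSpace ℂ (Fin m) →L[ℝ] ℝ}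
    {W : E → EuclideanSpace ℂ (Fin m)} {p : E} (hρ : ContDiffAt ℝ k ρ p) (hW : ContDiffAt ℝ k W p) :
    ContDiffAt ℝ k (fun y => complexify (ρ y) (W y)) p := by
  have h1 : ContDiffAt ℝ k (fun y => ρ y (W y)) p := hρ.clm_apply hW
  have h2 : ContDiffAt ℝ k (fun y => ρ y (Complex.I • W y)) p := hρ.clm_apply (hW.const_smul _)
  have h3 : ContDiffAt ℝ k (fun y => (ρ y (W y) : ℂ)) p :=
    Complex.ofRealCLM.contDiff.contDiffAt.comp p h1
  have h4 : ContDiffAt ℝ k (fun y => (ρ y (Complex.I • W y) : ℂ)) p :=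
    Complex.ofRealCLM.contDiff.contDiffAt.comp p h2
  exact h3.sub (contDiffAt_const.mul h4)

theorem contDiffAt_pointCovectorTensor {k : WithTop ℕ∞}
    {ρ : E → EuclideanSpace ℂ (Fin m) →L[ℝ] ℝ}
    {f : E → EuclideanSpace ℂ (Fin m)} {p : E} (hρ : ContDiffAt ℝ k ρ p) (hf : ContDiffAt ℝ k f p) :
    ContDiffAt ℝ k (fun y => pointCovectorTensor (f y) (ρ y)) p := by
  rw [contDiffAt_piLp]
  rintro ⟨a, b⟩
  refine ContDiffAt.mul ?_ ?_
  · cases a with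
    | none => exact contDiffAt_const
    | some i => exact ((contDiffAt_piLp 2).1 hf) i
  · cases b with
    | none => exact (contDiffAt_complexify hρ hf).neg
    | some i => exact contDiffAt_complexify hρ contDiffAt_const

theorem fderiv_complexify {ρ : E → EuclideanSpace ℂ (Fin m) →L[ℝ] ℝ}
    {W : E → EuclideanSpace ℂ (Fin m)} {p : E} (hρ : DifferentiableAt ℝ ρ p)
    (hW : DifferentiableAt ℝ W p) (u : E) :
    fderiv ℝ (fun y => complexify (ρ y) (W y)) p u
      = complexify (fderiv ℝ ρ p u) (W p) + complexify (ρ p) (fderiv ℝ W p u) := by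
  have h1 := hρ.hasFDerivAt.clm_apply hW.hasFDerivAt
  have h2 := hρ.hasFDerivAt.clm_apply (hW.hasFDerivAt.const_smul Complex.I)
  have h3 := Complex.ofRealCLM.hasFDerivAt.comp p h1
  have h4 := Complex.ofRealCLM.hasFDerivAt.comp p h2
  have h5 := h3.sub (h4.const_mul Complex.I)
  have h6 : HasFDerivAt (fun y => complexify (ρ y) (W y)) _ p := h5
  rw [h6.fderiv]
  simp [complexify]
  ring

/-- The derivative of a component of `pointCovectorTensor` along a curve of points and covectors. -/
theorem fderiv_pointCovectorTensor {ρ : E → EuclideanSpace ℂ (Fin m) →L[ℝ] ℝ}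
    {f : E → EuclideanSpace ℂ (Fin m)} {p : E} (hρ : ContDiffAt ℝ 1 ρ p) (hf : ContDiffAt ℝ 1 f p)
    (u : E) (a b : Option (Fin m)) :
    (fderiv ℝ (fun y => pointCovectorTensor (f y) (ρ y)) p u) (a, b) =
      (a.elim 0 fun i => fderiv ℝ f p u i) *
        (b.elim (-complexify (ρ p) (f p)) fun i => complexify (ρ p) (EuclideanSpace.single i 1))
      + (a.elim 1 fun i => f p i) *
        (b.elim (-(complexify (fderiv ℝ ρ p u) (f p) + complexify (ρ p) (fderiv ℝ f p u)))
          fun i => complexify (fderiv ℝ ρ p u) (EuclideanSpace.single i 1)) := by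
  have hd := (contDiffAt_pointCovectorTensor hρ hf).differentiableAt (by norm_num)
  have hρd := hρ.differentiableAt (by norm_num)
  have hfd := hf.differentiableAt (by norm_num)
  have h1 := (PiLp.proj (𝕜 := ℝ) 2 (fun _ => ℂ) (a, b)).hasFDerivAt.comp p hd.hasFDerivAt
  have hZ : HasFDerivAt (fun y => (a.elim 1 fun i => f y i : ℂ))
      (a.elim 0 fun i => (PiLp.proj (𝕜 := ℝ) 2 (fun _ => ℂ) i) ∘L fderiv ℝ f p) p := by
    cases a with
    | none => exact hasFDerivAt_const _ _
    | some i => exact (PiLp.proj (𝕜 := ℝ) 2 (fun _ => ℂ) i).hasFDerivAt.comp p hfd.hasFDerivAt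
  have hT : DifferentiableAt ℝ (fun y => (b.elim (-complexify (ρ y) (f y))
      fun i => complexify (ρ y) (EuclideanSpace.single i 1) : ℂ)) p := by
    cases b with
    | none => exact ((contDiffAt_complexify hρ hf).neg).differentiableAt (by norm_num)
    | some i =>
      exact (contDiffAt_complexify hρ contDiffAt_const).differentiableAt (by norm_num)
  have h2 := hZ.mul hT.hasFDerivAt
  have h3 := congrArg (fun L => L u) (h1.unique h2)
  simp only [ContinuousLinearMap.comp_apply] at h3
  refine Eq.trans h3 ?_
  simp only [add_apply, smul_apply, smul_eq_mul]
  rw [add_comm, mul_comm]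
  congr 2
  · cases a <;> rfl
  · cases b with
    | none =>
      simp only [Option.elim_none]
      rw [fderiv_fun_neg, neg_apply, fderiv_complexify hρd hfd]
    | some i =>
      simp only [Option.elim_some]
      rw [fderiv_complexify hρd (differentiableAt_const _)]
      simp [complexify]

end ComplexProjectiveSpace

/-! ### Cauchy–Riemann equations from closedness, and the local maximum argument. -/

namespace ComplexProjectiveSpace

variable {m : ℕ} {E : Type*} [NormedAddCommGroup E] [NormedSpace ℝ E]

theorem contDiffAt_complexExtension {k : WithTop ℕ∞} {A : E → E →L[ℝ] EuclideanSpace ℂ (Fin m)}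
    {p : E} (hA : ContDiffAt ℝ k A p) (v₀ : E) :
    ContDiffAt ℝ k (fun y => complexExtension (A y) v₀) p := by
  have h1 : ContDiffAt ℝ k (fun y => (A y) ∘L ContinuousLinearMap.fst ℝ E ℝ) p :=
    hA.clm_comp contDiffAt_const
  have h2 : ContDiffAt ℝ k (fun y => Complex.I • A y v₀) p :=
    (hA.clm_apply contDiffAt_const).const_smul _
  have h3 : ContDiffAt ℝ k
      (fun y => (ContinuousLinearMap.snd ℝ E ℝ).smulRight (Complex.I • A y v₀)) p :=
    (ContinuousLinearMap.smulRightL ℝ (E × ℝ) (EuclideanSpace ℂ (Fin m))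
      (ContinuousLinearMap.snd ℝ E ℝ)).contDiff.contDiffAt.comp p h2
  exact h1.add h3

/-- For a closed form `w` the complexified covector is holomorphic along the complex directions of
the hypersurface. -/
theorem complexify_fderiv_of_I_smul {f : E → EuclideanSpace ℂ (Fin m)} {w : E → E →L[ℝ] ℝ}
    {ρ : E → EuclideanSpace ℂ (Fin m) →L[ℝ] ℝ} {y : E}
    (hf : ContDiffAt ℝ 2 f y) (hw : DifferentiableAt ℝ w y) (hρ : DifferentiableAt ℝ ρ y)
    (hclosed : ∀ u v, fderiv ℝ w y u v = fderiv ℝ w y v u)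
    (heq : ∀ᶠ x in 𝓝 y, ∀ v, complexify (ρ x) (fderiv ℝ f x v) = w x v)
    {v₀ : E} (hspan : Function.Surjective (complexExtension (fderiv ℝ f y) v₀))
    {u u' : E} (hu : fderiv ℝ f y u' = Complex.I • fderiv ℝ f y u) (W : EuclideanSpace ℂ (Fin m)) :
    complexify (fderiv ℝ ρ y u') W = Complex.I * complexify (fderiv ℝ ρ y u) W := by
  have hfd : DifferentiableAt ℝ (fderiv ℝ f) y :=
    (hf.fderiv_right (m := 1) (by norm_num)).differentiableAt (by norm_num)
  -- Write `T` for the complexified covector. Differentiating `T (Df b) = w b` along `a` gives `(D_a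
  -- T)(Df b) + T (D²f (a, b)) = (D_a w) b`. The second and third terms are symmetric in `a` and
  -- `b`, by symmetry of `D²f` and closedness of `w`; hence so is the first.
  have hsymm : ∀ a b, complexify (fderiv ℝ ρ y a) (fderiv ℝ f y b)
      = complexify (fderiv ℝ ρ y b) (fderiv ℝ f y a) := by
    have h1 : ∀ a b, complexify (fderiv ℝ ρ y a) (fderiv ℝ f y b)
        + complexify (ρ y) (fderiv ℝ (fderiv ℝ f) y a b) = fderiv ℝ w y a b := by
      intro a b
      have hW : HasFDerivAt (fun x => fderiv ℝ f x b)
          ((fderiv ℝ (fderiv ℝ f) y).flip b) y := by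
        simpa using hfd.hasFDerivAt.clm_apply (hasFDerivAt_const b y)
      have h2 := fderiv_complexify hρ hW.differentiableAt a
      rw [hW.fderiv, ContinuousLinearMap.flip_apply] at h2
      rw [← h2]
      have h3 : (fun x => complexify (ρ x) (fderiv ℝ f x b)) =ᶠ[𝓝 y]
          fun x => ((w x b : ℝ) : ℂ) := by
        filter_upwards [heq] with x hx using hx b
      rw [h3.fderiv_eq]
      have h4 : HasFDerivAt (fun x => w x b) ((fderiv ℝ w y).flip b) y := by
        simpa using hw.hasFDerivAt.clm_apply (hasFDerivAt_const b y)
      have h5 : HasFDerivAt (fun x => ((w x b : ℝ) : ℂ)) _ y :=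
        Complex.ofRealCLM.hasFDerivAt.comp y h4
      rw [h5.fderiv]
      rfl
    intro a b
    have h2 : fderiv ℝ (fderiv ℝ f) y a b = fderiv ℝ (fderiv ℝ f) y b a :=
      (hf.isSymmSndFDerivAt (by simp)).eq _ _
    have h3 := h1 a b
    rw [hclosed a b, ← h1 b a, h2] at h3
    exact add_right_cancel h3
  -- The symmetry exchanges the direction of differentiation with the argument, where `Df u' = i Df
  -- u` and complex linearity apply. Tangent vectors together with `i Df v₀` span, so this
  -- determines the functional.
  have hT : ∀ v, complexify (fderiv ℝ ρ y u') (fderiv ℝ f y v)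
      = Complex.I * complexify (fderiv ℝ ρ y u) (fderiv ℝ f y v) := by
    intro v
    rw [hsymm, hu, complexify_I_smul, hsymm]
  obtain ⟨⟨v, s⟩, rfl⟩ := hspan W
  rw [complexExtension_apply, complexify_add, complexify_add, complexify_smul, complexify_smul,
    complexify_I_smul, complexify_I_smul, hT, hT]
  ring

/-- If a closed one-form on a real hypersurface is a multiple `R` of the covector of `i N`, then
`R²` has no positive local maximum. -/
theorem eq_zero_of_closed_of_isLocalMax [FiniteDimensional ℝ E]
    (hdim : Module.finrank ℝ E + 1 = 2 * m) (hm : 2 ≤ m)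
    {f : E → EuclideanSpace ℂ (Fin m)} {w : E → E →L[ℝ] ℝ} {R : E → ℝ} {p : E}
    (hf : ContDiffAt ℝ ∞ f p) (hw : ContDiffAt ℝ ∞ w p)
    (hcov : ∀ᶠ y in 𝓝 p, ∃ N, IsHypersurfaceCovector (f y) (fderiv ℝ f y) (w y) (R y) N)
    (hclosed : ∀ᶠ y in 𝓝 p, ∀ u v, fderiv ℝ w y u v = fderiv ℝ w y v u)
    (hmax : IsLocalMax (fun y => R y ^ 2) p) : R p = 0 := by
  by_contra hRp
  obtain ⟨N₀, hN₀⟩ := hcov.self_of_nhds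
  obtain ⟨v₀, hv₀⟩ := hN₀.exists_apply_ne_zero hdim hRp
  have hv₀' : ∀ᶠ y in 𝓝 p, w y v₀ ≠ 0 := by
    have : ContinuousAt (fun y => w y v₀) p :=
      (hw.clm_apply contDiffAt_const).continuousAt
    exact this.eventually_ne hv₀
  have hDf : ContDiffAt ℝ ∞ (fderiv ℝ f) p := hf.fderiv_right (by simp)
  set L : E → (E × ℝ) →L[ℝ] EuclideanSpace ℂ (Fin m) :=
    fun y => complexExtension (fderiv ℝ f y) v₀ with hL
  have hLc : ContDiffAt ℝ ∞ L p := contDiffAt_complexExtension hDf v₀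
  -- `ContinuousLinearMap.inverse` is zero at non-invertible maps. Near `p` the map `L y` is
  -- invertible, because `w y v₀` stays nonzero there.
  set K : E → EuclideanSpace ℂ (Fin m) →L[ℝ] E × ℝ :=
    fun y => ContinuousLinearMap.inverse (L y) with hK
  have hequiv : ∀ y, Function.Bijective (L y) →
      ∃ e : (E × ℝ) ≃L[ℝ] EuclideanSpace ℂ (Fin m), (e : (E × ℝ) →L[ℝ] _) = L y := by
    intro y hy
    exact ⟨(LinearEquiv.ofBijective (L y : (E × ℝ) →ₗ[ℝ] _) hy).toContinuousLinearEquiv, rfl⟩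
  have hKc : ContDiffAt ℝ ∞ K p := by
    obtain ⟨e, he⟩ := hequiv p (hN₀.complexExtension_bijective hdim hv₀)
    have h1 : ContDiffAt ℝ ∞ ContinuousLinearMap.inverse (L p) := by
      rw [← he]; exact contDiffAt_map_inverse e
    exact h1.comp p hLc
  set ρ : E → EuclideanSpace ℂ (Fin m) →L[ℝ] ℝ := fun y => realExtension (w y) (K y) with hρ
  have hρc : ContDiffAt ℝ ∞ ρ p := hw.clm_comp (contDiffAt_const.clm_comp hKc)
  -- pointwise facts near `p`
  have hgood : ∀ᶠ y in 𝓝 p, w y v₀ ≠ 0 ∧ R y ≠ 0 ∧ Function.Surjective (L y) ∧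
      (∀ x, K y (L y x) = x) ∧
      ∃ N, IsHypersurfaceCovector (f y) (fderiv ℝ f y) (w y) (R y) N := by
    filter_upwards [hcov, hv₀'] with y ⟨N, hN⟩ hy
    have hb := hN.complexExtension_bijective hdim hy
    refine ⟨hy, hN.ne_zero_of_apply_ne_zero hy, hb.2, ?_, N, hN⟩
    obtain ⟨e, he⟩ := hequiv y hb
    intro x
    rw [hK]
    simp only [← he, ContinuousLinearMap.inverse_equiv]
    simp
  have heq : ∀ᶠ y in 𝓝 p, ∀ v, complexify (ρ y) (fderiv ℝ f y v) = w y v := by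
    filter_upwards [hgood] with y ⟨h1, _, _, h4, N, hN⟩ v
    exact hN.complexify_apply hdim h1 h4 v
  set Ψ := fun y => pointCovectorTensor (f y) (ρ y) with hΨ
  have hΨc : ContDiffAt ℝ ∞ Ψ p := contDiffAt_pointCovectorTensor hρc hf
  have hnorm : ∀ᶠ y in 𝓝 p, ‖Ψ y‖ ^ 2 = R y ^ 2 := by
    filter_upwards [hgood] with y ⟨h1, _, _, h4, N, hN⟩
    rw [hΨ, norm_sq_pointCovectorTensor]
    exact hN.dual_norm hdim h1 h4
  have hΨmax : IsLocalMax (fun y => ‖Ψ y‖ ^ 2) p := by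
    filter_upwards [hmax, hnorm] with y h1 h2
    simp only [h2, hnorm.self_of_nhds, h1]
  have h2 : (2 : WithTop ℕ∞) ≤ ∞ := ENat.LEInfty.out
  have h1 : (1 : WithTop ℕ∞) ≤ ∞ := by simp
  have hfe : ∀ᶠ y in 𝓝 p, ContDiffAt ℝ 2 f y := (hf.of_le h2).eventually (by simp)
  have hwe : ∀ᶠ y in 𝓝 p, ContDiffAt ℝ 1 w y := (hw.of_le h1).eventually (by simp)
  have hρe : ∀ᶠ y in 𝓝 p, ContDiffAt ℝ 1 ρ y := (hρc.of_le h1).eventually (by simp)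
  -- Both tensor factors satisfy the CR equation on the kernel of `w`: the point factor since `Df u'
  -- = i Df u`, the covector factor by `complexify_fderiv_of_I_smul`.
  have hCR : ∀ᶠ y in 𝓝 p, ∀ u u', w y u = 0 → fderiv ℝ f y u' = Complex.I • fderiv ℝ f y u →
      fderiv ℝ Ψ y u' = Complex.I • fderiv ℝ Ψ y u := by
    filter_upwards [hgood, heq, heq.eventually_nhds, hfe, hwe, hρe, hclosed] with
      y ⟨h1, _, h3, h4, N, hN⟩ h5 h6 h7 h8 h9 h10 u u' hu hu'
    have hc := complexify_fderiv_of_I_smul h7 (h8.differentiableAt (by norm_num))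
      (h9.differentiableAt (by norm_num)) h10 h6 h3 hu'
    have hz : complexify (ρ y) (fderiv ℝ f y u) = 0 := by rw [h5, hu]; simp
    have hz' : complexify (ρ y) (fderiv ℝ f y u') = 0 := by
      rw [hu', complexify_I_smul, hz, mul_zero]
    ext ⟨a, b⟩
    rw [PiLp.smul_apply, hΨ, fderiv_pointCovectorTensor h9 (h7.of_le (by norm_num)),
      fderiv_pointCovectorTensor h9 (h7.of_le (by norm_num)), hz, hz', hu']
    cases a <;> cases b <;> simp [hc] <;> ring
  -- Multiplication by `i` preserves the kernel of `w`, because the complexified covector takes the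
  -- value `i w(u) = 0` on `i Df u`. The formula through `K` makes the rotated vector depend
  -- smoothly on `y`.
  have hI : ∀ᶠ y in 𝓝 p, ∀ u, w y u = 0 → ∃ u', fderiv ℝ f y u' = Complex.I • fderiv ℝ f y u ∧
      (K y (Complex.I • fderiv ℝ f y u)).1 = u' ∧ w y u' = 0 := by
    filter_upwards [hgood, heq] with y ⟨h1, h2, h3, h4, N, hN⟩ h5 u hu
    obtain ⟨u', hu'⟩ := hN.exists_eq_I_smul hdim h2 hu
    refine ⟨u', hu', ?_, ?_⟩
    · rw [← hu']
      have : L y (u', 0) = fderiv ℝ f y u' := by rw [hL, complexExtension_apply]; simp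
      rw [← this, h4]
    · have h6 : ((w y u' : ℝ) : ℂ) = 0 := by
        rw [← h5, hu', complexify_I_smul, h5, hu]; simp
      exact_mod_cast h6
  -- a vector field in the kernel of `w`
  obtain ⟨x₀, hx₀, hx₀'⟩ : ∃ x₀ : E, w p x₀ = 0 ∧ x₀ ≠ 0 := by
    have h1 : 0 < Module.finrank ℝ (LinearMap.ker (w p : E →ₗ[ℝ] ℝ)) := by
      have h0 : (w p : E →ₗ[ℝ] ℝ) ≠ 0 := fun h0 => hv₀ (by
        have := congrArg (fun L => L v₀) h0
        simpa using this)
      have h2 := Module.Dual.finrank_ker_add_one_of_ne_zero h0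
      omega
    have := Module.finrank_pos_iff.1 h1
    obtain ⟨x, hx⟩ := exists_ne (0 : LinearMap.ker (w p : E →ₗ[ℝ] ℝ))
    exact ⟨x, by simp, by simpa using hx⟩
  -- The correction by `v₀` keeps `X` in the kernel of `w` at every point, and at `p` it leaves a
  -- nonzero multiple of `x₀`. The field `Y` is `X` rotated by the complex structure.
  set X : E → E := fun y => w y v₀ • x₀ - w y x₀ • v₀ with hX
  set Y : E → E := fun y => (K y (Complex.I • fderiv ℝ f y (X y))).1 with hY
  have hwX : ∀ y, w y (X y) = 0 := by
    intro y; simp [hX]; ring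
  have hXc : ContDiffAt ℝ ∞ X p :=
    ((hw.clm_apply contDiffAt_const).smul contDiffAt_const).sub
      ((hw.clm_apply contDiffAt_const).smul contDiffAt_const)
  have hYc : ContDiffAt ℝ ∞ Y p :=
    contDiffAt_fst.comp p (hKc.clm_apply ((hDf.clm_apply hXc).const_smul Complex.I))
  have hXd : DifferentiableAt ℝ X p := hXc.differentiableAt (by simp)
  have hYd : DifferentiableAt ℝ Y p := hYc.differentiableAt (by simp)
  have hYI : ∀ᶠ y in 𝓝 p, fderiv ℝ f y (Y y) = Complex.I • fderiv ℝ f y (X y) ∧ w y (Y y) = 0 := by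
    filter_upwards [hI] with y hy
    obtain ⟨u', h1, h2, h3⟩ := hy (X y) (hwX y)
    rw [hY]
    simp only [h2]
    exact ⟨h1, h3⟩
  -- Frobenius: the kernel of a closed form is stable under brackets. The rotated bracket then
  -- serves as the direction `W` of the maximum principle.
  have hbracket : w p (fderiv ℝ X p (Y p) - fderiv ℝ Y p (X p)) = 0 := by
    have hwd : HasFDerivAt w (fderiv ℝ w p) p := (hw.differentiableAt (by simp)).hasFDerivAt
    have h1 := hwd.clm_apply hXd.hasFDerivAt
    have h2 := hwd.clm_apply hYd.hasFDerivAt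
    have h3 : HasFDerivAt (fun y => w y (X y)) (0 : E →L[ℝ] ℝ) p := by
      simp only [hwX]; exact hasFDerivAt_const _ _
    have h4 : HasFDerivAt (fun y => w y (Y y)) (0 : E →L[ℝ] ℝ) p := by
      refine (hasFDerivAt_const (0 : ℝ) p).congr_of_eventuallyEq ?_
      filter_upwards [hYI] with y hy using hy.2
    have e1 := congrArg (fun L => L (Y p)) (h1.unique h3)
    have e2 := congrArg (fun L => L (X p)) (h2.unique h4)
    simp only [add_apply, ContinuousLinearMap.comp_apply, ContinuousLinearMap.flip_apply,
      zero_apply] at e1 e2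
    have e3 := hclosed.self_of_nhds (X p) (Y p)
    rw [map_sub]
    linarith
  obtain ⟨W, hW1, -, -⟩ := hI.self_of_nhds _ hbracket
  have hzero : fderiv ℝ Ψ p (X p) = 0 := by
    refine fderiv_eq_zero_of_isLocalMax_norm_sq (hΨc.of_le h2) hΨmax hXd hYd ?_
      (hCR.self_of_nhds _ W hbracket hW1)
    filter_upwards [hCR, hYI] with y h1 h2
    exact h1 _ _ (hwX y) h2.1
  have hXp : X p ≠ 0 := by
    rw [hX]; simp [hx₀, hv₀, hx₀']
  have hcomp : ∀ a b, (fderiv ℝ Ψ p (X p)) (a, b) = 0 := by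
    intro a b; rw [hzero]; rfl
  -- The covector factor at `p` is nonzero, as `‖Ψ p‖² = R p ² ≠ 0`.
  have hT : ∃ b : Option (Fin m), (b.elim (-complexify (ρ p) (f p))
      fun i => complexify (ρ p) (EuclideanSpace.single i 1) : ℂ) ≠ 0 := by
    by_contra! hcon
    have h1 : Ψ p = 0 := by
      ext ⟨a, b⟩
      simp only [hΨ, pointCovectorTensor, hcon b, mul_zero]
      rfl
    have h2 := hnorm.self_of_nhds
    rw [h1] at h2
    simp at h2
    exact hRp (pow_eq_zero_iff two_ne_zero |>.1 h2.symm)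
  obtain ⟨b, hb⟩ := hT
  have hρ1 := hρe.self_of_nhds
  have hf1 := hfe.self_of_nhds.of_le (m := 1) (by norm_num)
  -- The first entry of `(1, z)` is constant, so component `(none, b)` of `DΨ (X) = 0` says that the
  -- covector entry `b` has zero derivative. Component `(some i, b)` then reduces to `Df (X)_i`
  -- times this nonzero entry.
  have hfX : fderiv ℝ f p (X p) = fderiv ℝ f p 0 := by
    rw [map_zero]
    ext i
    have h1 := hcomp none b
    have h2 := hcomp (some i) b
    rw [hΨ, fderiv_pointCovectorTensor hρ1 hf1] at h1 h2
    simp only [Option.elim_none, Option.elim_some, zero_mul, zero_add, one_mul] at h1 h2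
    rw [h1, mul_zero, add_zero] at h2
    exact (mul_eq_zero.1 h2).resolve_right hb
  exact hXp (hN₀.injective hfX)

end ComplexProjectiveSpace

/-! ### Divergence form of the codifferentials -/

namespace ChartGeometry

section IndexAlgebra

variable {n : ℕ} {g : Fin n → Fin n → ℝ} {d : Fin n → Fin n → Fin n → ℝ}

/-- Here `g` plays the inverse metric and `d k i j` the derivative `∂_k g_{ij}`. The first two terms
of the Christoffel symbol have equal traces. The right-hand side is `-∂_i g^{ik} - g^{ik} ∂_i log
√det`, ready to be recognized as a divergence. -/
theorem sum_trace_christoffel (hg : ∀ i j, g i j = g j i) (hd : ∀ k i j, d k i j = d k j i)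
    (k : Fin n) :
    ∑ i, ∑ j, g i j * ∑ l, g k l * ((d i j l + d j i l - d l i j) / 2)
      = (∑ i, ∑ a, ∑ b, g i a * d i a b * g b k)
        - (∑ i, (∑ a, ∑ b, g a b * d i b a) * g i k) / 2 := by
  have h1 : ∑ i, ∑ j, g i j * ∑ l, g k l * ((d i j l + d j i l - d l i j) / 2)
      = (∑ i, ∑ j, ∑ l, g i j * g k l * d i j l) / 2 + (∑ i, ∑ j, ∑ l, g i j * g k l * d j i l) / 2
        - (∑ i, ∑ j, ∑ l, g i j * g k l * d l i j) / 2 := by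
    simp only [Finset.mul_sum, Finset.sum_div, ← Finset.sum_add_distrib, ← Finset.sum_sub_distrib]
    refine Finset.sum_congr rfl fun i _ => Finset.sum_congr rfl fun j _ =>
      Finset.sum_congr rfl fun l _ => ?_
    ring
  have h2 : ∑ i, ∑ j, ∑ l, g i j * g k l * d j i l = ∑ i, ∑ j, ∑ l, g i j * g k l * d i j l := by
    rw [Finset.sum_comm]
    refine Finset.sum_congr rfl fun i _ => Finset.sum_congr rfl fun j _ =>
      Finset.sum_congr rfl fun l _ => ?_
    rw [hg j i]
  have h3 : ∑ i, ∑ j, ∑ l, g i j * g k l * d l i j = ∑ i, (∑ a, ∑ b, g a b * d i b a) * g i k := by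
    simp only [Finset.sum_mul]
    rw [Finset.sum_congr rfl fun i _ => Finset.sum_comm, Finset.sum_comm]
    refine Finset.sum_congr rfl fun i _ => Finset.sum_congr rfl fun j _ =>
      Finset.sum_congr rfl fun l _ => ?_
    rw [hg i k, hd i l j]; ring
  have h4 : ∑ i, ∑ j, ∑ l, g i j * g k l * d i j l = ∑ i, ∑ a, ∑ b, g i a * d i a b * g b k := by
    refine Finset.sum_congr rfl fun i _ => Finset.sum_congr rfl fun j _ =>
      Finset.sum_congr rfl fun l _ => ?_
    rw [hg k l]; ring
  rw [h1, h2, h3, h4]; ring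

/-- Contraction with `B` removes the term symmetric in `k` and `q`; the other two terms contribute
equally. -/
theorem sum_antisymm_christoffel (hd : ∀ k i j, d k i j = d k j i) {B : Fin n → Fin n → ℝ}
    (hB : ∀ i j, B i j = - B j i) (j : Fin n) :
    ∑ k, ∑ q, B k q * ((d k j q + d j k q - d q k j) / 2) = ∑ k, ∑ q, B k q * d k q j := by
  have h1 : ∑ k, ∑ q, B k q * d j k q = 0 := by
    have : ∑ k, ∑ q, B k q * d j k q = - ∑ k, ∑ q, B k q * d j k q := by
      conv_lhs => rw [Finset.sum_comm]
      simp only [← Finset.sum_neg_distrib]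
      refine Finset.sum_congr rfl fun i _ => Finset.sum_congr rfl fun q _ => ?_
      rw [hB q i, hd j q i]; ring
    linarith
  have h2 : ∑ k, ∑ q, B k q * d q k j = - ∑ k, ∑ q, B k q * d k q j := by
    conv_lhs => rw [Finset.sum_comm]
    simp only [← Finset.sum_neg_distrib]
    refine Finset.sum_congr rfl fun i _ => Finset.sum_congr rfl fun q _ => ?_
    rw [hB q i]; ring
  have h3 : ∑ k, ∑ q, B k q * ((d k j q + d j k q - d q k j) / 2)
      = (∑ k, ∑ q, B k q * d k q j) / 2 + (∑ k, ∑ q, B k q * d j k q) / 2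
        - (∑ k, ∑ q, B k q * d q k j) / 2 := by
    simp only [Finset.sum_div, ← Finset.sum_add_distrib, ← Finset.sum_sub_distrib]
    refine Finset.sum_congr rfl fun k _ => Finset.sum_congr rfl fun q _ => ?_
    rw [hd k j q]; ring
  rw [h3, h1, h2]; ring

end IndexAlgebra

section Calculus

variable {n : ℕ} {G : EuclideanSpace ℝ (Fin n) → Matrix (Fin n) (Fin n) ℝ}
  {y : EuclideanSpace ℝ (Fin n)}

theorem contDiff_det {F : Type*} [NormedAddCommGroup F] [NormedSpace ℝ F] {k : WithTop ℕ∞}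
    {s : Set F} {A : F → Matrix (Fin n) (Fin n) ℝ}
    (hA : ∀ i j, ContDiffOn ℝ k (fun x => A x i j) s) : ContDiffOn ℝ k (fun x => (A x).det) s := by
  simp only [Matrix.det_apply]
  refine ContDiffOn.sum fun σ _ => ?_
  exact (contDiffOn_prod fun i _ => hA _ _).const_smul _

/-- By Cramer's rule the entries are quotients of determinants. -/
theorem contDiffOn_inv {F : Type*} [NormedAddCommGroup F] [NormedSpace ℝ F] {k : WithTop ℕ∞}
    {s : Set F} {A : F → Matrix (Fin n) (Fin n) ℝ}
    (hA : ∀ i j, ContDiffOn ℝ k (fun x => A x i j) s) (hdet : ∀ x ∈ s, (A x).det ≠ 0)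
    (i j : Fin n) : ContDiffOn ℝ k (fun x => (A x)⁻¹ i j) s := by
  have h : ∀ x, (A x)⁻¹ i j = ((A x).det)⁻¹ * ((A x).updateRow j (Pi.single i 1)).det := by
    intro x
    rw [Matrix.inv_def, Matrix.smul_apply, Matrix.adjugate_apply, Ring.inverse_eq_inv', smul_eq_mul]
  simp only [h]
  refine ((contDiff_det hA).inv hdet).mul (contDiff_det fun a b => ?_)
  simp only [Matrix.updateRow_apply]
  split_ifs
  · exact contDiffOn_const
  · exact hA a b

/-- Jacobi's formula. As a function of the entries, `det` is differentiable, and along the line `G +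
t H` it equals `det G * det (1 + t G⁻¹ H)`. The derivative of the last factor at `t = 0` is the
trace of `G⁻¹ H`. -/
theorem partialDeriv_det (hG : ∀ i j, DifferentiableAt ℝ (fun z => G z i j) y)
    (hdet : (G y).det ≠ 0) (k : Fin n) :
    partialDeriv k (fun z => (G z).det) y = (G y).det *
      ∑ a, ∑ b, (G y)⁻¹ a b * partialDeriv k (fun z => G z b a) y := by
  set D : (Fin n → Fin n → ℝ) → ℝ := fun A => (Matrix.of A).det with hD
  have hDd : Differentiable ℝ D := by
    have : ContDiffOn ℝ 1 D Set.univ := contDiff_det fun i j =>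
      (contDiff_apply_apply ℝ ℝ i j).contDiffOn
    exact (contDiffOn_univ.1 this).differentiable (by norm_num)
  set g : EuclideanSpace ℝ (Fin n) → Fin n → Fin n → ℝ := fun z i j => G z i j with hg
  have hgd : DifferentiableAt ℝ g y :=
    differentiableAt_pi.2 fun i => differentiableAt_pi.2 fun j => hG i j
  set H : Matrix (Fin n) (Fin n) ℝ :=
    Matrix.of fun i j => partialDeriv k (fun z => G z i j) y with hH
  have hgH : fderiv ℝ g y (basisVec k) = fun i j => H i j := by
    funext i j
    have h1 := hasFDerivAt_pi'.1 (hasFDerivAt_pi'.1 hgd.hasFDerivAt i) j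
    simp only [hH, partialDeriv, Matrix.of_apply]
    exact (congrArg (fun L => L (basisVec k)) h1.fderiv).symm
  have h1 : partialDeriv k (fun z => (G z).det) y = fderiv ℝ D (g y) (fun i j => H i j) := by
    have h2 : HasFDerivAt (fun z => (G z).det) _ y :=
      (hDd (g y)).hasFDerivAt.comp y hgd.hasFDerivAt
    rw [partialDeriv, h2.fderiv, ContinuousLinearMap.comp_apply, hgH]
  have h3 : HasDerivAt (fun t : ℝ => D (g y + t • fun i j => H i j))
      (fderiv ℝ D (g y) (fun i j => H i j)) 0 := by
    have hl : HasDerivAt (fun t : ℝ => g y + t • fun i j => H i j) (fun i j => H i j) 0 := by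
      simpa using ((hasDerivAt_id (0 : ℝ)).smul_const (fun i j => H i j)).const_add (g y)
    have h0 : HasFDerivAt D (fderiv ℝ D (g y)) (g y + (0 : ℝ) • fun i j => H i j) := by
      simpa using (hDd (g y)).hasFDerivAt
    exact h0.comp_hasDerivAt (0 : ℝ) hl
  have h4 : ∀ t : ℝ, D (g y + t • fun i j => H i j)
      = (G y).det * (1 + t • ((G y)⁻¹ * H)).det := by
    intro t
    rw [← Matrix.det_mul, mul_add, mul_one, Matrix.mul_smul, ← Matrix.mul_assoc,
      Matrix.mul_nonsing_inv _ (isUnit_iff_ne_zero.2 hdet), one_mul]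
    rfl
  have h5 : HasDerivAt (fun t : ℝ => (1 + t • ((G y)⁻¹ * H)).det) ((G y)⁻¹ * H).trace 0 := by
    generalize (G y)⁻¹ * H = A
    have h6 := (Matrix.det (1 + (Polynomial.X : Polynomial ℝ) •
      A.map Polynomial.C)).hasDerivAt 0
    rw [Matrix.derivative_det_one_add_X_smul] at h6
    refine h6.congr_of_eventuallyEq (Filter.Eventually.of_forall fun t => ?_)
    simp only [← Polynomial.coe_evalRingHom, RingHom.map_det]
    congr 1
    ext i j
    simp [Matrix.one_apply, apply_ite]
    ring
  simp only [h4] at h3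
  rw [h1, h3.unique (h5.const_mul _)]
  simp [Matrix.trace, Matrix.mul_apply, hH]

end Calculus

end ChartGeometry

/-! ### Derivatives of the volume density and of the inverse metric; the codifferential of
one-forms. -/

namespace ChartGeometry

variable {n : ℕ} {G : EuclideanSpace ℝ (Fin n) → Matrix (Fin n) (Fin n) ℝ}
  {Ω : Set (EuclideanSpace ℝ (Fin n))} {y : EuclideanSpace ℝ (Fin n)}

section PartialDeriv

variable {f g : EuclideanSpace ℝ (Fin n) → ℝ}

theorem partialDeriv_mul (hf : DifferentiableAt ℝ f y) (hg : DifferentiableAt ℝ g y) (k : Fin n) :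
    partialDeriv k (fun z => f z * g z) y
      = partialDeriv k f y * g y + f y * partialDeriv k g y := by
  simp only [partialDeriv, fderiv_fun_mul hf hg, add_apply, smul_apply, smul_eq_mul]
  ring

theorem partialDeriv_sub (hf : DifferentiableAt ℝ f y) (hg : DifferentiableAt ℝ g y) (k : Fin n) :
    partialDeriv k (fun z => f z - g z) y = partialDeriv k f y - partialDeriv k g y := by
  simp [partialDeriv, fderiv_fun_sub hf hg]

theorem partialDeriv_sum {ι : Type*} {s : Finset ι} {f : ι → EuclideanSpace ℝ (Fin n) → ℝ}
    (hf : ∀ i ∈ s, DifferentiableAt ℝ (f i) y) (k : Fin n) :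
    partialDeriv k (fun z => ∑ i ∈ s, f i z) y = ∑ i ∈ s, partialDeriv k (f i) y := by
  simp [partialDeriv, fderiv_fun_sum hf]

theorem partialDeriv_congr (h : f =ᶠ[𝓝 y] g) (k : Fin n) :
    partialDeriv k f y = partialDeriv k g y := by
  simp [partialDeriv, h.fderiv_eq]

theorem contDiffOn_partialDeriv (hΩ : IsOpen Ω) (hf : ContDiffOn ℝ ∞ f Ω) (k : Fin n) :
    ContDiffOn ℝ ∞ (partialDeriv k f) Ω := by
  have h := hf.fderiv_of_isOpen hΩ (m := ∞) (by simp)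
  exact h.clm_apply contDiffOn_const

theorem differentiableAt_of_contDiffOn {f : EuclideanSpace ℝ (Fin n) → ℝ} (hΩ : IsOpen Ω)
    (hf : ContDiffOn ℝ ∞ f Ω) (hy : y ∈ Ω) : DifferentiableAt ℝ f y :=
  (hf.contDiffAt (hΩ.mem_nhds hy)).differentiableAt (by simp)

end PartialDeriv

/-- A smooth Riemannian metric on an open set of coordinate space. -/
structure IsSmoothMetricOn (G : EuclideanSpace ℝ (Fin n) → Matrix (Fin n) (Fin n) ℝ)
    (Ω : Set (EuclideanSpace ℝ (Fin n))) : Prop where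
  isOpen : IsOpen Ω
  contDiffOn : ∀ i j, ContDiffOn ℝ ∞ (fun z => G z i j) Ω
  posDef : ∀ z ∈ Ω, (G z).PosDef

/-- The Riemannian volume density. -/
def volumeDensity (G : EuclideanSpace ℝ (Fin n) → Matrix (Fin n) (Fin n) ℝ)
    (y : EuclideanSpace ℝ (Fin n)) : ℝ :=
  √(G y).det

namespace IsSmoothMetricOn

theorem det_pos (hG : IsSmoothMetricOn G Ω) (hy : y ∈ Ω) : 0 < (G y).det := (hG.posDef y hy).det_pos

theorem volumeDensity_pos (hG : IsSmoothMetricOn G Ω) (hy : y ∈ Ω) : 0 < volumeDensity G y :=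
  Real.sqrt_pos.2 (hG.det_pos hy)

theorem symm (hG : IsSmoothMetricOn G Ω) (hy : y ∈ Ω) (i j : Fin n) : G y i j = G y j i := by
  simpa using (hG.posDef y hy).isHermitian.apply j i

theorem inv_symm (hG : IsSmoothMetricOn G Ω) (hy : y ∈ Ω) (i j : Fin n) :
    (G y)⁻¹ i j = (G y)⁻¹ j i := by
  simpa using (hG.posDef y hy).isHermitian.inv.apply j i

theorem contDiffOn_inv (hG : IsSmoothMetricOn G Ω) (i j : Fin n) :
    ContDiffOn ℝ ∞ (fun z => (G z)⁻¹ i j) Ω :=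
  ChartGeometry.contDiffOn_inv hG.contDiffOn (fun _ hz => (hG.det_pos hz).ne') i j

theorem contDiffOn_volumeDensity (hG : IsSmoothMetricOn G Ω) : ContDiffOn ℝ ∞ (volumeDensity G) Ω :=
  (contDiff_det hG.contDiffOn).sqrt fun _ hz => (hG.det_pos hz).ne'

theorem differentiableAt_inv (hG : IsSmoothMetricOn G Ω) (hy : y ∈ Ω) (i j : Fin n) :
    DifferentiableAt ℝ (fun z => (G z)⁻¹ i j) y :=
  differentiableAt_of_contDiffOn hG.isOpen (hG.contDiffOn_inv i j) hy

theorem differentiableAt_volumeDensity (hG : IsSmoothMetricOn G Ω) (hy : y ∈ Ω) :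
    DifferentiableAt ℝ (volumeDensity G) y :=
  differentiableAt_of_contDiffOn hG.isOpen hG.contDiffOn_volumeDensity hy

theorem partialDeriv_volumeDensity (hG : IsSmoothMetricOn G Ω) (hy : y ∈ Ω) (k : Fin n) :
    partialDeriv k (volumeDensity G) y = volumeDensity G y *
      ((∑ a, ∑ b, (G y)⁻¹ a b * partialDeriv k (fun z => G z b a) y) / 2) := by
  have hd : ∀ i j, DifferentiableAt ℝ (fun z => G z i j) y := fun i j =>
    differentiableAt_of_contDiffOn hG.isOpen (hG.contDiffOn i j) hy
  have h1 := partialDeriv_det hd (hG.det_pos hy).ne' k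
  have h2 : DifferentiableAt ℝ (fun z => (G z).det) y :=
    differentiableAt_of_contDiffOn hG.isOpen (contDiff_det hG.contDiffOn) hy
  have h3 : HasFDerivAt (volumeDensity G) _ y := h2.hasFDerivAt.sqrt (hG.det_pos hy).ne'
  rw [partialDeriv, h3.fderiv]
  rw [partialDeriv] at h1
  simp only [smul_apply, smul_eq_mul, h1, volumeDensity]
  have h4 := Real.mul_self_sqrt (hG.det_pos hy).le
  have h5 : √(G y).det ≠ 0 := (Real.sqrt_pos.2 (hG.det_pos hy)).ne'
  nth_rewrite 2 [← h4]
  field_simp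

/-- Differentiate `G⁻¹ G = 1` and multiply by `G⁻¹` on the right. -/
theorem partialDeriv_inv (hG : IsSmoothMetricOn G Ω) (hy : y ∈ Ω) (k i j : Fin n) :
    partialDeriv k (fun z => (G z)⁻¹ i j) y
      = -∑ a, ∑ b, (G y)⁻¹ i a * partialDeriv k (fun z => G z a b) y * (G y)⁻¹ b j := by
  have hd : ∀ i j, DifferentiableAt ℝ (fun z => G z i j) y := fun i j =>
    differentiableAt_of_contDiffOn hG.isOpen (hG.contDiffOn i j) hy
  set D : Matrix (Fin n) (Fin n) ℝ := Matrix.of fun i j => partialDeriv k (fun z => G z i j) y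
    with hD
  set D' : Matrix (Fin n) (Fin n) ℝ :=
    Matrix.of fun i j => partialDeriv k (fun z => (G z)⁻¹ i j) y with hD'
  have hu : ∀ z ∈ Ω, IsUnit (G z).det := fun z hz => isUnit_iff_ne_zero.2 (hG.det_pos hz).ne'
  have h1 : D' * G y + (G y)⁻¹ * D = 0 := by
    ext a b
    have h2 : (fun z => ∑ l, (G z)⁻¹ a l * G z l b)
        =ᶠ[𝓝 y] fun _ => (1 : Matrix (Fin n) (Fin n) ℝ) a b := by
      filter_upwards [hG.isOpen.mem_nhds hy] with z hz
      rw [← Matrix.mul_apply, Matrix.nonsing_inv_mul _ (hu z hz)]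
    have h3 := partialDeriv_congr h2 k
    rw [partialDeriv_sum fun l _ => (hG.differentiableAt_inv hy a l).fun_mul (hd l b)] at h3
    simp only [partialDeriv_mul (hG.differentiableAt_inv hy a _) (hd _ b),
      Finset.sum_add_distrib] at h3
    simp only [Matrix.add_apply, Matrix.mul_apply, hD, hD', Matrix.of_apply, Matrix.zero_apply]
    rw [h3]
    simp [partialDeriv]
  have h2 : D' = -((G y)⁻¹ * D * (G y)⁻¹) := by
    have h3 : D' * G y * (G y)⁻¹ = -((G y)⁻¹ * D * (G y)⁻¹) := by
      rw [eq_neg_of_add_eq_zero_left h1, neg_mul]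
    rwa [Matrix.mul_assoc, Matrix.mul_nonsing_inv _ (hu y hy), Matrix.mul_one] at h3
  have h3 := congrFun (congrFun h2 i) j
  simp only [hD', Matrix.of_apply, Matrix.neg_apply, Matrix.mul_apply, hD, Finset.sum_mul] at h3
  rw [h3, Finset.sum_comm]

/-- The product rule, with the derivatives of density and inverse metric inserted, yields minus the
expression of `sum_trace_christoffel` times the density. -/
theorem sum_partialDeriv_volumeDensity_mul_inv (hG : IsSmoothMetricOn G Ω)
    (hy : y ∈ Ω) (k : Fin n) :
    ∑ i, partialDeriv i (fun z => volumeDensity G z * (G z)⁻¹ i k) y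
      = -(volumeDensity G y * ∑ i, ∑ j, (G y)⁻¹ i j * christoffel G y k i j) := by
  have hsd : ∀ l i j, partialDeriv l (fun z => G z i j) y
      = partialDeriv l (fun z => G z j i) y := by
    intro l i j
    refine partialDeriv_congr ?_ l
    filter_upwards [hG.isOpen.mem_nhds hy] with z hz using hG.symm hz i j
  have h := sum_trace_christoffel (g := fun i j => (G y)⁻¹ i j)
    (d := fun l i j => partialDeriv l (fun z => G z i j) y) (hG.inv_symm hy) hsd k
  simp only [christoffel]
  rw [h]
  simp only [partialDeriv_mul (hG.differentiableAt_volumeDensity hy)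
    (hG.differentiableAt_inv hy _ k), hG.partialDeriv_volumeDensity hy, hG.partialDeriv_inv hy]
  rw [Finset.sum_add_distrib]
  simp only [mul_neg, Finset.sum_neg_distrib, ← Finset.mul_sum, mul_assoc, Finset.sum_div]
  rw [mul_sub, Finset.mul_sum, Finset.mul_sum, Finset.mul_sum]
  have : ∀ i, volumeDensity G y * ((∑ a, ∑ b, (G y)⁻¹ a b * partialDeriv i (fun z => G z b a) y)
      * (G y)⁻¹ i k / 2) = volumeDensity G y * ((∑ a, ∑ b, (G y)⁻¹ a b *
        partialDeriv i (fun z => G z b a) y) / 2 * (G y)⁻¹ i k) := fun i => by ring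
  simp only [this, Finset.mul_sum]
  simp only [← Finset.mul_sum, ← Finset.sum_div]
  ring

/-- When the derivative falls on the density times the inverse metric, it produces exactly the
Christoffel term of `codiffOne`. -/
theorem sum_partialDeriv_sharp (hG : IsSmoothMetricOn G Ω)
    {w : EuclideanSpace ℝ (Fin n) → Fin n → ℝ} (hy : y ∈ Ω)
    (hw : ∀ j, DifferentiableAt ℝ (fun z => w z j) y) :
    ∑ i, partialDeriv i (fun z => volumeDensity G z * ∑ j, (G z)⁻¹ i j * w z j) y
      = -(volumeDensity G y * codiffOne G w y) := by
  have hs := hG.differentiableAt_volumeDensity hy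
  have hg := hG.differentiableAt_inv hy
  have h1 : ∀ i, partialDeriv i (fun z => volumeDensity G z * ∑ j, (G z)⁻¹ i j * w z j) y
      = ∑ j, (partialDeriv i (fun z => volumeDensity G z * (G z)⁻¹ i j) y * w y j
        + volumeDensity G y * ((G y)⁻¹ i j * partialDeriv i (fun z => w z j) y)) := by
    intro i
    simp only [Finset.mul_sum, ← mul_assoc]
    rw [partialDeriv_sum fun j _ => (hs.fun_mul (hg i j)).fun_mul (hw j)]
    refine Finset.sum_congr rfl fun j _ => ?_
    rw [partialDeriv_mul (hs.fun_mul (hg i j)) (hw j)]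
  simp only [h1, Finset.sum_add_distrib]
  rw [Finset.sum_comm]
  simp only [← Finset.sum_mul, hG.sum_partialDeriv_volumeDensity_mul_inv hy]
  have h2 : codiffOne G w y = (∑ k, (∑ i, ∑ j, (G y)⁻¹ i j * christoffel G y k i j) * w y k)
      - ∑ i, ∑ j, (G y)⁻¹ i j * partialDeriv i (fun z => w z j) y := by
    simp only [codiffOne, covDerivOne, mul_sub, Finset.sum_sub_distrib, neg_sub, Finset.sum_mul,
      Finset.mul_sum]
    congr 1
    rw [Finset.sum_comm_cycle]
    refine Finset.sum_congr rfl fun k _ => ?_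
    refine Finset.sum_congr rfl fun k _ => Finset.sum_congr rfl fun k _ => ?_
    ring
  rw [h2]
  simp only [neg_mul, Finset.sum_neg_distrib, mul_assoc, ← Finset.mul_sum]
  ring

end IsSmoothMetricOn

end ChartGeometry

/-! ### The codifferential of two-forms in divergence form. -/

namespace ChartGeometry

variable {n : ℕ} {G : EuclideanSpace ℝ (Fin n) → Matrix (Fin n) (Fin n) ℝ}
  {Ω : Set (EuclideanSpace ℝ (Fin n))} {y : EuclideanSpace ℝ (Fin n)}

namespace IsSmoothMetricOn

/-- This is the Christoffel term of `codiffTwo` that acts on the free index. Antisymmetry reduces it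
to first derivatives of the metric, in the shape that arises from differentiating the factor
`g^{jl}` which raises this index. -/
theorem sum_inv_mul_christoffel_antisymm (hG : IsSmoothMetricOn G Ω) (hy : y ∈ Ω)
    {b : Fin n → Fin n → ℝ} (hb : ∀ i j, b i j = - b j i) (l : Fin n) :
    ∑ j, (G y)⁻¹ l j * ∑ k, ∑ i, (G y)⁻¹ k i * ∑ p, christoffel G y p k j * b i p
      = ∑ k, ∑ i, ∑ j, (G y)⁻¹ k i * b i j *
        ∑ a, ∑ c, (G y)⁻¹ j a * partialDeriv k (fun z => G z a c) y * (G y)⁻¹ c l := by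
  have hsd : ∀ l i j, partialDeriv l (fun z => G z i j) y
      = partialDeriv l (fun z => G z j i) y := by
    intro l i j
    refine partialDeriv_congr ?_ l
    filter_upwards [hG.isOpen.mem_nhds hy] with z hz using hG.symm hz i j
  simp only [christoffel]
  set d : Fin n → Fin n → Fin n → ℝ := fun l i j => partialDeriv l (fun z => G z i j) y with hd
  set g : Fin n → Fin n → ℝ := fun i j => (G y)⁻¹ i j with hg
  have hgs : ∀ i j, g i j = g j i := hG.inv_symm hy
  change ∑ j, g l j * ∑ k, ∑ i, g k i * ∑ p, (∑ q, g p q * ((d k j q + d j k q - d q k j) / 2)) *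
    b i p = ∑ k, ∑ i, ∑ j, g k i * b i j * ∑ a, ∑ c, g j a * d k a c * g c l
  set B : Fin n → Fin n → ℝ := fun k q => ∑ i, ∑ p, g k i * b i p * g p q with hB
  have hBs : ∀ i j, B i j = - B j i := by
    intro i j
    simp only [hB, ← Finset.sum_neg_distrib]
    rw [Finset.sum_comm]
    refine Finset.sum_congr rfl fun p _ => Finset.sum_congr rfl fun q _ => ?_
    rw [hb q p, hgs i q, hgs p j]; ring
  have h1 : ∀ j, ∑ k, ∑ i, g k i * ∑ p, (∑ q, g p q * ((d k j q + d j k q - d q k j) / 2)) * b i p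
      = ∑ k, ∑ q, B k q * ((d k j q + d j k q - d q k j) / 2) := by
    intro j
    refine Finset.sum_congr rfl fun k _ => ?_
    simp only [hB, Finset.sum_mul, Finset.mul_sum]
    rw [Finset.sum_comm_cycle]
    refine Finset.sum_congr rfl fun q _ => Finset.sum_congr rfl fun i _ =>
      Finset.sum_congr rfl fun p _ => ?_
    ring
  have h2 : ∀ k, ∑ i, ∑ j, g k i * b i j * ∑ a, ∑ c, g j a * d k a c * g c l
      = ∑ c, g c l * ∑ a, B k a * d k a c := by
    intro k
    have h3 : ∀ i j, g k i * b i j * ∑ a, ∑ c, g j a * d k a c * g c l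
        = ∑ c, ∑ a, g c l * (g k i * b i j * g j a * d k a c) := by
      intro i j
      rw [Finset.sum_comm]
      simp only [Finset.mul_sum]
      refine Finset.sum_congr rfl fun q _ => Finset.sum_congr rfl fun i _ => ?_
      ring
    simp only [h3, hB, Finset.sum_mul, Finset.mul_sum]
    rw [Finset.sum_congr rfl fun i _ => Finset.sum_comm, Finset.sum_comm]
    refine Finset.sum_congr rfl fun c _ => ?_
    rw [Finset.sum_congr rfl fun i _ => Finset.sum_comm, Finset.sum_comm]
  simp only [h1, h2]
  rw [Finset.sum_comm]
  refine Finset.sum_congr rfl fun j _ => ?_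
  rw [← Finset.mul_sum, sum_antisymm_christoffel (d := d) hsd hBs, hgs l j]

/-- The product rule has three parts. The derivative of density times `g^{ki}` gives the first
Christoffel term of `codiffTwo`, the derivative of `β` its principal term, and the derivative of
`g^{jl}` its second Christoffel term by `sum_inv_mul_christoffel_antisymm`. -/
theorem sum_partialDeriv_sharp_two (hG : IsSmoothMetricOn G Ω)
    {β : EuclideanSpace ℝ (Fin n) → Fin n → Fin n → ℝ} (hy : y ∈ Ω)
    (hβ : ∀ i j, DifferentiableAt ℝ (fun z => β z i j) y) (hanti : ∀ i j, β y i j = - β y j i)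
    (l : Fin n) :
    ∑ k, partialDeriv k
        (fun z => volumeDensity G z * ∑ i, ∑ j, (G z)⁻¹ k i * β z i j * (G z)⁻¹ j l) y
      = -(volumeDensity G y * ∑ j, (G y)⁻¹ l j * codiffTwo G β y j) := by
  have hs := hG.differentiableAt_volumeDensity hy
  have hg := hG.differentiableAt_inv hy
  have h1 : ∀ k, partialDeriv k
      (fun z => volumeDensity G z * ∑ i, ∑ j, (G z)⁻¹ k i * β z i j * (G z)⁻¹ j l) y
      = ∑ i, ∑ j, (partialDeriv k (fun z => volumeDensity G z * (G z)⁻¹ k i) y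
            * (β y i j * (G y)⁻¹ j l)
          + volumeDensity G y * ((G y)⁻¹ k i * (partialDeriv k (fun z => β z i j) y * (G y)⁻¹ j l))
          - volumeDensity G y * ((G y)⁻¹ k i * β y i j *
            ∑ a, ∑ c, (G y)⁻¹ j a * partialDeriv k (fun z => G z a c) y * (G y)⁻¹ c l)) := by
    intro k
    have e : (fun z => volumeDensity G z * ∑ i, ∑ j, (G z)⁻¹ k i * β z i j * (G z)⁻¹ j l)
        = fun z => ∑ i, ∑ j, (volumeDensity G z * (G z)⁻¹ k i) * (β z i j * (G z)⁻¹ j l) := by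
      funext z
      simp only [Finset.mul_sum, mul_assoc]
    rw [e, partialDeriv_sum fun i _ => DifferentiableAt.fun_sum fun j _ =>
      (hs.fun_mul (hg k i)).fun_mul ((hβ i j).fun_mul (hg j l))]
    refine Finset.sum_congr rfl fun i _ => ?_
    rw [partialDeriv_sum fun j _ => (hs.fun_mul (hg k i)).fun_mul ((hβ i j).fun_mul (hg j l))]
    refine Finset.sum_congr rfl fun j _ => ?_
    rw [partialDeriv_mul (hs.fun_mul (hg k i)) ((hβ i j).fun_mul (hg j l)),
      partialDeriv_mul (hβ i j) (hg j l), hG.partialDeriv_inv hy]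
    ring
  simp only [h1, Finset.sum_add_distrib, Finset.sum_sub_distrib, ← Finset.mul_sum]
  rw [← hG.sum_inv_mul_christoffel_antisymm hy hanti l]
  have h2 : ∑ k, ∑ i, partialDeriv k (fun z => volumeDensity G z * (G z)⁻¹ k i) y
      * ∑ j, β y i j * (G y)⁻¹ j l = -(volumeDensity G y *
        ∑ j, (G y)⁻¹ l j * ∑ k, ∑ i, (G y)⁻¹ k i * ∑ p, christoffel G y p k i * β y p j) := by
    rw [Finset.sum_comm]
    simp only [← Finset.sum_mul, hG.sum_partialDeriv_volumeDensity_mul_inv hy, neg_mul,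
      Finset.sum_neg_distrib, mul_assoc, ← Finset.mul_sum]
    congr 2
    have e1 : ∀ j, ∑ k, ∑ i, (G y)⁻¹ k i * ∑ p, christoffel G y p k i * β y p j
        = ∑ p, (∑ k, ∑ i, (G y)⁻¹ k i * christoffel G y p k i) * β y p j := by
      intro j
      simp only [Finset.mul_sum, Finset.sum_mul]
      rw [Finset.sum_comm_cycle]
      refine Finset.sum_congr rfl fun p _ => Finset.sum_congr rfl fun k _ =>
        Finset.sum_congr rfl fun i _ => ?_
      ring
    simp only [e1]
    simp only [Finset.mul_sum]
    rw [Finset.sum_comm]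
    refine Finset.sum_congr rfl fun j _ => Finset.sum_congr rfl fun p _ => ?_
    rw [hG.inv_symm hy l j]; ring
  have h3 : ∑ k, ∑ i, (G y)⁻¹ k i * ∑ j, partialDeriv k (fun z => β z i j) y * (G y)⁻¹ j l
      = ∑ j, (G y)⁻¹ l j * ∑ k, ∑ i, (G y)⁻¹ k i * partialDeriv k (fun z => β z i j) y := by
    simp only [Finset.mul_sum]
    rw [Finset.sum_comm_cycle]
    refine Finset.sum_congr rfl fun j _ => Finset.sum_congr rfl fun k _ =>
      Finset.sum_congr rfl fun i _ => ?_
    rw [hG.inv_symm hy l j]; ring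
  rw [h2, h3]
  simp only [codiffTwo, covDerivTwo, mul_sub, Finset.sum_sub_distrib, mul_neg,
    Finset.sum_neg_distrib]
  ring

end IsSmoothMetricOn

end ChartGeometry

/-! ### The energy identity for harmonic one-forms in a chart -/

namespace ChartGeometry

variable {n : ℕ} {G : EuclideanSpace ℝ (Fin n) → Matrix (Fin n) (Fin n) ℝ}
  {Ω : Set (EuclideanSpace ℝ (Fin n))} {y : EuclideanSpace ℝ (Fin n)}
  {w : EuclideanSpace ℝ (Fin n) → Fin n → ℝ}

/-- The exterior derivative of a one-form with both indices raised. -/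
def raisedExtDeriv (G : EuclideanSpace ℝ (Fin n) → Matrix (Fin n) (Fin n) ℝ)
    (w : EuclideanSpace ℝ (Fin n) → Fin n → ℝ) (y : EuclideanSpace ℝ (Fin n)) (k l : Fin n) : ℝ :=
  ∑ i, ∑ j, (G y)⁻¹ k i * extDerivOne w y i j * (G y)⁻¹ j l

/-- The vector field `(d* w) w^♯ - (d w)(·, w)^♯`, whose divergence is minus the energy density
when `w` is harmonic. -/
def hodgeFlux (G : EuclideanSpace ℝ (Fin n) → Matrix (Fin n) (Fin n) ℝ)
    (w : EuclideanSpace ℝ (Fin n) → Fin n → ℝ) (y : EuclideanSpace ℝ (Fin n)) (k : Fin n) : ℝ :=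
  codiffOne G w y * (∑ j, (G y)⁻¹ k j * w y j) - ∑ l, raisedExtDeriv G w y k l * w y l

/-- The energy density `|d* w|² + |d w|²`. -/
def hodgeEnergy (G : EuclideanSpace ℝ (Fin n) → Matrix (Fin n) (Fin n) ℝ)
    (w : EuclideanSpace ℝ (Fin n) → Fin n → ℝ) (y : EuclideanSpace ℝ (Fin n)) : ℝ :=
  codiffOne G w y ^ 2 + (∑ k, ∑ l, raisedExtDeriv G w y k l * extDerivOne w y k l) / 2

theorem extDerivOne_antisymm (w : EuclideanSpace ℝ (Fin n) → Fin n → ℝ)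
    (y : EuclideanSpace ℝ (Fin n)) (i j : Fin n) : extDerivOne w y i j = -extDerivOne w y j i := by
  simp [extDerivOne]

namespace IsSmoothMetricOn

theorem contDiffOn_extDerivOne (hG : IsSmoothMetricOn G Ω)
    (hw : ∀ j, ContDiffOn ℝ ∞ (fun z => w z j) Ω) (i j : Fin n) :
    ContDiffOn ℝ ∞ (fun z => extDerivOne w z i j) Ω :=
  (contDiffOn_partialDeriv hG.isOpen (hw j) i).sub (contDiffOn_partialDeriv hG.isOpen (hw i) j)

theorem contDiffOn_raisedExtDeriv (hG : IsSmoothMetricOn G Ω)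
    (hw : ∀ j, ContDiffOn ℝ ∞ (fun z => w z j) Ω) (k l : Fin n) :
    ContDiffOn ℝ ∞ (fun z => raisedExtDeriv G w z k l) Ω :=
  ContDiffOn.sum fun i _ => ContDiffOn.sum fun j _ =>
    ((hG.contDiffOn_inv k i).mul (hG.contDiffOn_extDerivOne hw i j)).mul (hG.contDiffOn_inv j l)

theorem contDiffOn_christoffel (hG : IsSmoothMetricOn G Ω) (k i j : Fin n) :
    ContDiffOn ℝ ∞ (fun z => christoffel G z k i j) Ω :=
  ContDiffOn.sum fun l _ => (hG.contDiffOn_inv k l).mul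
    ((((contDiffOn_partialDeriv hG.isOpen (hG.contDiffOn j l) i).add
      (contDiffOn_partialDeriv hG.isOpen (hG.contDiffOn i l) j)).sub
      (contDiffOn_partialDeriv hG.isOpen (hG.contDiffOn i j) l)).div_const 2)

theorem contDiffOn_codiffOne (hG : IsSmoothMetricOn G Ω)
    (hw : ∀ j, ContDiffOn ℝ ∞ (fun z => w z j) Ω) : ContDiffOn ℝ ∞ (codiffOne G w) Ω :=
  (ContDiffOn.sum fun i _ => ContDiffOn.sum fun j _ => (hG.contDiffOn_inv i j).mul
    ((contDiffOn_partialDeriv hG.isOpen (hw j) i).sub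
      (ContDiffOn.sum fun k _ => (hG.contDiffOn_christoffel k i j).mul (hw k)))).neg

theorem contDiffOn_sharp (hG : IsSmoothMetricOn G Ω)
    (hw : ∀ j, ContDiffOn ℝ ∞ (fun z => w z j) Ω) (k : Fin n) :
    ContDiffOn ℝ ∞ (fun z => ∑ j, (G z)⁻¹ k j * w z j) Ω :=
  ContDiffOn.sum fun j _ => (hG.contDiffOn_inv k j).mul (hw j)

theorem contDiffOn_hodgeFlux (hG : IsSmoothMetricOn G Ω)
    (hw : ∀ j, ContDiffOn ℝ ∞ (fun z => w z j) Ω) (k : Fin n) :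
    ContDiffOn ℝ ∞ (fun z => hodgeFlux G w z k) Ω :=
  ((hG.contDiffOn_codiffOne hw).mul (hG.contDiffOn_sharp hw k)).sub
    (ContDiffOn.sum fun l _ => (hG.contDiffOn_raisedExtDeriv hw k l).mul (hw l))

theorem contDiffOn_hodgeEnergy (hG : IsSmoothMetricOn G Ω)
    (hw : ∀ j, ContDiffOn ℝ ∞ (fun z => w z j) Ω) :
    ContDiffOn ℝ ∞ (hodgeEnergy G w) Ω :=
  ((hG.contDiffOn_codiffOne hw).pow 2).add ((ContDiffOn.sum fun k _ => ContDiffOn.sum fun l _ =>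
    (hG.contDiffOn_raisedExtDeriv hw k l).mul (hG.contDiffOn_extDerivOne hw k l)).div_const 2)

theorem raisedExtDeriv_antisymm (hG : IsSmoothMetricOn G Ω) (hy : y ∈ Ω) (k l : Fin n) :
    raisedExtDeriv G w y k l = -raisedExtDeriv G w y l k := by
  simp only [raisedExtDeriv, ← Finset.sum_neg_distrib]
  rw [Finset.sum_comm]
  refine Finset.sum_congr rfl fun p _ => Finset.sum_congr rfl fun q _ => ?_
  rw [extDerivOne_antisymm w y q p, hG.inv_symm hy k q, hG.inv_symm hy p l]; ring

theorem raisedExtDeriv_eq (w : EuclideanSpace ℝ (Fin n) → Fin n → ℝ) (k l : Fin n) :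
    raisedExtDeriv G w y k l
      = ((G y)⁻¹ * (Matrix.of fun i j => extDerivOne w y i j) * (G y)⁻¹) k l := by
  simp only [raisedExtDeriv, Matrix.mul_apply, Finset.sum_mul, Matrix.of_apply]
  rw [Finset.sum_comm]

/-- The energy identity. -/
theorem sum_partialDeriv_hodgeFlux (hG : IsSmoothMetricOn G Ω)
    (hw : ∀ j, ContDiffOn ℝ ∞ (fun z => w z j) Ω) (hy : y ∈ Ω)
    (hharm : ∀ j, hodgeLaplacianOne G w y j = 0) :
    ∑ k, partialDeriv k (fun z => volumeDensity G z * hodgeFlux G w z k) y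
      = -(volumeDensity G y * hodgeEnergy G w y) := by
  have dif : ∀ {f : EuclideanSpace ℝ (Fin n) → ℝ}, ContDiffOn ℝ ∞ f Ω → DifferentiableAt ℝ f y :=
    fun hf => differentiableAt_of_contDiffOn hG.isOpen hf hy
  have hc := dif (hG.contDiffOn_codiffOne hw)
  have hsg := fun k => dif (hG.contDiffOn_volumeDensity.mul (hG.contDiffOn_sharp hw k))
  have hsb := fun k l => dif (hG.contDiffOn_volumeDensity.mul (hG.contDiffOn_raisedExtDeriv hw k l))
  have hwd := fun l => dif (hw l)
  have h1 : ∀ k, partialDeriv k (fun z => volumeDensity G z * hodgeFlux G w z k) y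
      = partialDeriv k (codiffOne G w) y * (volumeDensity G y * ∑ j, (G y)⁻¹ k j * w y j)
        + codiffOne G w y * partialDeriv k (fun z => volumeDensity G z * ∑ j, (G z)⁻¹ k j * w z j) y
        - ∑ l, (partialDeriv k (fun z => volumeDensity G z * raisedExtDeriv G w z k l) y * w y l
          + volumeDensity G y * raisedExtDeriv G w y k l * partialDeriv k (fun z => w z l) y) := by
    intro k
    have e : (fun z => volumeDensity G z * hodgeFlux G w z k)
        = fun z => codiffOne G w z * (volumeDensity G z * ∑ j, (G z)⁻¹ k j * w z j)
          - ∑ l, (volumeDensity G z * raisedExtDeriv G w z k l) * w z l := by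
      funext z
      simp only [hodgeFlux, mul_sub, Finset.mul_sum, mul_assoc]
      congr 1
      refine Finset.sum_congr rfl fun j _ => ?_
      ring
    rw [e, partialDeriv_sub (hc.fun_mul (hsg k))
      (DifferentiableAt.fun_sum fun l _ => (hsb k l).fun_mul (hwd l)),
      partialDeriv_mul hc (hsg k), partialDeriv_sum fun l _ => (hsb k l).fun_mul (hwd l)]
    congr 1
    refine Finset.sum_congr rfl fun l _ => ?_
    rw [partialDeriv_mul (hsb k l) (hwd l)]
  simp only [h1, Finset.sum_sub_distrib, Finset.sum_add_distrib, ← Finset.mul_sum]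
  rw [hG.sum_partialDeriv_sharp hy hwd]
  have h2 : ∑ k, ∑ l,
      partialDeriv k (fun z => volumeDensity G z * raisedExtDeriv G w z k l) y * w y l
      = -(volumeDensity G y *
        ∑ k, codiffTwo G (extDerivOne w) y k * ∑ j, (G y)⁻¹ k j * w y j) := by
    rw [Finset.sum_comm]
    have h3 := fun l => hG.sum_partialDeriv_sharp_two (β := extDerivOne w) hy
      (fun i j => dif (hG.contDiffOn_extDerivOne hw i j)) (extDerivOne_antisymm w y) l
    simp only [← raisedExtDeriv.eq_1] at h3
    simp only [← Finset.sum_mul, h3, neg_mul, Finset.sum_neg_distrib, mul_assoc, ← Finset.mul_sum]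
    congr 2
    simp only [Finset.mul_sum, Finset.sum_mul]
    rw [Finset.sum_comm]
    refine Finset.sum_congr rfl fun j _ => Finset.sum_congr rfl fun l _ => ?_
    rw [hG.inv_symm hy l j]; ring
  -- Contraction with an antisymmetric tensor sees only the antisymmetric part of `∂_k w_l`, which
  -- is half of `dw`.
  have h4 : ∑ k, ∑ l, raisedExtDeriv G w y k l * partialDeriv k (fun z => w z l) y
      = (∑ k, ∑ l, raisedExtDeriv G w y k l * extDerivOne w y k l) / 2 := by
    have h5 : ∑ k, ∑ l, raisedExtDeriv G w y k l * partialDeriv l (fun z => w z k) y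
        = -∑ k, ∑ l, raisedExtDeriv G w y k l * partialDeriv k (fun z => w z l) y := by
      rw [Finset.sum_comm]
      simp only [← Finset.sum_neg_distrib]
      refine Finset.sum_congr rfl fun j _ => Finset.sum_congr rfl fun l _ => ?_
      rw [hG.raisedExtDeriv_antisymm hy l j]; ring
    simp only [extDerivOne, mul_sub, Finset.sum_sub_distrib]
    rw [h5]; ring
  -- Harmonicity replaces `d d* w` by `-d* d w`, so this sum cancels against `h2` and only the
  -- energy is left.
  have h6 : ∑ k, partialDeriv k (codiffOne G w) y * (volumeDensity G y * ∑ j, (G y)⁻¹ k j * w y j)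
      = -(volumeDensity G y *
        ∑ k, codiffTwo G (extDerivOne w) y k * ∑ j, (G y)⁻¹ k j * w y j) := by
    rw [Finset.mul_sum, ← Finset.sum_neg_distrib]
    refine Finset.sum_congr rfl fun k _ => ?_
    have := hharm k
    rw [hodgeLaplacianOne] at this
    rw [eq_neg_of_add_eq_zero_left this]; ring
  rw [h2, h6]
  simp only [mul_assoc, ← Finset.mul_sum]
  rw [h4, hodgeEnergy]
  ring

open scoped MatrixOrder Matrix.Norms.L2Operator in
theorem _root_.Matrix.PosDef.exists_isUnit_eq_conjTranspose_mul_self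
    {A : Matrix (Fin n) (Fin n) ℝ} (hA : A.PosDef) :
    ∃ C : Matrix (Fin n) (Fin n) ℝ, IsUnit C ∧ A = C.conjTranspose * C :=
  CStarAlgebra.isStrictlyPositive_iff_eq_star_mul_self.1 hA.isStrictlyPositive

/-- With `G⁻¹ = Cᵀ C` the sum is the squared Frobenius norm of `C b Cᵀ`, where `b` is the matrix of
`dw`. As `C` is invertible, it vanishes only for `b = 0`. -/
theorem sum_raisedExtDeriv_nonneg (hG : IsSmoothMetricOn G Ω) (hy : y ∈ Ω) :
    0 ≤ ∑ k, ∑ l, raisedExtDeriv G w y k l * extDerivOne w y k l ∧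
    (∑ k, ∑ l, raisedExtDeriv G w y k l * extDerivOne w y k l = 0 →
      ∀ i j, extDerivOne w y i j = 0) := by
  obtain ⟨C, hC, hCg⟩ := (hG.posDef y hy).inv.exists_isUnit_eq_conjTranspose_mul_self
  set b : Matrix (Fin n) (Fin n) ℝ := Matrix.of fun i j => extDerivOne w y i j with hb
  have h1 : ∑ k, ∑ l, raisedExtDeriv G w y k l * extDerivOne w y k l
      = ((C * b * C.conjTranspose) * (C * b * C.conjTranspose).conjTranspose).trace := by
    have h2 : ((C * b * C.conjTranspose) * (C * b * C.conjTranspose).conjTranspose).trace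
        = ((G y)⁻¹ * b * (G y)⁻¹ * b.conjTranspose).trace := by
      rw [hCg]
      simp only [Matrix.conjTranspose_mul, Matrix.conjTranspose_conjTranspose, Matrix.mul_assoc]
      rw [Matrix.trace_mul_comm C.conjTranspose]
      simp only [Matrix.mul_assoc]
    rw [h2]
    simp only [raisedExtDeriv_eq, Matrix.trace, Matrix.diag]
    refine Finset.sum_congr rfl fun k _ => ?_
    rw [Matrix.mul_apply]
    rfl
  rw [h1]
  refine ⟨(Matrix.posSemidef_self_mul_conjTranspose _).trace_nonneg, fun h0 i j => ?_⟩
  rw [Matrix.trace_mul_conjTranspose_self_eq_zero_iff] at h0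
  have hCc : IsUnit C.conjTranspose := by simpa using hC.star
  have h2 : b = 0 := by
    have h3 : C * b * C.conjTranspose * C.conjTranspose⁻¹ = 0 := by rw [h0, zero_mul]
    rw [Matrix.mul_assoc, Matrix.mul_nonsing_inv _ ((Matrix.isUnit_iff_isUnit_det _).1 hCc),
      Matrix.mul_one] at h3
    have h4 : C⁻¹ * (C * b) = 0 := by rw [h3, mul_zero]
    rwa [← Matrix.mul_assoc, Matrix.nonsing_inv_mul _ ((Matrix.isUnit_iff_isUnit_det _).1 hC),
      Matrix.one_mul] at h4
  exact congrFun (congrFun h2 i) j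

theorem hodgeEnergy_nonneg (hG : IsSmoothMetricOn G Ω) (hy : y ∈ Ω) : 0 ≤ hodgeEnergy G w y := by
  have := (hG.sum_raisedExtDeriv_nonneg (w := w) hy).1
  rw [hodgeEnergy]; positivity

theorem extDerivOne_eq_zero_of_hodgeEnergy (hG : IsSmoothMetricOn G Ω) (hy : y ∈ Ω)
    (h : hodgeEnergy G w y = 0) (i j : Fin n) : extDerivOne w y i j = 0 := by
  obtain ⟨h1, h2⟩ := hG.sum_raisedExtDeriv_nonneg (w := w) hy
  refine h2 ?_ i j
  rw [hodgeEnergy] at h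
  nlinarith [sq_nonneg (codiffOne G w y)]

end IsSmoothMetricOn

end ChartGeometry

/-! ### Change of coordinates -/

namespace ChartGeometry

variable {n : ℕ}

/-- The Jacobian matrix. -/
def jacobian (τ : EuclideanSpace ℝ (Fin n) → EuclideanSpace ℝ (Fin n))
    (y : EuclideanSpace ℝ (Fin n)) : Matrix (Fin n) (Fin n) ℝ :=
  Matrix.of fun a i => fderiv ℝ τ y (basisVec i) a

theorem sum_smul_basisVec (v : EuclideanSpace ℝ (Fin n)) : ∑ i, v i • basisVec i = v := by
  have := (EuclideanSpace.basisFun (Fin n) ℝ).sum_repr v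
  simpa [basisVec] using this

theorem fderiv_basisVec (τ : EuclideanSpace ℝ (Fin n) → EuclideanSpace ℝ (Fin n))
    (y : EuclideanSpace ℝ (Fin n)) (i : Fin n) :
    fderiv ℝ τ y (basisVec i) = ∑ a, jacobian τ y a i • basisVec a :=
  (sum_smul_basisVec _).symm

theorem det_jacobian (τ : EuclideanSpace ℝ (Fin n) → EuclideanSpace ℝ (Fin n))
    (y : EuclideanSpace ℝ (Fin n)) : (jacobian τ y).det = (fderiv ℝ τ y).det := by
  rw [ContinuousLinearMap.det, ← LinearMap.det_toMatrix (EuclideanSpace.basisFun (Fin n) ℝ).toBasis]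
  congr 1

theorem partialDeriv_comp {h : EuclideanSpace ℝ (Fin n) → ℝ}
    {τ : EuclideanSpace ℝ (Fin n) → EuclideanSpace ℝ (Fin n)} {y : EuclideanSpace ℝ (Fin n)}
    (hh : DifferentiableAt ℝ h (τ y)) (hτ : DifferentiableAt ℝ τ y) (k : Fin n) :
    partialDeriv k (fun z => h (τ z)) y = ∑ a, jacobian τ y a k * partialDeriv a h (τ y) := by
  have h1 : HasFDerivAt (fun z => h (τ z)) _ y := hh.hasFDerivAt.comp y hτ.hasFDerivAt
  rw [partialDeriv, h1.fderiv, ContinuousLinearMap.comp_apply, fderiv_basisVec, map_sum]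
  simp [partialDeriv]

/-- The exterior derivative of a pulled back one-form. -/
theorem extDerivOne_pullback {w w' : EuclideanSpace ℝ (Fin n) → Fin n → ℝ}
    {τ : EuclideanSpace ℝ (Fin n) → EuclideanSpace ℝ (Fin n)} {y : EuclideanSpace ℝ (Fin n)}
    (hw' : ∀ a, DifferentiableAt ℝ (fun z => w' z a) (τ y)) (hτ : ContDiffAt ℝ ∞ τ y)
    (hw : ∀ᶠ z in 𝓝 y, ∀ i, w z i = ∑ a, jacobian τ z a i * w' (τ z) a) :
    (Matrix.of fun i j => extDerivOne w y i j)
      = (jacobian τ y).transpose * (Matrix.of fun i j => extDerivOne w' (τ y) i j)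
        * jacobian τ y := by
  have hτd : DifferentiableAt ℝ τ y := hτ.differentiableAt (by simp)
  have hD : DifferentiableAt ℝ (fderiv ℝ τ) y :=
    (hτ.fderiv_right (m := ∞) (by simp)).differentiableAt (by simp)
  have hJ : ∀ a i, HasFDerivAt (fun z => jacobian τ z a i)
      ((EuclideanSpace.proj a : _ →L[ℝ] ℝ) ∘L ((fderiv ℝ (fderiv ℝ τ) y).flip (basisVec i))) y := by
    intro a i
    have h1 : HasFDerivAt (fun z => fderiv ℝ τ z (basisVec i))
        ((fderiv ℝ (fderiv ℝ τ) y).flip (basisVec i)) y := by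
      simpa using hD.hasFDerivAt.clm_apply (hasFDerivAt_const (basisVec i) y)
    exact (EuclideanSpace.proj a : _ →L[ℝ] ℝ).hasFDerivAt.comp y h1
  -- Second derivatives of `τ` are symmetric, so the terms with derivatives of the Jacobian cancel
  -- in the exterior derivative.
  have hsymm : ∀ k i a, partialDeriv k (fun z => jacobian τ z a i) y
      = partialDeriv i (fun z => jacobian τ z a k) y := by
    intro k i a
    rw [partialDeriv, partialDeriv, (hJ a i).fderiv, (hJ a k).fderiv]
    have h2 : fderiv ℝ (fderiv ℝ τ) y (basisVec k) (basisVec i)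
        = fderiv ℝ (fderiv ℝ τ) y (basisVec i) (basisVec k) :=
      ((hτ.of_le (m := 2) ENat.LEInfty.out).isSymmSndFDerivAt (by simp)).eq _ _
    simp [h2]
  have hcomp : ∀ a, DifferentiableAt ℝ (fun z => w' (τ z) a) y := fun a => (hw' a).comp y hτd
  have hpd : ∀ k i, partialDeriv k (fun z => w z i) y
      = ∑ a, partialDeriv k (fun z => jacobian τ z a i) y * w' (τ y) a
        + ∑ a, ∑ b, jacobian τ y a i *
          (jacobian τ y b k * partialDeriv b (fun z => w' z a) (τ y)) := by
    intro k i
    have h1 : (fun z => w z i) =ᶠ[𝓝 y] fun z => ∑ a, jacobian τ z a i * w' (τ z) a := by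
      filter_upwards [hw] with z hz using hz i
    rw [partialDeriv_congr h1,
      partialDeriv_sum fun a _ => (hJ a i).differentiableAt.fun_mul (hcomp a),
      ← Finset.sum_add_distrib]
    refine Finset.sum_congr rfl fun a _ => ?_
    rw [partialDeriv_mul (hJ a i).differentiableAt (hcomp a), partialDeriv_comp (hw' a) hτd,
      Finset.mul_sum]
  ext i j
  simp only [Matrix.of_apply, extDerivOne, hpd, Matrix.mul_apply, Matrix.transpose_apply]
  simp only [hsymm j i, mul_sub, sub_mul, Finset.sum_sub_distrib, Finset.sum_mul]
  rw [add_sub_add_left_eq_sub]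
  congr 1
  · refine Finset.sum_congr rfl fun a _ => Finset.sum_congr rfl fun b _ => ?_
    ring
  · rw [Finset.sum_comm]
    refine Finset.sum_congr rfl fun a _ => Finset.sum_congr rfl fun b _ => ?_
    ring

section LinearAlgebra

variable {J G G' : Matrix (Fin n) (Fin n) ℝ}

theorem isUnit_det_of_congr (h : G = J.transpose * G' * J) (hG : G.det ≠ 0) : IsUnit J.det := by
  rw [isUnit_iff_ne_zero]
  rintro h0
  apply hG
  rw [h, Matrix.det_mul, h0, mul_zero]

theorem inv_of_congr (h : G = J.transpose * G' * J) (hG : G.det ≠ 0) :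
    J * G⁻¹ * J.transpose = G'⁻¹ := by
  have hJ := isUnit_det_of_congr h hG
  have hJt : IsUnit J.transpose.det := by rwa [Matrix.det_transpose]
  rw [h, Matrix.mul_inv_rev, Matrix.mul_inv_rev, ← Matrix.mul_assoc, ← Matrix.mul_assoc,
    Matrix.mul_nonsing_inv _ hJ, Matrix.one_mul, Matrix.mul_assoc,
    Matrix.nonsing_inv_mul _ hJt, Matrix.mul_one]

/-- Pairings with a bilinear form on covectors are invariant under changes of coordinates. -/
theorem pairing_of_congr {B B' : Matrix (Fin n) (Fin n) ℝ} (h : J * B * J.transpose = B')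
    (a b : Fin n → ℝ) :
    (J.transpose.mulVec a) ⬝ᵥ B.mulVec (J.transpose.mulVec b) = a ⬝ᵥ B'.mulVec b := by
  rw [← h, Matrix.mulVec_transpose, ← Matrix.dotProduct_mulVec, Matrix.mulVec_mulVec,
    Matrix.mulVec_mulVec]

theorem raised_of_congr (h : G = J.transpose * G' * J) (hG : G.det ≠ 0)
    {b b' : Matrix (Fin n) (Fin n) ℝ} (hb : b = J.transpose * b' * J) :
    J * (G⁻¹ * b * G⁻¹) * J.transpose = G'⁻¹ * b' * G'⁻¹ := by
  rw [← inv_of_congr h hG, hb]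
  simp only [Matrix.mul_assoc]

end LinearAlgebra

end ChartGeometry

/-! ### Integration in charts -/

namespace ChartGeometry

open MeasureTheory

section Euclidean

variable {n : ℕ} {Ω K : Set (EuclideanSpace ℝ (Fin n))}

/-- Since `h` vanishes off a compact subset of `Ω`, its extension by zero is continuous with compact
support. -/
theorem integrableOn_of_continuousOn_of_eq_zero {h : EuclideanSpace ℝ (Fin n) → ℝ} (hΩ : IsOpen Ω)
    (hK : IsCompact K) (hKΩ : K ⊆ Ω) (hc : ContinuousOn h Ω) (h0 : ∀ y ∈ Ω, y ∉ K → h y = 0) :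
    IntegrableOn h Ω := by
  have hcont : Continuous (Ω.indicator h) := by
    rw [continuous_iff_continuousAt]
    intro y
    by_cases hy : y ∈ Ω
    · refine (hc.continuousAt (hΩ.mem_nhds hy)).congr ?_
      filter_upwards [hΩ.mem_nhds hy] with z hz
      rw [Set.indicator_of_mem hz]
    · have hy' : y ∈ Kᶜ := fun h => hy (hKΩ h)
      refine (continuousAt_const (y := (0 : ℝ))).congr ?_
      filter_upwards [hK.isClosed.isOpen_compl.mem_nhds hy'] with z hz
      by_cases hz' : z ∈ Ω
      · rw [Set.indicator_of_mem hz', h0 z hz' hz]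
      · rw [Set.indicator_of_notMem hz']
  have hsupp : HasCompactSupport (Ω.indicator h) := by
    refine HasCompactSupport.intro hK fun y hy => ?_
    by_cases hy' : y ∈ Ω
    · rw [Set.indicator_of_mem hy', h0 y hy' hy]
    · rw [Set.indicator_of_notMem hy']
  exact (integrable_indicator_iff hΩ.measurableSet).1 (hcont.integrable_of_hasCompactSupport hsupp)

theorem partialDeriv_eq_zero_of_eq_zero {φ : EuclideanSpace ℝ (Fin n) → ℝ} (hΩ : IsOpen Ω)
    (hK : IsClosed K) (h0 : ∀ y ∈ Ω, y ∉ K → φ y = 0) {y : EuclideanSpace ℝ (Fin n)} (hy : y ∈ Ω)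
    (hyK : y ∉ K) (k : Fin n) : partialDeriv k φ y = 0 := by
  have h : φ =ᶠ[𝓝 y] fun _ => 0 := by
    filter_upwards [hΩ.mem_nhds hy, hK.isOpen_compl.mem_nhds hyK] with z h1 h2 using h0 z h1 h2
  rw [partialDeriv_congr h]
  simp [partialDeriv]

/-- Extending `φ` by zero gives a differentiable function on the whole space, so integration by
parts there has no boundary term. `P` need only be differentiable on the support of `φ`. -/
theorem setIntegral_mul_partialDeriv {φ P : EuclideanSpace ℝ (Fin n) → ℝ} (hΩ : IsOpen Ω)
    (hK : IsCompact K) (hKΩ : K ⊆ Ω) (hφ : ContDiffOn ℝ ∞ φ Ω) (hP : ContDiffOn ℝ ∞ P Ω)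
    (h0 : ∀ y ∈ Ω, y ∉ K → φ y = 0) (k : Fin n) :
    ∫ y in Ω, φ y * partialDeriv k P y = -∫ y in Ω, partialDeriv k φ y * P y := by
  set f := Ω.indicator φ with hf
  have hfΩ : ∀ y ∈ Ω, f =ᶠ[𝓝 y] φ := fun y hy => by
    filter_upwards [hΩ.mem_nhds hy] with z hz
    rw [hf, Set.indicator_of_mem hz]
  have hfK : ∀ y ∉ K, f =ᶠ[𝓝 y] fun _ => 0 := fun y hy => by
    filter_upwards [hK.isClosed.isOpen_compl.mem_nhds hy] with z hz
    by_cases hz' : z ∈ Ω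
    · rw [hf, Set.indicator_of_mem hz', h0 z hz' hz]
    · rw [hf, Set.indicator_of_notMem hz']
  have hfd : Differentiable ℝ f := by
    intro y
    by_cases hy : y ∈ Ω
    · exact (hfΩ y hy).differentiableAt_iff.2 (differentiableAt_of_contDiffOn hΩ hφ hy)
    · exact (hfK y fun h => hy (hKΩ h)).differentiableAt_iff.2 (differentiableAt_const _)
  have hft : tsupport f ⊆ K := by
    refine closure_minimal (fun y hy => ?_) hK.isClosed
    by_contra hyK
    exact hy (hfK y hyK).self_of_nhds
  have hpf : ∀ y, partialDeriv k f y = Ω.indicator (partialDeriv k φ) y := by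
    intro y
    by_cases hy : y ∈ Ω
    · rw [Set.indicator_of_mem hy, partialDeriv_congr (hfΩ y hy)]
    · rw [Set.indicator_of_notMem hy, partialDeriv_congr (hfK y fun h => hy (hKΩ h))]
      simp [partialDeriv]
  have i1 : IntegrableOn (fun y => partialDeriv k φ y * P y) Ω :=
    integrableOn_of_continuousOn_of_eq_zero hΩ hK hKΩ
      ((contDiffOn_partialDeriv hΩ hφ k).continuousOn.mul hP.continuousOn) fun y hy hyK => by
        rw [partialDeriv_eq_zero_of_eq_zero hΩ hK.isClosed h0 hy hyK, zero_mul]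
  have i2 : IntegrableOn (fun y => φ y * partialDeriv k P y) Ω :=
    integrableOn_of_continuousOn_of_eq_zero hΩ hK hKΩ
      (hφ.continuousOn.mul (contDiffOn_partialDeriv hΩ hP k).continuousOn) fun y hy hyK => by
        rw [h0 y hy hyK, zero_mul]
  have i3 : IntegrableOn (fun y => φ y * P y) Ω :=
    integrableOn_of_continuousOn_of_eq_zero hΩ hK hKΩ (hφ.continuousOn.mul hP.continuousOn)
      fun y hy hyK => by rw [h0 y hy hyK, zero_mul]
  have e1 : (fun y => fderiv ℝ f y (basisVec k) * P y)
      = Ω.indicator fun y => partialDeriv k φ y * P y := by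
    funext y
    rw [← partialDeriv, hpf, Set.indicator_mul_left]
  have e2 : (fun y => f y * fderiv ℝ P y (basisVec k))
      = Ω.indicator fun y => φ y * partialDeriv k P y := by
    funext y
    rw [← partialDeriv, hf, Set.indicator_mul_left]
  have e3 : (fun y => f y * P y) = Ω.indicator fun y => φ y * P y := by
    funext y
    rw [hf, Set.indicator_mul_left]
  have key := integral_mul_fderiv_eq_neg_fderiv_mul_of_integrable (μ := volume) (f := f) (g := P)
    (v := basisVec k) (by rw [e1]; exact (integrable_indicator_iff hΩ.measurableSet).2 i1)
    (by rw [e2]; exact (integrable_indicator_iff hΩ.measurableSet).2 i2)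
    (by rw [e3]; exact (integrable_indicator_iff hΩ.measurableSet).2 i3)
    (fun x _ => hfd x)
    (fun x hx => differentiableAt_of_contDiffOn hΩ hP (hKΩ (hft hx)))
  rw [e1, e2, integral_indicator hΩ.measurableSet, integral_indicator hΩ.measurableSet] at key
  exact key

/-- Integration by parts against a divergence. -/
theorem setIntegral_mul_divergence {φ : EuclideanSpace ℝ (Fin n) → ℝ}
    {P : EuclideanSpace ℝ (Fin n) → Fin n → ℝ} (hΩ : IsOpen Ω)
    (hK : IsCompact K) (hKΩ : K ⊆ Ω) (hφ : ContDiffOn ℝ ∞ φ Ω)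
    (hP : ∀ k, ContDiffOn ℝ ∞ (fun z => P z k) Ω) (h0 : ∀ y ∈ Ω, y ∉ K → φ y = 0) :
    ∫ y in Ω, φ y * ∑ k, partialDeriv k (fun z => P z k) y
      = -∫ y in Ω, ∑ k, partialDeriv k φ y * P y k := by
  simp only [Finset.mul_sum]
  rw [integral_finsetSum, integral_finsetSum, ← Finset.sum_neg_distrib]
  · exact Finset.sum_congr rfl fun k _ => setIntegral_mul_partialDeriv hΩ hK hKΩ hφ (hP k) h0 k
  · intro k _
    exact integrableOn_of_continuousOn_of_eq_zero hΩ hK hKΩ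
      ((contDiffOn_partialDeriv hΩ hφ k).continuousOn.mul (hP k).continuousOn) fun y hy hyK => by
        rw [partialDeriv_eq_zero_of_eq_zero hΩ hK.isClosed h0 hy hyK, zero_mul]
  · intro k _
    exact integrableOn_of_continuousOn_of_eq_zero hΩ hK hKΩ
      (hφ.continuousOn.mul (contDiffOn_partialDeriv hΩ (hP k) k).continuousOn) fun y hy hyK => by
        rw [h0 y hy hyK, zero_mul]

end Euclidean

section Manifold

variable {n : ℕ} {M : Type*} [TopologicalSpace M] [ChartedSpace (EuclideanSpace ℝ (Fin n)) M]
  {e e' : OpenPartialHomeomorph M (EuclideanSpace ℝ (Fin n))}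

theorem contDiffOn_transition
    (he : e ∈ IsManifold.maximalAtlas (𝓡 n) ∞ M) (he' : e' ∈ IsManifold.maximalAtlas (𝓡 n) ∞ M) :
    ContDiffOn ℝ ∞ (fun y => e' (e.symm y)) (e.symm.trans e').source := by
  rw [← contMDiffOn_iff_contDiffOn]
  have h1 := contMDiffOn_symm_of_mem_maximalAtlas he
  have h2 := contMDiffOn_of_mem_maximalAtlas he'
  refine h2.comp (h1.mono ?_) ?_
  · intro y hy
    exact (by simpa using hy : y ∈ e.target ∧ _).1
  · intro y hy
    exact (by simpa using hy : _ ∧ e.symm y ∈ e'.source).2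

theorem contDiffOn_comp_symm {ρ : M → ℝ} (he : e ∈ IsManifold.maximalAtlas (𝓡 n) ∞ M)
    (hρ : ContMDiff (𝓡 n) 𝓘(ℝ) ∞ ρ) : ContDiffOn ℝ ∞ (fun y => ρ (e.symm y)) e.target := by
  rw [← contMDiffOn_iff_contDiffOn]
  exact hρ.comp_contMDiffOn (contMDiffOn_symm_of_mem_maximalAtlas he)

/-- A family of coordinate metrics, one for each chart, that is a Riemannian metric on `M`. -/
structure IsCompatibleMetric (G : OpenPartialHomeomorph M (EuclideanSpace ℝ (Fin n)) →
    EuclideanSpace ℝ (Fin n) → Matrix (Fin n) (Fin n) ℝ) : Prop where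
  smooth : ∀ e ∈ IsManifold.maximalAtlas (𝓡 n) ∞ M, IsSmoothMetricOn (G e) e.target
  congr : ∀ e ∈ IsManifold.maximalAtlas (𝓡 n) ∞ M, ∀ e' ∈ IsManifold.maximalAtlas (𝓡 n) ∞ M,
    ∀ y ∈ (e.symm.trans e').source, G e y =
      (jacobian (fun z => e' (e.symm z)) y).transpose * G e' (e' (e.symm y))
        * jacobian (fun z => e' (e.symm z)) y

/-- A family of coordinate one-forms, one for each chart, that is a one-form on `M`. -/
structure IsCompatibleForm (w : OpenPartialHomeomorph M (EuclideanSpace ℝ (Fin n)) →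
    EuclideanSpace ℝ (Fin n) → Fin n → ℝ) : Prop where
  smooth : ∀ e ∈ IsManifold.maximalAtlas (𝓡 n) ∞ M, ∀ i,
    ContDiffOn ℝ ∞ (fun y => w e y i) e.target
  congr : ∀ e ∈ IsManifold.maximalAtlas (𝓡 n) ∞ M, ∀ e' ∈ IsManifold.maximalAtlas (𝓡 n) ∞ M,
    ∀ y ∈ (e.symm.trans e').source, w e y =
      (jacobian (fun z => e' (e.symm z)) y).transpose.mulVec (w e' (e' (e.symm y)))

variable {G : OpenPartialHomeomorph M (EuclideanSpace ℝ (Fin n)) →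
    EuclideanSpace ℝ (Fin n) → Matrix (Fin n) (Fin n) ℝ}
  {w : OpenPartialHomeomorph M (EuclideanSpace ℝ (Fin n)) →
    EuclideanSpace ℝ (Fin n) → Fin n → ℝ}

/-- The integral over a chart domain for the Riemannian volume. -/
def chartIntegral (G : OpenPartialHomeomorph M (EuclideanSpace ℝ (Fin n)) →
    EuclideanSpace ℝ (Fin n) → Matrix (Fin n) (Fin n) ℝ)
    (e : OpenPartialHomeomorph M (EuclideanSpace ℝ (Fin n))) (ψ : M → ℝ) : ℝ :=
  ∫ y in e.target, ψ (e.symm y) * volumeDensity (G e) y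

theorem IsCompatibleMetric.volumeDensity_eq (hG : IsCompatibleMetric G)
    (he : e ∈ IsManifold.maximalAtlas (𝓡 n) ∞ M) (he' : e' ∈ IsManifold.maximalAtlas (𝓡 n) ∞ M)
    {y : EuclideanSpace ℝ (Fin n)} (hy : y ∈ (e.symm.trans e').source) :
    volumeDensity (G e) y = |(fderiv ℝ (fun z => e' (e.symm z)) y).det|
      * volumeDensity (G e') (e' (e.symm y)) := by
  rw [volumeDensity, hG.congr e he e' he' y hy, Matrix.det_mul, Matrix.det_mul,
    Matrix.det_transpose, det_jacobian, mul_right_comm, ← sq, Real.sqrt_mul (sq_nonneg _),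
    Real.sqrt_sq_eq_abs]
  rfl

/-- Change of variables between charts. -/
theorem IsCompatibleMetric.chartIntegral_eq (hG : IsCompatibleMetric G)
    (he : e ∈ IsManifold.maximalAtlas (𝓡 n) ∞ M) (he' : e' ∈ IsManifold.maximalAtlas (𝓡 n) ∞ M)
    {ψ ψ' : M → ℝ} (h : ∀ x ∈ e.source, x ∈ e'.source → ψ x = ψ' x)
    (h1 : ∀ x ∈ e.source, x ∉ e'.source → ψ x = 0)
    (h2 : ∀ x ∈ e'.source, x ∉ e.source → ψ' x = 0) :
    chartIntegral G e ψ = chartIntegral G e' ψ' := by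
  have hS : (e.symm.trans e').source = {y | y ∈ e.target ∧ e.symm y ∈ e'.source} := by
    ext y; simp
  have hS' : (e'.symm.trans e).source = {y | y ∈ e'.target ∧ e'.symm y ∈ e.source} := by
    ext y; simp
  have himg : (fun y => e' (e.symm y)) '' (e.symm.trans e').source = (e'.symm.trans e).source := by
    rw [hS, hS']
    ext z
    constructor
    · rintro ⟨y, ⟨hy1, hy2⟩, rfl⟩
      refine ⟨e'.map_source hy2, ?_⟩
      rw [e'.left_inv hy2]
      exact e.map_target hy1
    · rintro ⟨hz1, hz2⟩
      refine ⟨e (e'.symm z), ⟨e.map_source hz2, ?_⟩, ?_⟩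
      · rw [e.left_inv hz2]; exact e'.map_target hz1
      · simp only [e.left_inv hz2, e'.right_inv hz1]
  have hinj : Set.InjOn (fun y => e' (e.symm y)) (e.symm.trans e').source :=
    (e.symm.trans e').injOn
  have hopen : IsOpen (e.symm.trans e').source := (e.symm.trans e').open_source
  have hder : ∀ y ∈ (e.symm.trans e').source, HasFDerivWithinAt (fun y => e' (e.symm y))
      (fderiv ℝ (fun y => e' (e.symm y)) y) (e.symm.trans e').source y := fun y hy =>
    (((contDiffOn_transition he he').contDiffAt (hopen.mem_nhds hy)).differentiableAt
      (by simp)).hasFDerivAt.hasFDerivWithinAt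
  have hcv := integral_image_eq_integral_abs_det_fderiv_smul volume hopen.measurableSet hder hinj
    (fun z => ψ' (e'.symm z) * volumeDensity (G e') z)
  rw [himg] at hcv
  rw [chartIntegral, chartIntegral,
    setIntegral_eq_of_subset_of_forall_sdiff_eq_zero (s := (e.symm.trans e').source)
      e.open_target.measurableSet (by rw [hS]; exact fun y hy => hy.1)
      (fun y hy => by
        rw [h1 _ (e.map_target hy.1), zero_mul]
        intro h3; exact hy.2 (by rw [hS]; exact ⟨hy.1, h3⟩)),
    setIntegral_eq_of_subset_of_forall_sdiff_eq_zero (s := (e'.symm.trans e).source)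
      e'.open_target.measurableSet (by rw [hS']; exact fun y hy => hy.1)
      (fun y hy => by
        rw [h2 _ (e'.map_target hy.1), zero_mul]
        intro h3; exact hy.2 (by rw [hS']; exact ⟨hy.1, h3⟩)), hcv]
  refine setIntegral_congr_fun hopen.measurableSet fun y hy => ?_
  have hy' : y ∈ e.target ∧ e.symm y ∈ e'.source := by rw [hS] at hy; exact hy
  simp only [smul_eq_mul]
  rw [hG.volumeDensity_eq he he' hy, e'.left_inv hy'.2, h _ (e.map_target hy'.1) hy'.2]
  ring

theorem IsCompatibleMetric.integrableOn (hG : IsCompatibleMetric G)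
    (he : e ∈ IsManifold.maximalAtlas (𝓡 n) ∞ M) {ψ : M → ℝ} {K : Set M} (hK : IsCompact K)
    (hKe : K ⊆ e.source) (hψ : ContinuousOn (fun y => ψ (e.symm y)) e.target)
    (h0 : ∀ x ∈ e.source, x ∉ K → ψ x = 0) :
    IntegrableOn (fun y => ψ (e.symm y) * volumeDensity (G e) y) e.target := by
  refine integrableOn_of_continuousOn_of_eq_zero (K := e '' K) e.open_target
    (hK.image_of_continuousOn (e.continuousOn.mono hKe)) ?_
    (hψ.mul (hG.smooth e he).contDiffOn_volumeDensity.continuousOn) ?_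
  · rintro _ ⟨x, hx, rfl⟩
    exact e.map_source (hKe hx)
  · intro y hy hyK
    rw [h0 _ (e.map_target hy), zero_mul]
    exact fun h => hyK ⟨_, h, e.right_inv hy⟩

/-- A nonnegative function with integral zero vanishes. -/
theorem IsCompatibleMetric.eq_zero_of_chartIntegral_eq_zero (hG : IsCompatibleMetric G)
    (he : e ∈ IsManifold.maximalAtlas (𝓡 n) ∞ M) {ψ : M → ℝ} {K : Set M} (hK : IsCompact K)
    (hKe : K ⊆ e.source) (hψ : ContinuousOn (fun y => ψ (e.symm y)) e.target)
    (h0 : ∀ x ∈ e.source, x ∉ K → ψ x = 0) (hpos : ∀ x ∈ e.source, 0 ≤ ψ x)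
    (hint : chartIntegral G e ψ = 0) : ∀ x ∈ e.source, ψ x = 0 := by
  have hi := hG.integrableOn he hK hKe hψ h0
  have hnn : 0 ≤ᵐ[volume.restrict e.target] fun y => ψ (e.symm y) * volumeDensity (G e) y := by
    refine (ae_restrict_iff' e.open_target.measurableSet).2 (Filter.Eventually.of_forall ?_)
    intro y hy
    exact mul_nonneg (hpos _ (e.map_target hy)) (Real.sqrt_nonneg _)
  have h1 := (setIntegral_eq_zero_iff_of_nonneg_ae hnn hi).1 hint
  have h2 := Measure.eqOn_open_of_ae_eq h1 e.open_target
    (hψ.mul (hG.smooth e he).contDiffOn_volumeDensity.continuousOn) continuousOn_const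
  intro x hx
  have h3 := h2 (e.map_source hx)
  simp only [e.left_inv hx, Pi.zero_apply] at h3
  exact (mul_eq_zero.1 h3).resolve_right ((hG.smooth e he).volumeDensity_pos (e.map_source hx)).ne'

end Manifold

end ChartGeometry

/-! ### Harmonic one-forms on closed manifolds are closed -/

namespace ChartGeometry

open MeasureTheory

variable {n : ℕ} {M : Type*} [TopologicalSpace M]
  {e e' : OpenPartialHomeomorph M (EuclideanSpace ℝ (Fin n))}
  {G : OpenPartialHomeomorph M (EuclideanSpace ℝ (Fin n)) →
    EuclideanSpace ℝ (Fin n) → Matrix (Fin n) (Fin n) ℝ}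
  {w : OpenPartialHomeomorph M (EuclideanSpace ℝ (Fin n)) →
    EuclideanSpace ℝ (Fin n) → Fin n → ℝ} {ρ : M → ℝ} {x : M}

/-- The components of the differential of `ρ` in the chart `e`. -/
def chartGrad (e : OpenPartialHomeomorph M (EuclideanSpace ℝ (Fin n))) (ρ : M → ℝ)
    (y : EuclideanSpace ℝ (Fin n)) (k : Fin n) : ℝ :=
  partialDeriv k (fun z => ρ (e.symm z)) y

theorem chartGrad_eq_zero (hx : x ∈ e.source) (hρ : x ∉ tsupport ρ) : chartGrad e ρ (e x) = 0 := by
  funext k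
  have h0 : ρ =ᶠ[𝓝 x] fun _ => 0 := notMem_tsupport_iff_eventuallyEq.1 hρ
  have hc : Filter.Tendsto e.symm (𝓝 (e x)) (𝓝 x) := by
    have := e.continuousAt_symm (e.map_source hx)
    rwa [ContinuousAt, e.left_inv hx] at this
  have h1 : (fun z => ρ (e.symm z)) =ᶠ[𝓝 (e x)] fun _ => 0 := hc.eventually h0
  rw [chartGrad, partialDeriv_congr h1]
  simp [partialDeriv]

theorem mem_transition_source (hx : x ∈ e.source) (hx' : x ∈ e'.source) :
    e x ∈ (e.symm.trans e').source := by
  simp [hx, hx']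

/-- The pairing of `dρ` with `w`. -/
def gradPairing (G : OpenPartialHomeomorph M (EuclideanSpace ℝ (Fin n)) →
    EuclideanSpace ℝ (Fin n) → Matrix (Fin n) (Fin n) ℝ)
    (w : OpenPartialHomeomorph M (EuclideanSpace ℝ (Fin n)) →
    EuclideanSpace ℝ (Fin n) → Fin n → ℝ)
    (e : OpenPartialHomeomorph M (EuclideanSpace ℝ (Fin n))) (ρ : M → ℝ) (x : M) : ℝ :=
  chartGrad e ρ (e x) ⬝ᵥ ((G e (e x))⁻¹.mulVec (w e (e x)))

/-- The pairing of `dρ` with the flux of `w`. -/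
def fluxPairing (G : OpenPartialHomeomorph M (EuclideanSpace ℝ (Fin n)) →
    EuclideanSpace ℝ (Fin n) → Matrix (Fin n) (Fin n) ℝ)
    (w : OpenPartialHomeomorph M (EuclideanSpace ℝ (Fin n)) →
    EuclideanSpace ℝ (Fin n) → Fin n → ℝ)
    (e : OpenPartialHomeomorph M (EuclideanSpace ℝ (Fin n))) (ρ : M → ℝ) (x : M) : ℝ :=
  chartGrad e ρ (e x) ⬝ᵥ hodgeFlux (G e) (w e) (e x)

/-- This splits the flux into a scalar and two tensorial pairings, so that chart independence can be
checked for each of them separately. -/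
theorem fluxPairing_eq (x : M) : fluxPairing G w e ρ x
    = codiffOne (G e) (w e) (e x) * gradPairing G w e ρ x - chartGrad e ρ (e x) ⬝ᵥ
      ((G e (e x))⁻¹ * (Matrix.of fun i j => extDerivOne (w e) (e x) i j) * (G e (e x))⁻¹).mulVec
        (w e (e x)) := by
  rw [fluxPairing, gradPairing, ← smul_eq_mul, ← dotProduct_smul, ← dotProduct_sub]
  congr 1
  funext k
  simp only [hodgeFlux, IsSmoothMetricOn.raisedExtDeriv_eq]
  rfl

theorem fluxPairing_eq_zero (hx : x ∈ e.source) (hρ : x ∉ tsupport ρ) :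
    fluxPairing G w e ρ x = 0 := by
  rw [fluxPairing, chartGrad_eq_zero hx hρ, zero_dotProduct]

variable [ChartedSpace (EuclideanSpace ℝ (Fin n)) M]

theorem contDiffOn_chartGrad (he : e ∈ IsManifold.maximalAtlas (𝓡 n) ∞ M)
    (hρ : ContMDiff (𝓡 n) 𝓘(ℝ) ∞ ρ) (k : Fin n) :
    ContDiffOn ℝ ∞ (fun y => chartGrad e ρ y k) e.target :=
  contDiffOn_partialDeriv e.open_target (contDiffOn_comp_symm he hρ) k

theorem chartGrad_congr (he : e ∈ IsManifold.maximalAtlas (𝓡 n) ∞ M)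
    (he' : e' ∈ IsManifold.maximalAtlas (𝓡 n) ∞ M) (hρ : ContMDiff (𝓡 n) 𝓘(ℝ) ∞ ρ)
    (hx : x ∈ e.source) (hx' : x ∈ e'.source) :
    chartGrad e ρ (e x) = (jacobian (fun z => e' (e.symm z)) (e x)).transpose.mulVec
      (chartGrad e' ρ (e' x)) := by
  have hS := mem_transition_source hx hx'
  have hopen : IsOpen (e.symm.trans e').source := (e.symm.trans e').open_source
  have hτ : DifferentiableAt ℝ (fun z => e' (e.symm z)) (e x) :=
    ((contDiffOn_transition he he').contDiffAt (hopen.mem_nhds hS)).differentiableAt (by simp)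
  have hρ' : DifferentiableAt ℝ (fun z => ρ (e'.symm z)) (e' (e.symm (e x))) :=
    differentiableAt_of_contDiffOn e'.open_target (contDiffOn_comp_symm he' hρ)
      (by rw [e.left_inv hx]; exact e'.map_source hx')
  funext k
  have h1 : (fun z => ρ (e.symm z))
      =ᶠ[𝓝 (e x)] fun z => (fun z => ρ (e'.symm z)) (e' (e.symm z)) := by
    filter_upwards [hopen.mem_nhds hS] with z hz
    have hz' : e.symm z ∈ e'.source := by simp at hz; exact hz.2
    simp [e'.left_inv hz']
  rw [chartGrad, partialDeriv_congr h1,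
    partialDeriv_comp (h := fun z => ρ (e'.symm z)) hρ' hτ, e.left_inv hx]
  rfl

/-- Integration by parts in a chart, for the divergence of a vector field. -/
theorem IsCompatibleMetric.chartIntegral_mul_divergence [CompactSpace M]
    (hG : IsCompatibleMetric G) (he : e ∈ IsManifold.maximalAtlas (𝓡 n) ∞ M)
    (hρ : ContMDiff (𝓡 n) 𝓘(ℝ) ∞ ρ) (hsupp : tsupport ρ ⊆ e.source)
    {V : EuclideanSpace ℝ (Fin n) → Fin n → ℝ} {q : EuclideanSpace ℝ (Fin n) → ℝ}
    (hV : ∀ k, ContDiffOn ℝ ∞ (fun z => V z k) e.target)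
    (hq : ∀ y ∈ e.target, ∑ k, partialDeriv k (fun z => volumeDensity (G e) z * V z k) y
      = -(volumeDensity (G e) y * q y)) :
    chartIntegral G e (fun x => ρ x * q (e x))
      = chartIntegral G e (fun x => chartGrad e ρ (e x) ⬝ᵥ V (e x)) := by
  have hK : IsCompact (e '' tsupport ρ) :=
    (isClosed_tsupport ρ).isCompact.image_of_continuousOn (e.continuousOn.mono hsupp)
  have hKΩ : e '' tsupport ρ ⊆ e.target := by
    rintro _ ⟨x, hx, rfl⟩
    exact e.map_source (hsupp hx)
  have h0 : ∀ y ∈ e.target, y ∉ e '' tsupport ρ → ρ (e.symm y) = 0 := fun y hy hyK =>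
    image_eq_zero_of_notMem_tsupport fun h => hyK ⟨_, h, e.right_inv hy⟩
  have key := setIntegral_mul_divergence e.open_target hK hKΩ (contDiffOn_comp_symm he hρ)
    (P := fun z k => volumeDensity (G e) z * V z k)
    (fun k => (hG.smooth e he).contDiffOn_volumeDensity.mul (hV k)) h0
  have h1 : chartIntegral G e (fun x => ρ x * q (e x))
      = -∫ y in e.target, ρ (e.symm y) *
        ∑ k, partialDeriv k (fun z => volumeDensity (G e) z * V z k) y := by
    rw [chartIntegral, ← integral_neg]
    refine setIntegral_congr_fun e.open_target.measurableSet fun y hy => ?_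
    simp only [hq y hy, e.right_inv hy]
    ring
  rw [h1, key, neg_neg, chartIntegral]
  refine setIntegral_congr_fun e.open_target.measurableSet fun y hy => ?_
  simp only [e.right_inv hy, dotProduct, Finset.sum_mul, chartGrad]
  refine Finset.sum_congr rfl fun k _ => ?_
  ring

theorem IsCompatibleMetric.det_ne_zero (hG : IsCompatibleMetric G)
    (he : e ∈ IsManifold.maximalAtlas (𝓡 n) ∞ M) (hx : x ∈ e.source) : (G e (e x)).det ≠ 0 :=
  ((hG.smooth e he).det_pos (e.map_source hx)).ne'

theorem IsCompatibleMetric.congr' (hG : IsCompatibleMetric G)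
    (he : e ∈ IsManifold.maximalAtlas (𝓡 n) ∞ M) (he' : e' ∈ IsManifold.maximalAtlas (𝓡 n) ∞ M)
    (hx : x ∈ e.source) (hx' : x ∈ e'.source) : G e (e x) =
      (jacobian (fun z => e' (e.symm z)) (e x)).transpose * G e' (e' x)
        * jacobian (fun z => e' (e.symm z)) (e x) := by
  have := hG.congr e he e' he' _ (mem_transition_source hx hx')
  rwa [e.left_inv hx] at this

theorem IsCompatibleForm.congr' (hw : IsCompatibleForm w)
    (he : e ∈ IsManifold.maximalAtlas (𝓡 n) ∞ M) (he' : e' ∈ IsManifold.maximalAtlas (𝓡 n) ∞ M)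
    (hx : x ∈ e.source) (hx' : x ∈ e'.source) : w e (e x) =
      (jacobian (fun z => e' (e.symm z)) (e x)).transpose.mulVec (w e' (e' x)) := by
  have := hw.congr e he e' he' _ (mem_transition_source hx hx')
  rwa [e.left_inv hx] at this

theorem gradPairing_congr (hG : IsCompatibleMetric G) (hw : IsCompatibleForm w)
    (he : e ∈ IsManifold.maximalAtlas (𝓡 n) ∞ M) (he' : e' ∈ IsManifold.maximalAtlas (𝓡 n) ∞ M)
    (hρ : ContMDiff (𝓡 n) 𝓘(ℝ) ∞ ρ) (hx : x ∈ e.source) (hx' : x ∈ e'.source) :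
    gradPairing G w e ρ x = gradPairing G w e' ρ x := by
  rw [gradPairing, chartGrad_congr he he' hρ hx hx', hw.congr' he he' hx hx']
  exact pairing_of_congr (inv_of_congr (hG.congr' he he' hx hx') (hG.det_ne_zero he hx)) _ _

theorem IsCompatibleForm.extDerivOne_congr (hw : IsCompatibleForm w)
    (he : e ∈ IsManifold.maximalAtlas (𝓡 n) ∞ M) (he' : e' ∈ IsManifold.maximalAtlas (𝓡 n) ∞ M)
    (hx : x ∈ e.source) (hx' : x ∈ e'.source) :
    (Matrix.of fun i j => extDerivOne (w e) (e x) i j)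
      = (jacobian (fun z => e' (e.symm z)) (e x)).transpose
        * (Matrix.of fun i j => extDerivOne (w e') (e' x) i j)
        * jacobian (fun z => e' (e.symm z)) (e x) := by
  have hS := mem_transition_source hx hx'
  have hopen : IsOpen (e.symm.trans e').source := (e.symm.trans e').open_source
  have h := extDerivOne_pullback (w := w e) (w' := w e') (τ := fun z => e' (e.symm z)) (y := e x)
    (fun a => differentiableAt_of_contDiffOn e'.open_target (hw.smooth e' he' a)
      (by simpa [e.left_inv hx] using e'.map_source hx'))
    ((contDiffOn_transition he he').contDiffAt (hopen.mem_nhds hS)) (by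
      filter_upwards [hopen.mem_nhds hS] with z hz i
      rw [hw.congr e he e' he' z hz]
      rfl)
  simp only [e.left_inv hx] at h
  exact h

theorem chartIntegral_sub (hG : IsCompatibleMetric G)
    (he : e ∈ IsManifold.maximalAtlas (𝓡 n) ∞ M) {ψ ψ' : M → ℝ} {K : Set M} (hK : IsCompact K)
    (hKe : K ⊆ e.source) (hψ : ContinuousOn (fun y => ψ (e.symm y)) e.target)
    (h0 : ∀ x ∈ e.source, x ∉ K → ψ x = 0)
    (hψ' : ContinuousOn (fun y => ψ' (e.symm y)) e.target)
    (h0' : ∀ x ∈ e.source, x ∉ K → ψ' x = 0) :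
    chartIntegral G e (fun x => ψ x - ψ' x) = chartIntegral G e ψ - chartIntegral G e ψ' := by
  simp only [chartIntegral, sub_mul]
  exact integral_sub (hG.integrableOn he hK hKe hψ h0) (hG.integrableOn he hK hKe hψ' h0')

theorem chartIntegral_sum (hG : IsCompatibleMetric G)
    (he : e ∈ IsManifold.maximalAtlas (𝓡 n) ∞ M) {ι : Type*} {s : Finset ι} {ψ : ι → M → ℝ}
    {K : Set M} (hK : IsCompact K)
    (hKe : K ⊆ e.source) (hψ : ∀ i ∈ s, ContinuousOn (fun y => ψ i (e.symm y)) e.target)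
    (h0 : ∀ i ∈ s, ∀ x ∈ e.source, x ∉ K → ψ i x = 0) :
    chartIntegral G e (fun x => ∑ i ∈ s, ψ i x) = ∑ i ∈ s, chartIntegral G e (ψ i) := by
  simp only [chartIntegral, Finset.sum_mul]
  exact integral_finsetSum s fun i hi => hG.integrableOn he hK hKe (hψ i hi) (h0 i hi)

/-- The codifferential does not depend on the chart. -/
theorem codiffOne_congr [CompactSpace M] [T2Space M] [IsManifold (𝓡 n) ∞ M]
    (hG : IsCompatibleMetric G) (hw : IsCompatibleForm w)
    (he : e ∈ IsManifold.maximalAtlas (𝓡 n) ∞ M) (he' : e' ∈ IsManifold.maximalAtlas (𝓡 n) ∞ M)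
    (hx : x ∈ e.source) (hx' : x ∈ e'.source) :
    codiffOne (G e) (w e) (e x) = codiffOne (G e') (w e') (e' x) := by
  set c : M → ℝ := fun x => codiffOne (G e) (w e) (e x) with hc
  set c' : M → ℝ := fun x => codiffOne (G e') (w e') (e' x) with hc'
  have hcc : ContinuousOn c e.source :=
    ((hG.smooth e he).contDiffOn_codiffOne (hw.smooth e he)).continuousOn.comp e.continuousOn
      fun x hx => e.map_source hx
  have hcc' : ContinuousOn c' e'.source :=
    ((hG.smooth e' he').contDiffOn_codiffOne (hw.smooth e' he')).continuousOn.comp e'.continuousOn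
      fun x hx => e'.map_source hx
  change c x = c' x
  -- The argument is weak, avoiding the transformation law of Christoffel symbols: integration by
  -- parts expresses the integral of `ρ d* w` through the pairing of `dρ` with `w`, which is
  -- tensorial. Two continuous candidates for `d* w` with the same integrals against bump functions
  -- agree.
  by_contra hne
  set U := e.source ∩ e'.source with hU
  have hUo : IsOpen U := e.open_source.inter e'.open_source
  have hdc : ContinuousOn (fun z => (c z - c' z) * (c x - c' x)) U :=
    ((hcc.mono Set.inter_subset_left).sub (hcc'.mono Set.inter_subset_right)).mul
      continuousOn_const
  have hd0 : 0 < (c x - c' x) * (c x - c' x) :=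
    mul_self_pos.2 (sub_ne_zero.2 hne)
  have hnhds : {z | z ∈ U ∧ 0 < (c z - c' z) * (c x - c' x)} ∈ 𝓝 x := by
    have h1 := (hdc.continuousAt (hUo.mem_nhds ⟨hx, hx'⟩)).eventually_const_lt hd0
    filter_upwards [hUo.mem_nhds ⟨hx, hx'⟩, h1] with z h2 h3 using ⟨h2, h3⟩
  -- The bump is supported where `c - c'` keeps the sign it has at `x`; the factor `c x - c' x`
  -- makes the integrand nonnegative in either case.
  obtain ⟨f, -, hf⟩ := (SmoothBumpFunction.nhds_basis_tsupport (I := 𝓡 n) x).mem_iff.1 hnhds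
  set ρ : M → ℝ := fun z => f z with hρdef
  have hρ : ContMDiff (𝓡 n) 𝓘(ℝ) ∞ ρ := f.contMDiff
  have hsU : tsupport ρ ⊆ U := fun z hz => (hf hz).1
  have hs : tsupport ρ ⊆ e.source := fun z hz => (hsU hz).1
  have hs' : tsupport ρ ⊆ e'.source := fun z hz => (hsU hz).2
  have hρ0 : ∀ z ∉ tsupport ρ, ρ z = 0 := fun z hz => image_eq_zero_of_notMem_tsupport hz
  have hKc : IsCompact (tsupport ρ) := (isClosed_tsupport ρ).isCompact
  have parts : ∀ {e₀ : OpenPartialHomeomorph M (EuclideanSpace ℝ (Fin n))},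
      e₀ ∈ IsManifold.maximalAtlas (𝓡 n) ∞ M → tsupport ρ ⊆ e₀.source →
      chartIntegral G e₀ (fun x => ρ x * codiffOne (G e₀) (w e₀) (e₀ x))
        = chartIntegral G e₀ (gradPairing G w e₀ ρ) := by
    intro e₀ he₀ hs₀
    refine hG.chartIntegral_mul_divergence he₀ hρ hs₀
      (V := fun y => (G e₀ y)⁻¹.mulVec (w e₀ y))
      (fun k => (hG.smooth e₀ he₀).contDiffOn_sharp (hw.smooth e₀ he₀) k) fun y hy => ?_
    exact (hG.smooth e₀ he₀).sum_partialDeriv_sharp hy fun j =>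
      differentiableAt_of_contDiffOn e₀.open_target (hw.smooth e₀ he₀ j) hy
  have g0 : ∀ {e₀ : OpenPartialHomeomorph M (EuclideanSpace ℝ (Fin n))} {z : M},
      z ∈ e₀.source → z ∉ tsupport ρ → gradPairing G w e₀ ρ z = 0 := by
    intro e₀ z hz hzρ
    rw [gradPairing, chartGrad_eq_zero hz hzρ, zero_dotProduct]
  have e1 : chartIntegral G e (gradPairing G w e ρ) = chartIntegral G e' (gradPairing G w e' ρ) :=
    hG.chartIntegral_eq he he' (fun z hz hz' => gradPairing_congr hG hw he he' hρ hz hz')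
      (fun z hz hz' => g0 hz fun h => hz' (hs' h)) (fun z hz hz' => g0 hz fun h => hz' (hs h))
  have e2 : chartIntegral G e (fun x => ρ x * c' x) = chartIntegral G e' (fun x => ρ x * c' x) :=
    hG.chartIntegral_eq he he' (fun _ _ _ => rfl)
      (fun z _ hz' => by rw [hρ0 z fun h => hz' (hs' h), zero_mul])
      (fun z _ hz' => by rw [hρ0 z fun h => hz' (hs h), zero_mul])
  have e3 : chartIntegral G e (fun x => ρ x * c x) = chartIntegral G e (fun x => ρ x * c' x) :=
    (parts he hs).trans (e1.trans ((parts he' hs').symm.trans e2.symm))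
  have hρc : ContinuousOn (fun y => ρ (e.symm y)) e.target :=
    (contDiffOn_comp_symm he hρ).continuousOn
  have cont1 : ContinuousOn (fun y => ρ (e.symm y) * c (e.symm y)) e.target :=
    hρc.mul (hcc.comp e.continuousOn_symm fun y hy => e.map_target hy)
  -- `c'` is known to be continuous only on the source of `e'`; elsewhere the product is locally
  -- zero because `ρ` is supported inside that source.
  have cont2 : ContinuousOn (fun y => ρ (e.symm y) * c' (e.symm y)) e.target := by
    intro y hy
    refine ContinuousAt.continuousWithinAt ?_
    by_cases hyU : e.symm y ∈ e'.source
    · exact (hρc.continuousAt (e.open_target.mem_nhds hy)).mul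
        ((hcc'.continuousAt (e'.open_source.mem_nhds hyU)).comp
          (e.continuousAt_symm hy))
    · have hn : e.symm y ∈ (tsupport ρ)ᶜ := fun h => hyU (hs' h)
      have hev : ∀ᶠ z in 𝓝 y, e.symm z ∈ (tsupport ρ)ᶜ :=
        (e.continuousAt_symm hy).eventually
          ((isClosed_tsupport ρ).isOpen_compl.mem_nhds hn)
      refine (continuousAt_const (y := (0 : ℝ))).congr ?_
      filter_upwards [hev] with z hz
      rw [hρ0 _ hz, zero_mul]
  have z1 : ∀ z ∈ e.source, z ∉ tsupport ρ → ρ z * c z = 0 := fun z _ hz => by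
    rw [hρ0 z hz, zero_mul]
  have z2 : ∀ z ∈ e.source, z ∉ tsupport ρ → ρ z * c' z = 0 := fun z _ hz => by
    rw [hρ0 z hz, zero_mul]
  have e4 := chartIntegral_sub hG he hKc hs cont1 z1 cont2 z2
  rw [e3, sub_self] at e4
  have e5 : chartIntegral G e (fun z => (ρ z * c z - ρ z * c' z) * (c x - c' x)) = 0 := by
    have : chartIntegral G e (fun z => (ρ z * c z - ρ z * c' z) * (c x - c' x))
        = chartIntegral G e (fun z => ρ z * c z - ρ z * c' z) * (c x - c' x) := by
      rw [chartIntegral, chartIntegral, ← integral_mul_const]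
      refine integral_congr_ae (Filter.Eventually.of_forall fun y => ?_)
      simp only
      ring
    rw [this, e4, zero_mul]
  have e6 := hG.eq_zero_of_chartIntegral_eq_zero he hKc hs
    ((cont1.sub cont2).mul continuousOn_const)
    (fun z hz hz' => by rw [z1 z hz hz', z2 z hz hz']; ring) (fun z hz => by
      by_cases hzρ : z ∈ tsupport ρ
      · have h1 := (hf hzρ).2
        have h2 : 0 ≤ ρ z := f.nonneg
        have h3 : (ρ z * c z - ρ z * c' z) * (c x - c' x)
            = ρ z * ((c z - c' z) * (c x - c' x)) := by ring
        rw [h3]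
        exact mul_nonneg h2 h1.le
      · rw [hρ0 z hzρ]; simp) e5 x hx
  have hρx : ρ x = 1 := f.eq_one
  rw [hρx, one_mul, one_mul] at e6
  exact hd0.ne' e6

theorem fluxPairing_congr [CompactSpace M] [T2Space M] [IsManifold (𝓡 n) ∞ M]
    (hG : IsCompatibleMetric G) (hw : IsCompatibleForm w)
    (he : e ∈ IsManifold.maximalAtlas (𝓡 n) ∞ M) (he' : e' ∈ IsManifold.maximalAtlas (𝓡 n) ∞ M)
    (hρ : ContMDiff (𝓡 n) 𝓘(ℝ) ∞ ρ) (hx : x ∈ e.source) (hx' : x ∈ e'.source) :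
    fluxPairing G w e ρ x = fluxPairing G w e' ρ x := by
  rw [fluxPairing_eq, fluxPairing_eq, codiffOne_congr hG hw he he' hx hx',
    gradPairing_congr hG hw he he' hρ hx hx', chartGrad_congr he he' hρ hx hx',
    hw.congr' he he' hx hx']
  congr 1
  exact pairing_of_congr (raised_of_congr (hG.congr' he he' hx hx') (hG.det_ne_zero he hx)
    (hw.extDerivOne_congr he he' hx hx')) _ _

theorem continuousOn_fluxPairing (hG : IsCompatibleMetric G) (hw : IsCompatibleForm w)
    (he : e ∈ IsManifold.maximalAtlas (𝓡 n) ∞ M) (hρ : ContMDiff (𝓡 n) 𝓘(ℝ) ∞ ρ) :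
    ContinuousOn (fun y => fluxPairing G w e ρ (e.symm y)) e.target := by
  have h : ContinuousOn (fun y => ∑ k, chartGrad e ρ y k * hodgeFlux (G e) (w e) y k) e.target :=
    continuousOn_finsetSum _ fun k _ => (contDiffOn_chartGrad he hρ k).continuousOn.mul
      ((hG.smooth e he).contDiffOn_hodgeFlux (hw.smooth e he) k).continuousOn
  refine h.congr fun y hy => ?_
  rw [fluxPairing, e.right_inv hy]
  rfl

/-- On a closed manifold a harmonic one-form is closed. -/
theorem extDerivOne_eq_zero_of_harmonic [CompactSpace M] [T2Space M] [IsManifold (𝓡 n) ∞ M]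
    (hG : IsCompatibleMetric G) (hw : IsCompatibleForm w)
    (hharm : ∀ e ∈ IsManifold.maximalAtlas (𝓡 n) ∞ M, ∀ y ∈ e.target, ∀ j,
      hodgeLaplacianOne (G e) (w e) y j = 0)
    (he : e ∈ IsManifold.maximalAtlas (𝓡 n) ∞ M) {y : EuclideanSpace ℝ (Fin n)}
    (hy : y ∈ e.target) (i j : Fin n) : extDerivOne (w e) y i j = 0 := by
  -- By compactness finitely many charts suffice, so the sums over the partition of unity are
  -- finite.
  obtain ⟨t, ht⟩ : ∃ t : Finset M, ∀ x : M, ∃ a ∈ t,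
      x ∈ (chartAt (EuclideanSpace ℝ (Fin n)) a).source := by
    obtain ⟨t, -, ht⟩ := isCompact_univ.elim_nhds_subcover
      (fun a : M => (chartAt (EuclideanSpace ℝ (Fin n)) a).source)
      (fun a _ => chart_source_mem_nhds _ a)
    refine ⟨t, fun x => ?_⟩
    have := ht (Set.mem_univ x)
    simpa using this
  set ch : t → OpenPartialHomeomorph M (EuclideanSpace ℝ (Fin n)) :=
    fun a => chartAt (EuclideanSpace ℝ (Fin n)) a.1 with hch
  have hcm : ∀ a, ch a ∈ IsManifold.maximalAtlas (𝓡 n) ∞ M := fun a =>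
    IsManifold.chart_mem_maximalAtlas a.1
  obtain ⟨f, hf⟩ := SmoothPartitionOfUnity.exists_isSubordinate (𝓡 n) (isClosed_univ (X := M))
    (fun a => (ch a).source) (fun a => (ch a).open_source) (fun x _ => by
      obtain ⟨a, ha, hx⟩ := ht x
      exact Set.mem_iUnion.2 ⟨⟨a, ha⟩, hx⟩)
  have hfs : ∀ a, ContMDiff (𝓡 n) 𝓘(ℝ) ∞ (f a) := fun a => (f a).contMDiff
  have hsum : ∀ x, ∑ a, f a x = 1 := fun x => by
    rw [← finsum_eq_sum_of_fintype]; exact f.sum_eq_one (Set.mem_univ x)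
  have hf0 : ∀ a, ∀ z ∉ tsupport (f a), f a z = 0 := fun a z hz =>
    image_eq_zero_of_notMem_tsupport hz
  have hKc : ∀ a, IsCompact (tsupport (f a)) := fun a => (isClosed_tsupport _).isCompact
  have hcf : ∀ a b, ContinuousOn (fun y => f a ((ch b).symm y)) (ch b).target := fun a b =>
    (contDiffOn_comp_symm (hcm b) (hfs a)).continuousOn
  have hcF : ∀ a b, ContinuousOn (fun y => fluxPairing G w (ch b) (f a) ((ch b).symm y))
      (ch b).target := fun a b => continuousOn_fluxPairing hG hw (hcm b) (hfs a)
  -- the energy identity in each chart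
  have h1 : ∀ a, chartIntegral G (ch a)
      (fun x => f a x * hodgeEnergy (G (ch a)) (w (ch a)) (ch a x))
      = chartIntegral G (ch a) (fluxPairing G w (ch a) (f a)) := fun a =>
    hG.chartIntegral_mul_divergence (hcm a) (hfs a) (hf a)
      (fun k => (hG.smooth _ (hcm a)).contDiffOn_hodgeFlux (hw.smooth _ (hcm a)) k)
      fun y hy => (hG.smooth _ (hcm a)).sum_partialDeriv_hodgeFlux (hw.smooth _ (hcm a)) hy
        (hharm _ (hcm a) y hy)
  -- Insert `1 = ∑ f b` and move each summand to chart `b`. The flux pairing is chart independent,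
  -- and each summand is supported in both charts.
  have h2 : ∀ a, chartIntegral G (ch a) (fluxPairing G w (ch a) (f a))
      = ∑ b, chartIntegral G (ch b) (fun x => f b x * fluxPairing G w (ch b) (f a) x) := by
    intro a
    have e1 : fluxPairing G w (ch a) (f a)
        = fun x => ∑ b, f b x * fluxPairing G w (ch a) (f a) x := by
      funext x
      rw [← Finset.sum_mul, hsum, one_mul]
    rw [e1, chartIntegral_sum hG (hcm a) (hKc a) (hf a) (fun b _ => (hcf b a).mul (hcF a a))
      (fun b _ x hx hxK => by rw [fluxPairing_eq_zero hx hxK, mul_zero])]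
    refine Finset.sum_congr rfl fun b _ => ?_
    refine hG.chartIntegral_eq (hcm a) (hcm b) (fun x hx hx' => ?_) (fun x hx hx' => ?_)
      (fun x hx hx' => ?_)
    · rw [fluxPairing_congr hG hw (hcm a) (hcm b) (hfs a) hx hx']
    · rw [hf0 b x fun h => hx' (hf b h), zero_mul]
    · rw [fluxPairing_eq_zero hx fun h => hx' (hf a h), mul_zero]
  -- In the fixed chart `b` the sum over `a` falls on the differentials of the `f a`, and these add
  -- up to the differential of the constant `1`.
  have h3 : ∀ b, ∑ a, chartIntegral G (ch b) (fun x => f b x * fluxPairing G w (ch b) (f a) x)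
      = 0 := by
    intro b
    rw [← chartIntegral_sum hG (hcm b) (hKc b) (hf b) (fun a _ => (hcf b b).mul (hcF a b))
      (fun a _ x hx hxK => by rw [hf0 b x hxK, zero_mul]), chartIntegral]
    refine setIntegral_eq_zero_of_forall_eq_zero fun y hy => ?_
    have e2 : ∑ a, chartGrad (ch b) (f a) y = 0 := by
      funext k
      rw [Finset.sum_apply]
      simp only [chartGrad]
      rw [← partialDeriv_sum fun a _ => differentiableAt_of_contDiffOn (ch b).open_target
        (contDiffOn_comp_symm (hcm b) (hfs a)) hy]
      simp only [hsum]
      simp [partialDeriv]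
    rw [← Finset.mul_sum]
    simp only [fluxPairing, (ch b).right_inv hy]
    rw [← sum_dotProduct, e2, zero_dotProduct]
    ring
  have h4 : ∑ a, chartIntegral G (ch a)
      (fun x => f a x * hodgeEnergy (G (ch a)) (w (ch a)) (ch a x)) = 0 := by
    simp only [h1, h2]
    rw [Finset.sum_comm]
    exact Finset.sum_eq_zero fun b _ => h3 b
  have hpos : ∀ a, ∀ x ∈ (ch a).source,
      0 ≤ f a x * hodgeEnergy (G (ch a)) (w (ch a)) (ch a x) := fun a x hx =>
    mul_nonneg (f.nonneg a x) ((hG.smooth _ (hcm a)).hodgeEnergy_nonneg ((ch a).map_source hx))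
  have h5 : ∀ a, chartIntegral G (ch a)
      (fun x => f a x * hodgeEnergy (G (ch a)) (w (ch a)) (ch a x)) = 0 := by
    intro a
    refine (Finset.sum_eq_zero_iff_of_nonneg fun a _ => ?_).1 h4 a (Finset.mem_univ a)
    refine setIntegral_nonneg (ch a).open_target.measurableSet fun y hy => ?_
    exact mul_nonneg (hpos a _ ((ch a).map_target hy)) (Real.sqrt_nonneg _)
  have h6 : ∀ a, ∀ x ∈ (ch a).source,
      f a x * hodgeEnergy (G (ch a)) (w (ch a)) (ch a x) = 0 := by
    intro a
    refine hG.eq_zero_of_chartIntegral_eq_zero (hcm a) (hKc a) (hf a) ?_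
      (fun x _ hxK => by rw [hf0 a x hxK, zero_mul]) (hpos a) (h5 a)
    refine (hcf a a).mul ?_
    refine ((hG.smooth _ (hcm a)).contDiffOn_hodgeEnergy (hw.smooth _ (hcm a))).continuousOn.congr
      fun y hy => ?_
    rw [(ch a).right_inv hy]
  set x := e.symm y with hxdef
  have hx : x ∈ e.source := e.map_target hy
  -- At a point where `f a` is nonzero the energy in chart `a` vanishes. The resulting `dw = 0` is
  -- then transported to the given chart.
  obtain ⟨a, ha⟩ : ∃ a, f a x ≠ 0 := by
    by_contra! hcon
    have := hsum x
    simp [hcon] at this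
  have hxa : x ∈ (ch a).source := hf a (subset_tsupport _ ha)
  have h7 := (mul_eq_zero.1 (h6 a x hxa)).resolve_left ha
  have h8 := (hG.smooth _ (hcm a)).extDerivOne_eq_zero_of_hodgeEnergy ((ch a).map_source hxa) h7
  have h9 := hw.extDerivOne_congr he (hcm a) hx hxa
  have h10 : (Matrix.of fun i j => extDerivOne (w (ch a)) (ch a x) i j) = 0 := by
    ext i j; exact h8 i j
  rw [h10, mul_zero, zero_mul, hxdef, e.right_inv hy] at h9
  exact congrFun (congrFun h9 i) j

end ChartGeometry

/-! ### The Fubini–Study metric in different affine charts -/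

namespace ComplexProjectiveSpace

variable {m : ℕ}

/-- The Fubini–Study metric in homogeneous coordinates. -/
def homogeneousFubiniStudy (Z V W : EuclideanSpace ℂ (Fin (m + 1))) : ℝ :=
  (inner ℂ Z Z * inner ℂ V W - inner ℂ V Z * inner ℂ Z W).re / (‖Z‖ ^ 2) ^ 2

/-- These are the two ambiguities of homogeneous coordinates: rescaling the representative `Z`, and
changing a lifted tangent vector by a multiple of `Z`. -/
theorem homogeneousFubiniStudy_smul_add {c : ℂ} (hc : c ≠ 0) (a b : ℂ)
    (Z V W : EuclideanSpace ℂ (Fin (m + 1))) :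
    homogeneousFubiniStudy (c • Z) (c • V + a • Z) (c • W + b • Z)
      = homogeneousFubiniStudy Z V W := by
  rw [homogeneousFubiniStudy, homogeneousFubiniStudy]
  have h1 : inner ℂ (c • Z) (c • Z) * inner ℂ (c • V + a • Z) (c • W + b • Z)
      - inner ℂ (c • V + a • Z) (c • Z) * inner ℂ (c • Z) (c • W + b • Z)
      = (((‖c‖ ^ 2) ^ 2 : ℝ) : ℂ) * (inner ℂ Z Z * inner ℂ V W - inner ℂ V Z * inner ℂ Z W) := by
    have hcc : (((‖c‖ ^ 2) ^ 2 : ℝ) : ℂ) = (starRingEnd ℂ c * c) ^ 2 := by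
      rw [mul_comm, Complex.mul_conj, Complex.normSq_eq_norm_sq]; push_cast; ring
    rw [hcc]
    simp only [inner_smul_left, inner_smul_right, inner_add_left, inner_add_right]
    ring
  rw [h1, Complex.re_ofReal_mul, norm_smul, mul_pow, mul_pow]
  have : ‖c‖ ≠ 0 := norm_ne_zero_iff.2 hc
  rw [mul_div_mul_left _ _ (by positivity)]

/-- The linear part of `affineLift`. -/
def affineLiftLinear (j : Fin (m + 1)) (v : EuclideanSpace ℂ (Fin m)) :
    EuclideanSpace ℂ (Fin (m + 1)) :=
  WithLp.toLp 2 (j.insertNth (α := fun _ => ℂ) 0 v.ofLp)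

theorem inner_affineLift (j : Fin (m + 1)) (z w : EuclideanSpace ℂ (Fin m)) :
    inner ℂ (affineLift j z) (affineLift j w) = 1 + inner ℂ z w := by
  simp only [PiLp.inner_apply, Fin.sum_univ_succAbove _ j, affineLift_self, affineLift_succAbove]
  simp

theorem inner_affineLiftLinear_right (j : Fin (m + 1)) (z w : EuclideanSpace ℂ (Fin m)) :
    inner ℂ (affineLift j z) (affineLiftLinear j w) = inner ℂ z w := by
  simp [PiLp.inner_apply, Fin.sum_univ_succAbove _ j, affineLift_succAbove, affineLiftLinear]

theorem inner_affineLiftLinear_left (j : Fin (m + 1)) (z w : EuclideanSpace ℂ (Fin m)) :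
    inner ℂ (affineLiftLinear j w) (affineLift j z) = inner ℂ w z := by
  rw [← inner_conj_symm, inner_affineLiftLinear_right, inner_conj_symm]

theorem inner_affineLiftLinear (j : Fin (m + 1)) (v w : EuclideanSpace ℂ (Fin m)) :
    inner ℂ (affineLiftLinear j v) (affineLiftLinear j w) = inner ℂ v w := by
  simp [PiLp.inner_apply, Fin.sum_univ_succAbove _ j, affineLiftLinear]

theorem affineFubiniStudy_eq (j : Fin (m + 1)) (z v w : EuclideanSpace ℂ (Fin m)) :
    affineFubiniStudy z v w
      = homogeneousFubiniStudy (affineLift j z) (affineLiftLinear j v) (affineLiftLinear j w) := by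
  have h1 : inner ℂ (affineLift j z) (affineLift j z) = ((1 + ‖z‖ ^ 2 : ℝ) : ℂ) := by
    rw [inner_affineLift, inner_self_eq_norm_sq_to_K]; simp
  have h2 : ‖affineLift j z‖ ^ 2 = 1 + ‖z‖ ^ 2 := by
    rw [← inner_self_eq_norm_sq (𝕜 := ℂ), h1]
    exact Complex.ofReal_re _
  rw [affineFubiniStudy, homogeneousFubiniStudy, h1, h2, inner_affineLiftLinear,
    inner_affineLiftLinear_left, inner_affineLiftLinear_right]

theorem fderiv_affineLift (j : Fin (m + 1)) (z v : EuclideanSpace ℂ (Fin m)) :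
    fderiv ℝ (affineLift j) z v = affineLiftLinear j v := by
  have hd : DifferentiableAt ℝ (affineLift j) z :=
    ((contDiff_affineLift j).differentiable (by simp)).restrictScalars ℝ z
  ext k
  have h1 := (PiLp.proj (𝕜 := ℝ) 2 (fun _ : Fin (m + 1) => ℂ) k).hasFDerivAt.comp z hd.hasFDerivAt
  have h2 : fderiv ℝ (affineLift j) z v k = fderiv ℝ (fun z => affineLift j z k) z v := by
    have h3 : HasFDerivAt (fun z => affineLift j z k) _ z := h1
    rw [h3.fderiv]; rfl
  rw [h2]
  rcases Fin.eq_self_or_eq_succAbove j k with rfl | ⟨i, rfl⟩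
  · simp [affineLift_self, affineLiftLinear]
  · simp only [affineLift_succAbove]
    have h4 : HasFDerivAt (fun z : EuclideanSpace ℂ (Fin m) => z i)
        (PiLp.proj (𝕜 := ℝ) 2 (fun _ : Fin m => ℂ) i) z :=
      (PiLp.proj (𝕜 := ℝ) 2 (fun _ : Fin m => ℂ) i).hasFDerivAt
    rw [h4.fderiv]
    simp [affineLiftLinear]

/-- The coordinate change between the affine charts `j` and `k`. -/
def affineTransition (j k : Fin (m + 1)) (z : EuclideanSpace ℂ (Fin m)) :
    EuclideanSpace ℂ (Fin m) :=
  affineCoord k (affineLift j z)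

theorem isOpen_affineLift_ne_zero (j k : Fin (m + 1)) :
    IsOpen {z : EuclideanSpace ℂ (Fin m) | affineLift j z k ≠ 0} := by
  have h : Continuous fun z => affineLift j z k :=
    (PiLp.continuous_apply 2 (fun _ : Fin (m + 1) => ℂ) k).comp (contDiff_affineLift j).continuous
  exact isOpen_ne_fun h continuous_const

theorem differentiableAt_affineTransition {j k : Fin (m + 1)} {z : EuclideanSpace ℂ (Fin m)}
    (hz : affineLift j z k ≠ 0) : DifferentiableAt ℂ (affineTransition j k) z := by
  have hs : ContDiffOn ℂ ∞ (affineTransition j k) {z | affineLift j z k ≠ 0} :=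
    (contDiffOn_affineCoord k).comp (contDiff_affineLift j).contDiffOn (fun z hz => hz)
  exact (hs.contDiffAt ((isOpen_affineLift_ne_zero j k).mem_nhds hz)).differentiableAt (by simp)

theorem affineLift_affineTransition {j k : Fin (m + 1)} {z : EuclideanSpace ℂ (Fin m)}
    (hz : affineLift j z k ≠ 0) :
    affineLift k (affineTransition j k z) = (affineLift j z k)⁻¹ • affineLift j z := by
  ext l
  rcases Fin.eq_self_or_eq_succAbove k l with rfl | ⟨i, rfl⟩
  · simp [affineLift_self, hz]
  · rw [affineLift_succAbove]
    simp [affineTransition, affineCoord, div_eq_inv_mul]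

theorem fderiv_affineTransition_I_smul {j k : Fin (m + 1)} {z : EuclideanSpace ℂ (Fin m)}
    (hz : affineLift j z k ≠ 0) (v : EuclideanSpace ℂ (Fin m)) :
    fderiv ℝ (affineTransition j k) z (Complex.I • v)
      = Complex.I • fderiv ℝ (affineTransition j k) z v := by
  rw [(differentiableAt_affineTransition hz).fderiv_restrictScalars ℝ]
  simp

/-- The affine charts define the same metric. -/
theorem affineFubiniStudy_affineTransition {j k : Fin (m + 1)} {z : EuclideanSpace ℂ (Fin m)}
    (hz : affineLift j z k ≠ 0) (v w : EuclideanSpace ℂ (Fin m)) :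
    affineFubiniStudy (affineTransition j k z) (fderiv ℝ (affineTransition j k) z v)
      (fderiv ℝ (affineTransition j k) z w) = affineFubiniStudy z v w := by
  have hd : DifferentiableAt ℝ (affineTransition j k) z :=
    (differentiableAt_affineTransition hz).restrictScalars ℝ
  have hl : ∀ i z, DifferentiableAt ℝ (affineLift (m := m) i) z := fun i z =>
    ((contDiff_affineLift i).differentiable (by simp)).restrictScalars ℝ z
  have hc : DifferentiableAt ℝ (fun z => (affineLift j z k)⁻¹) z := by
    have h1 : DifferentiableAt ℝ (fun z => affineLift j z k) z :=
      ((PiLp.proj (𝕜 := ℝ) 2 (fun _ : Fin (m + 1) => ℂ) k).differentiableAt.comp z (hl j z) :)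
    exact h1.inv hz
  -- The lifts of a point by two affine charts differ by a scalar function. Differentiating it
  -- yields the rescaling and the shift allowed by `homogeneousFubiniStudy_smul_add`.
  have key : ∀ u, affineLiftLinear k (fderiv ℝ (affineTransition j k) z u)
      = (affineLift j z k)⁻¹ • affineLiftLinear j u
        + (fderiv ℝ (fun z => (affineLift j z k)⁻¹) z u) • affineLift j z := by
    intro u
    have h1 : (fun z => affineLift k (affineTransition j k z))
        =ᶠ[𝓝 z] fun z => (affineLift j z k)⁻¹ • affineLift j z := by
      filter_upwards [(isOpen_affineLift_ne_zero j k).mem_nhds hz] with x hx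
      exact affineLift_affineTransition hx
    have h2 : HasFDerivAt (fun z => affineLift k (affineTransition j k z)) _ z :=
      (hl k _).hasFDerivAt.comp z hd.hasFDerivAt
    have h3 := hc.hasFDerivAt.smul (hl j z).hasFDerivAt
    have h4 := congrArg (fun L => L u) ((h2.congr_of_eventuallyEq h1.symm).unique h3)
    simp only [ContinuousLinearMap.comp_apply, fderiv_affineLift] at h4
    rw [h4]
    simp [fderiv_affineLift]
  rw [affineFubiniStudy_eq k, affineFubiniStudy_eq j, key, key, affineLift_affineTransition hz]
  exact homogeneousFubiniStudy_smul_add (inv_ne_zero hz) _ _ _ _ _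

end ComplexProjectiveSpace

/-! ### Tangent vectors in charts -/

namespace ChartGeometry

section Tangent

variable {E : Type*} [NormedAddCommGroup E] [NormedSpace ℝ E]
  {M : Type*} [TopologicalSpace M] [ChartedSpace E M]
  {V : Type*} [NormedAddCommGroup V] [NormedSpace ℝ V]
  {P : Type*} [TopologicalSpace P] [ChartedSpace V P]
  {e e' : OpenPartialHomeomorph M E} {y : E}

theorem mdifferentiableAt_symm [IsManifold 𝓘(ℝ, E) ∞ M]
    (he : e ∈ IsManifold.maximalAtlas 𝓘(ℝ, E) ∞ M)
    (hy : y ∈ e.target) : MDifferentiableAt 𝓘(ℝ, E) 𝓘(ℝ, E) e.symm y :=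
  ((contMDiffOn_symm_of_mem_maximalAtlas he).contMDiffAt
    (e.open_target.mem_nhds hy)).mdifferentiableAt (by simp)

theorem mfderiv_eq_fderiv {f : E → P} (hf : MDifferentiableAt 𝓘(ℝ, E) 𝓘(ℝ, V) f y) (v : E) :
    (mfderiv 𝓘(ℝ, E) 𝓘(ℝ, V) f y v : V) = fderiv ℝ (fun z => chartAt V (f y) (f z)) y v := by
  rw [hf.mfderiv]
  simp [writtenInExtChartAt, Function.comp_def]
  rfl

/-- `coordVec e y` as a linear map, the tangent space of `M` being identified with `E` by the
preferred chart. -/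
def coordMap (e : OpenPartialHomeomorph M E) (y : E) : E →L[ℝ] E :=
  fderiv ℝ (fun z => chartAt E (e.symm y) (e.symm z)) y

theorem coordVec_eq [IsManifold 𝓘(ℝ, E) ∞ M] (he : e ∈ IsManifold.maximalAtlas 𝓘(ℝ, E) ∞ M)
    (hy : y ∈ e.target) (v : E) : (coordVec e y v : E) = coordMap e y v :=
  mfderiv_eq_fderiv (mdifferentiableAt_symm he hy) v

theorem mfderiv_coordVec [IsManifold 𝓘(ℝ, E) ∞ M] {F : M → P}
    (hF : ContMDiff 𝓘(ℝ, E) 𝓘(ℝ, V) ∞ F) (he : e ∈ IsManifold.maximalAtlas 𝓘(ℝ, E) ∞ M)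
    (hy : y ∈ e.target) (v : E) :
    (mfderiv 𝓘(ℝ, E) 𝓘(ℝ, V) F (e.symm y) (coordVec e y v) : V)
      = fderiv ℝ (fun z => chartAt V (F (e.symm y)) (F (e.symm z))) y v := by
  have h1 := mdifferentiableAt_symm he hy
  have h2 : MDifferentiableAt 𝓘(ℝ, E) 𝓘(ℝ, V) F (e.symm y) := hF.mdifferentiableAt (by simp)
  have h3 := mfderiv_comp y h2 h1
  have h4 := mfderiv_eq_fderiv (h2.comp y h1) v
  rw [h3] at h4
  exact h4

theorem differentiableAt_transition [IsManifold 𝓘(ℝ, E) ∞ M]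
    (he : e ∈ IsManifold.maximalAtlas 𝓘(ℝ, E) ∞ M)
    (he' : e' ∈ IsManifold.maximalAtlas 𝓘(ℝ, E) ∞ M) (hy : y ∈ e.target)
    (hy' : e.symm y ∈ e'.source) : DifferentiableAt ℝ (fun z => e' (e.symm z)) y := by
  have h1 := (contMDiffOn_symm_of_mem_maximalAtlas he).contMDiffAt (e.open_target.mem_nhds hy)
  have h2 := (contMDiffOn_of_mem_maximalAtlas he').contMDiffAt (e'.open_source.mem_nhds hy')
  have h3 : ContMDiffAt 𝓘(ℝ, E) 𝓘(ℝ, E) ∞ (fun z => e' (e.symm z)) y := h2.comp y h1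
  exact h3.contDiffAt.differentiableAt (by simp)

/-- Coordinate vectors transform by the differential of the coordinate change. -/
theorem coordMap_transition [IsManifold 𝓘(ℝ, E) ∞ M]
    (he : e ∈ IsManifold.maximalAtlas 𝓘(ℝ, E) ∞ M)
    (he' : e' ∈ IsManifold.maximalAtlas 𝓘(ℝ, E) ∞ M) (hy : y ∈ e.target)
    (hy' : e.symm y ∈ e'.source) :
    coordMap e y = (coordMap e' (e' (e.symm y))).comp (fderiv ℝ (fun z => e' (e.symm z)) y) := by
  have ht : e' (e.symm y) ∈ e'.target := e'.map_source hy'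
  rw [coordMap, coordMap, e'.left_inv hy']
  set c := chartAt E (e.symm y)
  have hc : c ∈ IsManifold.maximalAtlas 𝓘(ℝ, E) ∞ M := IsManifold.chart_mem_maximalAtlas _
  have hd1 := differentiableAt_transition he he' hy hy'
  have hd2 : DifferentiableAt ℝ (fun z => c (e'.symm z)) (e' (e.symm y)) :=
    differentiableAt_transition he' hc ht (by rw [e'.left_inv hy']; exact mem_chart_source _ _)
  have heq : (fun z => c (e.symm z)) =ᶠ[𝓝 y]
      (fun z => c (e'.symm z)) ∘ (fun z => e' (e.symm z)) := by
    have hs : ∀ᶠ z in 𝓝 y, e.symm z ∈ e'.source :=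
      (e.symm.continuousAt hy).eventually_mem (e'.open_source.mem_nhds hy')
    filter_upwards [hs] with z hz
    simp [e'.left_inv hz]
  rw [heq.fderiv_eq, fderiv_comp y hd2 hd1]

end Tangent

section Form

variable {n : ℕ} {M : Type*} [TopologicalSpace M] [ChartedSpace (EuclideanSpace ℝ (Fin n)) M]
  [IsManifold (𝓡 n) ∞ M]

theorem fderiv_basisVec_eq_sum (τ : EuclideanSpace ℝ (Fin n) → EuclideanSpace ℝ (Fin n))
    (y : EuclideanSpace ℝ (Fin n)) (i : Fin n) :
    fderiv ℝ τ y (basisVec i) = ∑ a, jacobian τ y a i • basisVec a :=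
  (sum_smul_basisVec _).symm

theorem IsSmoothOneForm.isCompatibleForm {α : ∀ x : M, TangentSpace (𝓡 n) x →L[ℝ] ℝ}
    (hα : IsSmoothOneForm α) : IsCompatibleForm (formComponents α) where
  smooth e he i := hα e he i
  congr e he e' he' y hy := by
    have hy2 : y ∈ e.target ∧ e.symm y ∈ e'.source := by simpa using hy
    -- All tangent spaces are the same model space by definition. Forgetting the dependent type
    -- allows rewriting the base point.
    let A : M → EuclideanSpace ℝ (Fin n) →L[ℝ] ℝ := α
    have hA : ∀ e ∈ IsManifold.maximalAtlas (𝓡 n) ∞ M, ∀ y ∈ e.target, ∀ i,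
        formComponents α e y i = A (e.symm y) (coordMap e y (basisVec i)) := by
      intro e he y hy i
      rw [← coordVec_eq he hy]
      rfl
    have hx : e'.symm (e' (e.symm y)) = e.symm y := e'.left_inv hy2.2
    funext i
    rw [hA e he y hy2.1, coordMap_transition he he' hy2.1 hy2.2, ContinuousLinearMap.comp_apply,
      fderiv_basisVec_eq_sum]
    simp only [map_sum, map_smul, Matrix.mulVec, dotProduct, Matrix.transpose_apply, smul_eq_mul,
      hA e' he' _ (e'.map_source hy2.2), hx]

end Form

end ChartGeometry

/-! ### Immersions in charts -/

namespace ChartGeometry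

section Immersion

variable {E : Type*} [NormedAddCommGroup E] [NormedSpace ℝ E]
  {M : Type*} [TopologicalSpace M] [ChartedSpace E M]
  {V : Type*} [NormedAddCommGroup V] [NormedSpace ℝ V]
  {P : Type*} [TopologicalSpace P] [ChartedSpace V P]
  {e : OpenPartialHomeomorph M E} {c : OpenPartialHomeomorph P V} {y : E} {F : M → P}

theorem contDiffAt_inCharts (hF : ContMDiff 𝓘(ℝ, E) 𝓘(ℝ, V) ∞ F)
    (he : e ∈ IsManifold.maximalAtlas 𝓘(ℝ, E) ∞ M) (hc : c ∈ IsManifold.maximalAtlas 𝓘(ℝ, V) ∞ P)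
    (hy : y ∈ e.target) (hy' : F (e.symm y) ∈ c.source) :
    ContDiffAt ℝ ∞ (fun z => c (F (e.symm z))) y := by
  have h1 := (contMDiffOn_symm_of_mem_maximalAtlas he).contMDiffAt (e.open_target.mem_nhds hy)
  have h2 := (contMDiffOn_of_mem_maximalAtlas hc).contMDiffAt (c.open_source.mem_nhds hy')
  have h3 : ContMDiffAt 𝓘(ℝ, E) 𝓘(ℝ, V) ∞ (fun z => c (F (e.symm z))) y :=
    h2.comp y (hF.contMDiffAt.comp y h1)
  exact h3.contDiffAt

/-- The differential of an immersion is injective. -/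
theorem injective_fderiv_of_isImmersionAt [IsManifold 𝓘(ℝ, E) ∞ M]
    [IsManifold 𝓘(ℝ, V) ∞ P] (hF : ContMDiff 𝓘(ℝ, E) 𝓘(ℝ, V) ∞ F)
    (h : Manifold.IsImmersionAt 𝓘(ℝ, E) 𝓘(ℝ, V) ∞ F (e.symm y))
    (he : e ∈ IsManifold.maximalAtlas 𝓘(ℝ, E) ∞ M) (hc : c ∈ IsManifold.maximalAtlas 𝓘(ℝ, V) ∞ P)
    (hy : y ∈ e.target) (hy' : F (e.symm y) ∈ c.source) :
    Function.Injective (fderiv ℝ (fun z => c (F (e.symm z))) y) := by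
  set d := h.domChart
  set d' := h.codChart
  have hd : d ∈ IsManifold.maximalAtlas 𝓘(ℝ, E) ∞ M := h.domChart_mem_maximalAtlas
  have hd' : d' ∈ IsManifold.maximalAtlas 𝓘(ℝ, V) ∞ P := h.codChart_mem_maximalAtlas
  have hxd : e.symm y ∈ d.source := h.mem_domChart_source
  have hxd' : F (e.symm y) ∈ d'.source := h.mem_codChart_source
  set q := c (F (e.symm y))
  have hq : c.symm q = F (e.symm y) := c.left_inv hy'
  -- In the slice charts of the immersion `F` reads `x ↦ (x, 0)`, so the first projection inverts
  -- it. Returning to the given charts produces a differentiable local left inverse of the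
  -- coordinate map.
  let π : V →L[ℝ] E := (ContinuousLinearMap.fst ℝ E h.complement).comp
    (h.equiv.symm : V →L[ℝ] E × h.complement)
  have hslice : ∀ x ∈ d.source, π (d' (F x)) = d x := by
    intro x hx
    have h0 : d x ∈ (d.extend 𝓘(ℝ, E)).target := by simpa using d.map_source hx
    have h1 := h.writtenInCharts h0
    have h2 : d' (F (d.symm (d x))) = h.equiv (d x, 0) := by simpa using h1
    rw [d.left_inv hx] at h2
    simp [π, h2]
  have D1 : DifferentiableAt ℝ (fun a => d' (c.symm a)) q :=
    differentiableAt_transition hc hd' (c.map_source hy') (by rw [hq]; exact hxd')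
  have hπ : π (d' (c.symm q)) = d (e.symm y) := by rw [hq, hslice _ hxd]
  have D2 : DifferentiableAt ℝ (fun a => e (d.symm a)) (π (d' (c.symm q))) := by
    rw [hπ]
    exact differentiableAt_transition hd he (d.map_source hxd)
      (by rw [d.left_inv hxd]; exact e.map_target hy)
  have D3 : DifferentiableAt ℝ (fun a => π (d' (c.symm a))) q := π.differentiableAt.comp q D1
  have D4 : DifferentiableAt ℝ (fun a => e (d.symm (π (d' (c.symm a))))) q :=
    DifferentiableAt.comp (g := fun a => e (d.symm a)) q D2 D3
  have hf := (contDiffAt_inCharts hF he hc hy hy').differentiableAt (by simp)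
  have hcont : ContinuousAt (fun z => F (e.symm z)) y :=
    ContinuousAt.comp hF.continuous.continuousAt (e.symm.continuousAt hy)
  have heq : (fun a => e (d.symm (π (d' (c.symm a))))) ∘ (fun z => c (F (e.symm z)))
      =ᶠ[𝓝 y] id := by
    filter_upwards [(e.symm.continuousAt hy).eventually_mem (d.open_source.mem_nhds hxd),
      hcont.eventually_mem (c.open_source.mem_nhds hy'), e.open_target.mem_nhds hy]
      with z h1 h2 h3
    simp [c.left_inv h2, hslice _ h1, d.left_inv h1, e.right_inv h3]
  have hcomp := heq.fderiv_eq (𝕜 := ℝ)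
  rw [fderiv_comp y D4 hf, fderiv_id] at hcomp
  exact Function.LeftInverse.injective fun v => congrArg (fun L => L v) hcomp

end Immersion

end ChartGeometry

/-! ### Maps into projective space read in a fixed affine chart. -/

namespace ComplexProjectiveSpace

variable {m : ℕ}

theorem affineChart_mem_maximalAtlas (k : Fin (m + 1)) :
    affineChart k ∈ IsManifold.maximalAtlas 𝓘(ℝ, EuclideanSpace ℂ (Fin m)) ∞
      (ComplexProjectiveSpace m) :=
  IsManifold.subset_maximalAtlas (Set.mem_range_self k)

theorem affineLift_affineCoord {j : Fin (m + 1)} {Z : EuclideanSpace ℂ (Fin (m + 1))}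
    (hZ : Z j ≠ 0) : affineLift j (affineCoord j Z) = (Z j)⁻¹ • Z := by
  ext l
  rcases Fin.eq_self_or_eq_succAbove j l with rfl | ⟨i, rfl⟩
  · simp [affineLift_self, hZ]
  · rw [affineLift_succAbove]
    simp [affineCoord, div_eq_inv_mul]

theorem affineLift_affineChart_ne_zero {j k : Fin (m + 1)} {p : ComplexProjectiveSpace m}
    (hj : p ∈ (affineChart j).source) (hk : p ∈ (affineChart k).source) :
    affineLift j (affineChart j p) k ≠ 0 := by
  change affineLift j (affineCoord j (Projectivization.rep p)) k ≠ 0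
  rw [affineLift_affineCoord hj]
  exact mul_ne_zero (inv_ne_zero hj) hk

theorem affineTransition_affineChart {j : Fin (m + 1)} (k : Fin (m + 1))
    {p : ComplexProjectiveSpace m} (hj : p ∈ (affineChart j).source) :
    affineTransition j k (affineChart j p) = affineChart k p := by
  change affineCoord k (affineLift j (affineCoord j (Projectivization.rep p))) = _
  rw [affineLift_affineCoord hj, affineCoord_smul k _ (inv_ne_zero hj)]
  rfl

variable {n : ℕ} {M : Type*} [TopologicalSpace M] [ChartedSpace (EuclideanSpace ℝ (Fin n)) M]
  [IsManifold (𝓡 n) ∞ M] {e : OpenPartialHomeomorph M (EuclideanSpace ℝ (Fin n))}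
  {F : M → ComplexProjectiveSpace m} {y : EuclideanSpace ℝ (Fin n)} {k : Fin (m + 1)}

open ChartGeometry

/-- The differential of the coordinate change from the preferred chart at `F x` to the affine chart
`k` preserves the metric and the complex structure. -/
theorem exists_isometry_affineChart
    (hF : ContMDiff (𝓡 n) 𝓘(ℝ, EuclideanSpace ℂ (Fin m)) ∞ F)
    (he : e ∈ IsManifold.maximalAtlas (𝓡 n) ∞ M) (hy : y ∈ e.target)
    (hk : F (e.symm y) ∈ (affineChart k).source) :
    ∃ D : EuclideanSpace ℂ (Fin m) →L[ℝ] EuclideanSpace ℂ (Fin m),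
      (∀ v, D (Complex.I • v) = Complex.I • D v) ∧
      (∀ v w, affineFubiniStudy (affineChart k (F (e.symm y))) (D v) (D w)
        = fubiniStudy (F (e.symm y)) v w) ∧
      ∀ v, D (mfderiv (𝓡 n) 𝓘(ℝ, EuclideanSpace ℂ (Fin m)) F (e.symm y) (coordVec e y v))
        = fderiv ℝ (fun z => affineChart k (F (e.symm z))) y v := by
  obtain ⟨j, hj⟩ : ∃ j, chartAt (EuclideanSpace ℂ (Fin m)) (F (e.symm y)) = affineChart j :=
    ⟨_, rfl⟩
  have hjs : F (e.symm y) ∈ (affineChart j).source := by rw [← hj]; exact mem_chart_source _ _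
  have hz := affineLift_affineChart_ne_zero hjs hk
  refine ⟨fderiv ℝ (affineTransition j k) (affineChart j (F (e.symm y))),
    fderiv_affineTransition_I_smul hz, fun v w => ?_, fun v => ?_⟩
  · change _ = affineFubiniStudy (chartAt (EuclideanSpace ℂ (Fin m)) (F (e.symm y)) (F (e.symm y)))
      v w
    rw [hj, ← affineFubiniStudy_affineTransition hz, affineTransition_affineChart k hjs]
  · have h1 := mfderiv_coordVec hF he hy v
    rw [hj] at h1
    have hcont : ContinuousAt (fun z => F (e.symm z)) y :=
      ContinuousAt.comp hF.continuous.continuousAt (e.symm.continuousAt hy)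
    have heq : (fun z => affineChart k (F (e.symm z))) =ᶠ[𝓝 y]
        affineTransition j k ∘ fun z => affineChart j (F (e.symm z)) := by
      filter_upwards [hcont.eventually_mem ((affineChart j).open_source.mem_nhds hjs)] with z hz
      exact (affineTransition_affineChart k hz).symm
    rw [heq.fderiv_eq, fderiv_comp y ((differentiableAt_affineTransition hz).restrictScalars ℝ)
      ((contDiffAt_inCharts hF he (affineChart_mem_maximalAtlas j) hy hjs).differentiableAt
        (by simp))]
    exact congrArg _ h1

/-- The definition of the metric uses the preferred chart at `F x`, which may jump with `x`. With a
fixed affine chart the smoothness becomes visible. -/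
theorem metricMatrix_inducedMetric (hF : ContMDiff (𝓡 n) 𝓘(ℝ, EuclideanSpace ℂ (Fin m)) ∞ F)
    (he : e ∈ IsManifold.maximalAtlas (𝓡 n) ∞ M) (hy : y ∈ e.target)
    (hk : F (e.symm y) ∈ (affineChart k).source) (i j : Fin n) :
    metricMatrix (inducedMetric fubiniStudy F) e y i j
      = affineFubiniStudy (affineChart k (F (e.symm y)))
        (fderiv ℝ (fun z => affineChart k (F (e.symm z))) y (basisVec i))
        (fderiv ℝ (fun z => affineChart k (F (e.symm z))) y (basisVec j)) := by
  obtain ⟨D, -, hD, hDF⟩ := exists_isometry_affineChart hF he hy hk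
  rw [← hDF, ← hDF]
  exact (hD _ _).symm

end ComplexProjectiveSpace

/-! ### The induced metric on a hypersurface -/

namespace ComplexProjectiveSpace

open ChartGeometry

variable {m : ℕ}

theorem contDiffAt_affineFubiniStudy {E : Type*} [NormedAddCommGroup E] [NormedSpace ℝ E]
    {k : WithTop ℕ∞} {p : E} {z v w : E → EuclideanSpace ℂ (Fin m)} (hz : ContDiffAt ℝ k z p)
    (hv : ContDiffAt ℝ k v p) (hw : ContDiffAt ℝ k w p) :
    ContDiffAt ℝ k (fun y => affineFubiniStudy (z y) (v y) (w y)) p := by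
  have hn : ContDiffAt ℝ k (fun y => 1 + ‖z y‖ ^ 2) p := contDiffAt_const.add (hz.norm_sq ℂ)
  have hnum : ContDiffAt ℝ k (fun y => ((1 + ‖z y‖ ^ 2 : ℝ) : ℂ) * inner ℂ (v y) (w y)
      - inner ℂ (v y) (z y) * inner ℂ (z y) (w y)) p :=
    ((Complex.ofRealCLM.contDiff.contDiffAt.comp p hn).mul (hv.inner ℂ hw)).sub
      ((hv.inner ℂ hz).mul (hz.inner ℂ hw))
  exact (Complex.reCLM.contDiff.contDiffAt.comp p hnum).div (hn.pow 2)
    (pow_ne_zero _ (by positivity))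

variable {n : ℕ}

/-- A pulled back bilinear form in coordinates. -/
theorem sum_affineFubiniStudy (z : EuclideanSpace ℂ (Fin m))
    (A : EuclideanSpace ℝ (Fin n) →L[ℝ] EuclideanSpace ℂ (Fin m)) (a b : Fin n → ℝ) :
    ∑ i, ∑ j, a i * b j * affineFubiniStudy z (A (basisVec i)) (A (basisVec j))
      = affineFubiniStudy z (A (WithLp.toLp 2 a)) (A (WithLp.toLp 2 b)) := by
  have ha : WithLp.toLp 2 a = ∑ i, a i • basisVec i := (sum_smul_basisVec (WithLp.toLp 2 a)).symm
  have hb : WithLp.toLp 2 b = ∑ i, b i • basisVec i := (sum_smul_basisVec (WithLp.toLp 2 b)).symm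
  rw [ha, hb, ← affineFubiniStudyForm_apply]
  simp only [map_sum, map_smul, LinearMap.sum_apply, LinearMap.smul_apply, smul_eq_mul,
    affineFubiniStudyForm_apply, Finset.mul_sum]
  rw [Finset.sum_comm]
  exact Finset.sum_congr rfl fun i _ => Finset.sum_congr rfl fun j _ => by ring

variable {M : Type*} [TopologicalSpace M] [ChartedSpace (EuclideanSpace ℝ (Fin n)) M]
  {e e' : OpenPartialHomeomorph M (EuclideanSpace ℝ (Fin n))}
  {F : M → ComplexProjectiveSpace m} {y : EuclideanSpace ℝ (Fin n)} {k : Fin (m + 1)}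

theorem eventually_mem_affineChart_source
    (hF : ContMDiff (𝓡 n) 𝓘(ℝ, EuclideanSpace ℂ (Fin m)) ∞ F) (hy : y ∈ e.target)
    (hk : F (e.symm y) ∈ (affineChart k).source) :
    ∀ᶠ z in 𝓝 y, z ∈ e.target ∧ F (e.symm z) ∈ (affineChart k).source := by
  have hcont : ContinuousAt (fun z => F (e.symm z)) y :=
    ContinuousAt.comp hF.continuous.continuousAt (e.symm.continuousAt hy)
  exact (e.open_target.eventually_mem hy).and
    (hcont.eventually_mem ((affineChart k).open_source.mem_nhds hk))

theorem posDef_metricMatrix [IsManifold (𝓡 n) ∞ M]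
    (hF : Manifold.IsSmoothEmbedding (𝓡 n) 𝓘(ℝ, EuclideanSpace ℂ (Fin m)) ∞ F)
    (he : e ∈ IsManifold.maximalAtlas (𝓡 n) ∞ M) (hy : y ∈ e.target) :
    (metricMatrix (inducedMetric fubiniStudy F) e y).PosDef := by
  obtain ⟨k, hk⟩ := exists_rep_ne_zero (F (e.symm y))
  have hk : F (e.symm y) ∈ (affineChart k).source := hk
  have hG := metricMatrix_inducedMetric hF.contMDiff he hy hk
  refine Matrix.PosDef.of_dotProduct_mulVec_pos ?_ fun a ha => ?_
  · ext i j
    rw [Matrix.conjTranspose_apply, hG, hG, affineFubiniStudy_comm]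
    rfl
  · have h1 : star a ⬝ᵥ (metricMatrix (inducedMetric fubiniStudy F) e y).mulVec a
        = affineFubiniStudy (affineChart k (F (e.symm y)))
          (fderiv ℝ (fun z => affineChart k (F (e.symm z))) y (WithLp.toLp 2 a))
          (fderiv ℝ (fun z => affineChart k (F (e.symm z))) y (WithLp.toLp 2 a)) := by
      rw [← sum_affineFubiniStudy]
      simp only [dotProduct, Matrix.mulVec, hG, Finset.mul_sum, Pi.star_apply, star_trivial]
      exact Finset.sum_congr rfl fun i _ => Finset.sum_congr rfl fun j _ => by ring
    rw [h1]
    refine affineFubiniStudy_self_pos _ fun h0 => ha ?_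
    have h2 := injective_fderiv_of_isImmersionAt hF.contMDiff (hF.isImmersion.isImmersionAt _) he
      (affineChart_mem_maximalAtlas k) hy hk (h0.trans (map_zero _).symm)
    simpa using h2

theorem isCompatibleMetric_inducedMetric [IsManifold (𝓡 n) ∞ M]
    (hF : Manifold.IsSmoothEmbedding (𝓡 n) 𝓘(ℝ, EuclideanSpace ℂ (Fin m)) ∞ F) :
    IsCompatibleMetric (metricMatrix (inducedMetric (n := n) fubiniStudy F)) where
  smooth e he :=
    { isOpen := e.open_target
      contDiffOn := fun i j y hy => by
        obtain ⟨k, hk⟩ := exists_rep_ne_zero (F (e.symm y))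
        have hk : F (e.symm y) ∈ (affineChart k).source := hk
        have hf := contDiffAt_inCharts hF.contMDiff he (affineChart_mem_maximalAtlas k) hy hk
        have hDf := hf.fderiv_right (m := ∞) (by simp)
        refine ContDiffAt.contDiffWithinAt ((contDiffAt_affineFubiniStudy hf
          (hDf.clm_apply (contDiffAt_const (c := basisVec i)))
          (hDf.clm_apply (contDiffAt_const (c := basisVec j)))).congr_of_eventuallyEq
            (f₁ := fun z => metricMatrix (inducedMetric fubiniStudy F) e z i j) ?_)
        filter_upwards [eventually_mem_affineChart_source hF.contMDiff hy hk] with z hz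
        exact metricMatrix_inducedMetric hF.contMDiff he hz.1 hz.2 i j
      posDef := fun y hy => posDef_metricMatrix hF he hy }
  congr e he e' he' y hy := by
    have hy2 : y ∈ e.target ∧ e.symm y ∈ e'.source := by simpa using hy
    have ht := e'.map_source hy2.2
    have hx := e'.left_inv hy2.2
    obtain ⟨k, hk⟩ := exists_rep_ne_zero (F (e.symm y))
    have hk : F (e.symm y) ∈ (affineChart k).source := hk
    have hk' : F (e'.symm (e' (e.symm y))) ∈ (affineChart k).source := by rwa [hx]
    have hd := differentiableAt_transition he he' hy2.1 hy2.2
    have hf := (contDiffAt_inCharts hF.contMDiff he' (affineChart_mem_maximalAtlas k) ht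
      hk').differentiableAt (by simp)
    have heq : (fun z => affineChart k (F (e.symm z))) =ᶠ[𝓝 y]
        (fun z => affineChart k (F (e'.symm z))) ∘ fun z => e' (e.symm z) := by
      filter_upwards [(e.symm.continuousAt hy2.1).eventually_mem
        (e'.open_source.mem_nhds hy2.2)] with z hz
      simp [e'.left_inv hz]
    ext i j
    rw [metricMatrix_inducedMetric hF.contMDiff he hy2.1 hk, heq.fderiv_eq,
      fderiv_comp y hf hd, ContinuousLinearMap.comp_apply, ContinuousLinearMap.comp_apply]
    have h1 := sum_affineFubiniStudy (affineChart k (F (e.symm y)))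
      (fderiv ℝ (fun z => affineChart k (F (e'.symm z))) (e' (e.symm y)))
      (fderiv ℝ (fun z => e' (e.symm z)) y (basisVec i))
      (fderiv ℝ (fun z => e' (e.symm z)) y (basisVec j))
    simp only [WithLp.toLp_ofLp] at h1
    rw [← h1, Matrix.mul_apply, Finset.sum_comm]
    refine Finset.sum_congr rfl fun b _ => ?_
    rw [Matrix.mul_apply, Finset.sum_mul]
    refine Finset.sum_congr rfl fun a _ => ?_
    rw [metricMatrix_inducedMetric hF.contMDiff he' ht hk', hx]
    simp only [jacobian, Matrix.transpose_apply, Matrix.of_apply]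
    ring

end ComplexProjectiveSpace

/-! ### One-forms proportional to `(JN)^♭` -/

namespace ChartGeometry

variable {n : ℕ} {M : Type*} [TopologicalSpace M] [ChartedSpace (EuclideanSpace ℝ (Fin n)) M]
  {e : OpenPartialHomeomorph M (EuclideanSpace ℝ (Fin n))} {y : EuclideanSpace ℝ (Fin n)}

/-- The linear form with the components `a`. -/
def covectorOfComponents (a : Fin n → ℝ) : EuclideanSpace ℝ (Fin n) →L[ℝ] ℝ :=
  ∑ i, a i • EuclideanSpace.proj i

theorem covectorOfComponents_apply (a : Fin n → ℝ) (v : EuclideanSpace ℝ (Fin n)) :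
    covectorOfComponents a v = ∑ i, a i * v i := by
  simp [covectorOfComponents]

theorem covectorOfComponents_basisVec (a : Fin n → ℝ) (i : Fin n) :
    covectorOfComponents a (basisVec i) = a i := by
  simp [covectorOfComponents_apply, basisVec]

theorem contDiffAt_covectorOfComponents {w : EuclideanSpace ℝ (Fin n) → Fin n → ℝ}
    {k : WithTop ℕ∞} (hw : ∀ i, ContDiffAt ℝ k (fun z => w z i) y) :
    ContDiffAt ℝ k (fun z => covectorOfComponents (w z)) y :=
  ContDiffAt.sum fun i _ => (hw i).smul contDiffAt_const

theorem fderiv_covectorOfComponents_comm {w : EuclideanSpace ℝ (Fin n) → Fin n → ℝ}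
    (hw : ∀ i, DifferentiableAt ℝ (fun z => w z i) y) (hd : ∀ i j, extDerivOne w y i j = 0)
    (u v : EuclideanSpace ℝ (Fin n)) :
    fderiv ℝ (fun z => covectorOfComponents (w z)) y u v
      = fderiv ℝ (fun z => covectorOfComponents (w z)) y v u := by
  have key : ∀ u v : EuclideanSpace ℝ (Fin n),
      fderiv ℝ (fun z => covectorOfComponents (w z)) y u v
        = ∑ i, ∑ j, u j * v i * partialDeriv j (fun z => w z i) y := by
    intro u v
    have h1 : HasFDerivAt (fun z => covectorOfComponents (w z)) _ y :=
      HasFDerivAt.fun_sum fun i (_ : i ∈ Finset.univ) =>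
        (hw i).hasFDerivAt.smul_const (EuclideanSpace.proj i : EuclideanSpace ℝ (Fin n) →L[ℝ] ℝ)
    rw [h1.fderiv]
    simp only [sum_apply, ContinuousLinearMap.smulRight_apply, smul_apply, smul_eq_mul]
    refine Finset.sum_congr rfl fun i _ => ?_
    conv_lhs => rw [← sum_smul_basisVec u]
    simp only [map_sum, map_smul, smul_eq_mul, Finset.sum_mul, partialDeriv]
    refine Finset.sum_congr rfl fun j _ => ?_
    rw [mul_right_comm]
    rfl
  rw [key, key, Finset.sum_comm]
  refine Finset.sum_congr rfl fun i _ => Finset.sum_congr rfl fun j _ => ?_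
  have h2 : partialDeriv i (fun z => w z j) y = partialDeriv j (fun z => w z i) y :=
    sub_eq_zero.1 (hd i j)
  rw [h2]
  ring

theorem covectorOfComponents_formComponents [IsManifold (𝓡 n) ∞ M]
    (α : ∀ x : M, TangentSpace (𝓡 n) x →L[ℝ] ℝ)
    (he : e ∈ IsManifold.maximalAtlas (𝓡 n) ∞ M) (hy : y ∈ e.target)
    (v : EuclideanSpace ℝ (Fin n)) :
    covectorOfComponents (formComponents α e y) v = α (e.symm y) (coordVec e y v) := by
  let A : M → EuclideanSpace ℝ (Fin n) →L[ℝ] ℝ := α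
  have hA : ∀ v, α (e.symm y) (coordVec e y v) = A (e.symm y) (coordMap e y v) := by
    intro v
    rw [← coordVec_eq he hy]
    rfl
  rw [hA, covectorOfComponents_apply]
  conv_rhs => rw [← sum_smul_basisVec v]
  simp only [map_sum, map_smul, smul_eq_mul]
  refine Finset.sum_congr rfl fun i _ => ?_
  rw [mul_comm, formComponents, hA]

end ChartGeometry

/-! ### From the form on the hypersurface to the linear data in an affine chart. -/

namespace ComplexProjectiveSpace

open ChartGeometry

variable {m n : ℕ}

/-- If `A ξ = i N`, then `w = r G ξ` and `ξ` is a unit vector. So the squared length of the covector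
in the induced metric is `r²`. -/
theorem IsHypersurfaceCovector.dotProduct_inv_mulVec (hdim : n + 1 = 2 * m)
    {z : EuclideanSpace ℂ (Fin m)} {A : EuclideanSpace ℝ (Fin n) →L[ℝ] EuclideanSpace ℂ (Fin m)}
    {ℓ : EuclideanSpace ℝ (Fin n) →L[ℝ] ℝ} {r : ℝ} {N : EuclideanSpace ℂ (Fin m)}
    (h : IsHypersurfaceCovector z A ℓ r N) {G : Matrix (Fin n) (Fin n) ℝ} (hdet : G.det ≠ 0)
    (hG : ∀ i j, G i j = affineFubiniStudy z (A (basisVec i)) (A (basisVec j)))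
    {w : Fin n → ℝ} (hw : ∀ i, w i = ℓ (basisVec i)) : w ⬝ᵥ G⁻¹.mulVec w = r ^ 2 := by
  obtain ⟨ξ, hξ⟩ := h.exists_unit_tangent (by simpa using hdim)
  have hsum : ∀ a b : EuclideanSpace ℝ (Fin n),
      a.ofLp ⬝ᵥ G.mulVec b.ofLp = affineFubiniStudy z (A a) (A b) := by
    intro a b
    have h1 := sum_affineFubiniStudy z A a.ofLp b.ofLp
    simp only [WithLp.toLp_ofLp] at h1
    rw [← h1]
    simp only [dotProduct, Matrix.mulVec, hG, Finset.mul_sum]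
    exact Finset.sum_congr rfl fun i _ => Finset.sum_congr rfl fun j _ => by ring
  have hwG : w = r • G.mulVec ξ.ofLp := by
    funext i
    have h1 := hsum (basisVec i) ξ
    have h2 : (basisVec i).ofLp ⬝ᵥ G.mulVec ξ.ofLp = G.mulVec ξ.ofLp i := by
      simp [basisVec]
    rw [h2] at h1
    rw [Pi.smul_apply, h1, hw, h.covector, hξ, affineFubiniStudy_comm, smul_eq_mul]
  have hinv : G⁻¹.mulVec (G.mulVec ξ.ofLp) = ξ.ofLp := by
    rw [Matrix.mulVec_mulVec, Matrix.nonsing_inv_mul _ (isUnit_iff_ne_zero.2 hdet),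
      Matrix.one_mulVec]
  have hself : G.mulVec ξ.ofLp ⬝ᵥ ξ.ofLp = 1 := by
    rw [dotProduct_comm, hsum, hξ, affineFubiniStudy_I_smul_I_smul, h.unit]
  rw [hwG, Matrix.mulVec_smul, hinv, smul_dotProduct, dotProduct_smul, hself]
  simp [sq]

variable {M : Type*} [TopologicalSpace M] [ChartedSpace (EuclideanSpace ℝ (Fin n)) M]
  [IsManifold (𝓡 n) ∞ M] {e : OpenPartialHomeomorph M (EuclideanSpace ℝ (Fin n))}
  {F : M → ComplexProjectiveSpace m} {α : ∀ x : M, TangentSpace (𝓡 n) x →L[ℝ] ℝ}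
  {y : EuclideanSpace ℝ (Fin n)} {k : Fin (m + 1)}

/-- `α x = r (JN)^♭` for a unit normal vector `N` at `x`. -/
def IsNormalMultiple (F : M → ComplexProjectiveSpace m)
    (α : ∀ x : M, TangentSpace (𝓡 n) x →L[ℝ] ℝ) (x : M) (r : ℝ) : Prop :=
  ∃ N : TangentSpace 𝓘(ℝ, EuclideanSpace ℂ (Fin m)) (F x), IsUnitNormal (n := n) fubiniStudy F x N ∧
    ∀ v : TangentSpace (𝓡 n) x, α x v = r * fubiniStudy (F x) (complexStructure (F x) N)
      (mfderiv (𝓡 n) 𝓘(ℝ, EuclideanSpace ℂ (Fin m)) F x v)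

theorem exists_isHypersurfaceCovector
    (hF : Manifold.IsSmoothEmbedding (𝓡 n) 𝓘(ℝ, EuclideanSpace ℂ (Fin m)) ∞ F)
    (he : e ∈ IsManifold.maximalAtlas (𝓡 n) ∞ M) (hy : y ∈ e.target)
    (hk : F (e.symm y) ∈ (affineChart k).source) {r : ℝ} (h : IsNormalMultiple F α (e.symm y) r) :
    ∃ N, IsHypersurfaceCovector (affineChart k (F (e.symm y)))
      (fderiv ℝ (fun z => affineChart k (F (e.symm z))) y)
      (covectorOfComponents (formComponents α e y)) r N := by
  obtain ⟨N, ⟨hN1, hN2⟩, hα⟩ := h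
  obtain ⟨D, hDI, hD, hDF⟩ := exists_isometry_affineChart hF.contMDiff he hy hk
  refine ⟨D N, ?_, ?_, fun v => ?_, fun v => ?_⟩
  · exact injective_fderiv_of_isImmersionAt hF.contMDiff (hF.isImmersion.isImmersionAt _) he
      (affineChart_mem_maximalAtlas k) hy hk
  · exact (hD N N).trans hN1
  · rw [← hDF]
    exact (hD _ _).trans (hN2 _)
  · let N' : EuclideanSpace ℂ (Fin m) := N
    have h1 := hD (Complex.I • N') (mfderiv (𝓡 n) 𝓘(ℝ, EuclideanSpace ℂ (Fin m)) F (e.symm y)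
      (coordVec e y v))
    rw [hDI, hDF] at h1
    rw [covectorOfComponents_formComponents α he hy, hα]
    exact congrArg (r * ·) h1.symm

/-- The factor `r` is fixed only up to the sign of the normal, but `r²` is the squared length of
`α`, hence continuous. -/
theorem continuous_sq_of_isNormalMultiple (hn : n + 1 = 2 * m)
    (hF : Manifold.IsSmoothEmbedding (𝓡 n) 𝓘(ℝ, EuclideanSpace ℂ (Fin m)) ∞ F)
    (hα : IsSmoothOneForm α) {r : M → ℝ} (hr : ∀ x, IsNormalMultiple F α x (r x)) :
    Continuous fun x => r x ^ 2 := by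
  rw [continuous_iff_continuousAt]
  intro x
  set e := chartAt (EuclideanSpace ℝ (Fin n)) x
  have he : e ∈ IsManifold.maximalAtlas (𝓡 n) ∞ M := IsManifold.chart_mem_maximalAtlas x
  have hxe : x ∈ e.source := mem_chart_source _ x
  have hG := isCompatibleMetric_inducedMetric hF
  set G := metricMatrix (inducedMetric (n := n) fubiniStudy F) e
  have hc : ContinuousOn (fun y => formComponents α e y ⬝ᵥ (G y)⁻¹.mulVec (formComponents α e y))
      e.target := by
    simp only [dotProduct, Matrix.mulVec]
    refine continuousOn_finsetSum _ fun i _ => (hα e he i).continuousOn.mul ?_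
    exact continuousOn_finsetSum _ fun j _ =>
      ((hG.smooth e he).contDiffOn_inv i j).continuousOn.mul (hα e he j).continuousOn
  refine (((hc.continuousAt (e.open_target.mem_nhds (e.map_source hxe))).comp
    (e.continuousAt hxe))).congr ?_
  filter_upwards [e.open_source.mem_nhds hxe] with x' hx'
  have ht := e.map_source hx'
  obtain ⟨k, hk⟩ := exists_rep_ne_zero (F (e.symm (e x')))
  have hk : F (e.symm (e x')) ∈ (affineChart k).source := hk
  obtain ⟨N, hN⟩ := exists_isHypersurfaceCovector (r := r (e.symm (e x'))) hF he ht hk (hr _)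
  rw [Function.comp_apply, hN.dotProduct_inv_mulVec hn ((hG.smooth e he).det_pos ht).ne'
    (metricMatrix_inducedMetric hF.contMDiff he ht hk)
    fun i => (covectorOfComponents_basisVec _ i).symm, e.left_inv hx']

theorem eq_zero_of_isMaxOn_sq [T2Space M] [CompactSpace M] (hm : 2 ≤ m) (hn : n + 1 = 2 * m)
    (hF : Manifold.IsSmoothEmbedding (𝓡 n) 𝓘(ℝ, EuclideanSpace ℂ (Fin m)) ∞ F)
    (hα : IsHarmonicOneForm (inducedMetric fubiniStudy F) α) {r : M → ℝ}
    (hr : ∀ x, IsNormalMultiple F α x (r x)) {x : M} (hx : ∀ x', r x' ^ 2 ≤ r x ^ 2) :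
    r x = 0 := by
  set e := chartAt (EuclideanSpace ℝ (Fin n)) x
  have he : e ∈ IsManifold.maximalAtlas (𝓡 n) ∞ M := IsManifold.chart_mem_maximalAtlas x
  have hxe : x ∈ e.source := mem_chart_source _ x
  have ht := e.map_source hxe
  obtain ⟨k, hk⟩ := exists_rep_ne_zero (F (e.symm (e x)))
  have hk : F (e.symm (e x)) ∈ (affineChart k).source := hk
  have hsm : ∀ y ∈ e.target, ∀ i, ContDiffAt ℝ ∞ (fun z => formComponents α e z i) y :=
    fun y hy i => (hα.1 e he i).contDiffAt (e.open_target.mem_nhds hy)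
  have h0 : r (e.symm (e x)) = 0 := by
    refine eq_zero_of_closed_of_isLocalMax (R := fun y => r (e.symm y))
      (f := fun z => affineChart k (F (e.symm z)))
      (w := fun z => covectorOfComponents (formComponents α e z)) (by simpa using hn) hm
      (contDiffAt_inCharts hF.contMDiff he (affineChart_mem_maximalAtlas k) ht hk)
      (contDiffAt_covectorOfComponents (hsm _ ht)) ?_ ?_ ?_
    · filter_upwards [eventually_mem_affineChart_source hF.contMDiff ht hk] with y hy
      exact exists_isHypersurfaceCovector hF he hy.1 hy.2 (hr _)
    · filter_upwards [e.open_target.mem_nhds ht] with y hy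
      exact fderiv_covectorOfComponents_comm (fun i => (hsm y hy i).differentiableAt (by simp))
        fun i j => extDerivOne_eq_zero_of_harmonic (isCompatibleMetric_inducedMetric hF)
          hα.1.isCompatibleForm hα.2 he hy i j
    · refine Filter.Eventually.of_forall fun y => ?_
      simpa [e.left_inv hxe] using hx (e.symm y)
  rwa [e.left_inv hxe] at h0

end ComplexProjectiveSpace

end

/-! ### Conclusion: the maximum of the squared factor is zero. -/

theorem propositionA0 {m n : ℕ} (hm : 2 ≤ m) (hn : n + 1 = 2 * m)
    {M : Type*} [TopologicalSpace M] [T2Space M] [CompactSpace M]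
    [ChartedSpace (EuclideanSpace ℝ (Fin n)) M] [IsManifold (𝓡 n) ∞ M]
    (F : M → ComplexProjectiveSpace m)
    (hF : Manifold.IsSmoothEmbedding (𝓡 n) 𝓘(ℝ, EuclideanSpace ℂ (Fin m)) ∞ F)
    (hmin : ChartGeometry.IsMinimal (n := n) ComplexProjectiveSpace.fubiniStudy F)
    (α : ∀ x : M, TangentSpace (𝓡 n) x →L[ℝ] ℝ)
    (hα : ChartGeometry.IsHarmonicOneForm
      (ChartGeometry.inducedMetric ComplexProjectiveSpace.fubiniStudy F) α)
    (hprop : ∀ x : M, ∃ N : TangentSpace 𝓘(ℝ, EuclideanSpace ℂ (Fin m)) (F x),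
      ChartGeometry.IsUnitNormal (n := n) ComplexProjectiveSpace.fubiniStudy F x N ∧
      ∃ r : ℝ, ∀ v : TangentSpace (𝓡 n) x,
        α x v = r * ComplexProjectiveSpace.fubiniStudy (F x)
          (ComplexProjectiveSpace.complexStructure (F x) N)
          (mfderiv (𝓡 n) 𝓘(ℝ, EuclideanSpace ℂ (Fin m)) F x v)) :
    ∀ x : M, α x = 0 := by
  intro x
  have hex : ∀ x, ∃ r, ComplexProjectiveSpace.IsNormalMultiple F α x r := fun x => by
    obtain ⟨N, hN, r, hr⟩ := hprop x
    exact ⟨r, N, hN, hr⟩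
  -- The sign of `r` is arbitrary at each point; only `r²` is used below.
  choose r hr using hex
  have hcont := ComplexProjectiveSpace.continuous_sq_of_isNormalMultiple hn hF hα.1 hr
  obtain ⟨x₀, -, hx₀⟩ := isCompact_univ.exists_isMaxOn ⟨x, Set.mem_univ x⟩ hcont.continuousOn
  have hmax : ∀ x', r x' ^ 2 ≤ r x₀ ^ 2 := fun x' => hx₀ (Set.mem_univ x')
  have h0 := ComplexProjectiveSpace.eq_zero_of_isMaxOn_sq hm hn hF hα hr hmax
  have hrx : r x = 0 := by
    have := hmax x
    rw [h0] at this
    exact pow_eq_zero_iff two_ne_zero |>.1 (le_antisymm (by simpa using this) (sq_nonneg _))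
  obtain ⟨N, -, hN⟩ := hr x
  ext v
  rw [hN, hrx, zero_mul]
  rfl
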